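/- A quadrisection of a (nondegenerate) triangle is an unordered pair of perpendicular segments, each with both endpoints on the boundary of the triangle, which divide the triangle into exactly four regions, all of equal area. It is called rational if the vertices of the triangle and the four endpoints of the two segments have rational coordinates. Let $I_1$ be the triangle with vertices $(1,0),(0,0),(2-\sqrt2,\sqrt{2\sqrt2-2})$ and $I_2$ the triangle with vertices $(\tfrac12,\tfrac89),(0,0),(1,0)$. Both are isosceles, with apex the vertex listed first. Then: (1) $I_2$ has vertex angle $2\arctan(9/16)\approx 58.72^\circ$. It has exactly two quadrisections, and up to similarity it is the only isosceles triangle with exactly two quadrisections. Exactly one of the two quadrisections of $I_2$ is rational. (2) $I_1$ has vertex angle $\arcsin\sqrt{2\sqrt2-2}=\arccos(\sqrt2-1)\approx 65.53^\circ$, which is greater than $\pi/3$, and it has exactly one quadrisection. Every isosceles triangle which has vertex angle greater than $\pi/3$ and exactly one quadrisection, and which is not similar to $I_1$, has a vertex angle larger than that of $I_1$. (3) Every triangle having an angle that is at least the vertex angle of $I_1$ has exactly one quadrisection. -/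

import Mathlib

/-- The Euclidean plane. -/
abbrev Plane : Type := EuclideanSpace ℝ (Fin 2)

/-- The closed triangular region with vertices `T 0`, `T 1`, `T 2`. -/
def triangleRegion (T : Fin 3 → Plane) : Set Plane :=
  convexHull ℝ (Set.range T)

/-- The regions into which two sets `s`, `t` (in the application: two segments) divide the
triangle `T`: the connected components of what is left of the interior of the triangle
when `s` and `t` are removed. -/
def dividedRegions (T : Fin 3 → Plane) (s t : Set Plane) : Set (Set Plane) :=
  {K | ∃ p ∈ interior (triangleRegion T) \ (s ∪ t),
    K = connectedComponentIn (interior (triangleRegion T) \ (s ∪ t)) p}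

/-- The segments `XP` and `YQ` form a quadrisection of the triangle `T`: they are nondegenerate,
they run from boundary to boundary, they are perpendicular, and they divide the triangle
into exactly four regions, each having one fourth of the area of the triangle. -/
structure IsQuadrisection (T : Fin 3 → Plane) (X P Y Q : Plane) : Prop where
  memX : X ∈ frontier (triangleRegion T)
  memP : P ∈ frontier (triangleRegion T)
  memY : Y ∈ frontier (triangleRegion T)
  memQ : Q ∈ frontier (triangleRegion T)
  ne_XP : X ≠ P
  ne_YQ : Y ≠ Q
  perp : inner ℝ (P - X) (Q - Y) = 0
  four_regions : (dividedRegions T (segment ℝ X P) (segment ℝ Y Q)).encard = 4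
  area_eq : ∀ K ∈ dividedRegions T (segment ℝ X P) (segment ℝ Y Q),
    MeasureTheory.volume K = MeasureTheory.volume (triangleRegion T) / 4

/-- The set of all quadrisections of `T`. A quadrisection is an unordered pair of segments, each
segment being a set of points, so neither the order of the two segments nor the order of
the endpoints of a segment matters. -/
def quadrisections (T : Fin 3 → Plane) : Set (Sym2 (Set Plane)) :=
  {q | ∃ X P Y Q : Plane, IsQuadrisection T X P Y Q ∧
    q = Sym2.mk (segment ℝ X P) (segment ℝ Y Q)}

/-- A point with rational coordinates. -/
def IsRationalPoint (p : Plane) : Prop :=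
  ∀ i, ∃ r : ℚ, p i = (r : ℝ)

/-- The rational quadrisections of `T`: the vertices of the triangle and the endpoints of the two
segments are rational points. -/
def rationalQuadrisections (T : Fin 3 → Plane) : Set (Sym2 (Set Plane)) :=
  {q | (∀ i, IsRationalPoint (T i)) ∧ ∃ X P Y Q : Plane, IsQuadrisection T X P Y Q ∧
    IsRationalPoint X ∧ IsRationalPoint P ∧ IsRationalPoint Y ∧ IsRationalPoint Q ∧
    q = Sym2.mk (segment ℝ X P) (segment ℝ Y Q)}

/-- `T` is a nondegenerate isosceles triangle, listed with the vertex at which the two equal sides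
meet (the apex) first. -/
def IsIsoscelesTriangle (T : Fin 3 → Plane) : Prop :=
  AffineIndependent ℝ T ∧ dist (T 0) (T 1) = dist (T 0) (T 2)

/-- The angle of `T` at the vertex `T 0`; for an isosceles triangle listed apex first this is its
vertex angle. -/
noncomputable def vertexAngle (T : Fin 3 → Plane) : ℝ :=
  EuclideanGeometry.angle (T 1) (T 0) (T 2)

/-- The triangle `I₁`, with apex `(1, 0)`. -/
noncomputable def triangleI₁ : Fin 3 → Plane :=
  ![!₂[1, 0], !₂[0, 0], !₂[2 - √2, √(2 * √2 - 2)]]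

/-- The triangle `I₂`, with apex `(1/2, 8/9)`. -/
noncomputable def triangleI₂ : Fin 3 → Plane :=
  ![!₂[1 / 2, 8 / 9], !₂[0, 0], !₂[1, 0]]

/-!
A pair of perpendicular chords dividing a triangle into four regions of equal area is described by
one real parameter for each side of the triangle, and the perpendicularity condition is linear in
the Conway quantities `α = ⟨B - A, C - A⟩`, `β = ⟨C - B, A - B⟩`, `γ = ⟨A - C, B - C⟩`.

*From regions to areas.* Inside the triangle a chord agrees with the line carrying it
(`mem_segment_iff_lineForm`), so the connected components of the complement of the two chords are
the nonempty ones among the four convex sets on which both linear forms have constant sign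
(`dividedRegions_eq`). Hence there are four regions of equal area exactly when both lines halve the
triangle and one of the four sign regions is a quarter of it (`isQuadrisection_iff`,
`area_signRegion_eq_quarter_iff`).

*From areas to an arc.* The endpoints of each chord lie on two sides, so the two chords have feet on
a common side `BC`. If the other endpoints lie on a common side as well, the areas are inconsistent
(`not_fourQuarters_of_same_corner`). Otherwise the feet are at fractions `x` (from `C`) and `y`
(from `B`) of `BC`, and the area conditions become `4 (x + y - 1)² = 2 x² + 2 y² - 1`, an arc of a
hyperbola (`IsArc`). The chords are perpendicular exactly when `α = p β + q γ` with
`p = 2 x² (2 y² - 1)` and `q = 2 y² (2 x² - 1)` (`PerpCond`). This gives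
`mem_quadrisections_iff`. At an end of the arc one chord is a median, and the pair belongs to the
families of two sides (`arcChord_end_glue`).

*The coefficient curve.* With a rational parameter `t` on the arc, `p + q = arcP t` and
`q - p = arcM t`, and `arcP t - 1 = arcSlope t * (1 - arcM t)` (`arcP_eq`). The key fact is that
`arcSlope` is strictly increasing, from `0` to `3 - 2√2` (`arcSlope_strictMonoOn`): seen from its
end, the curve `(p, q)` is strictly concave.

*Counting.* Let `α ≤ β ≤ γ`. On the side opposite to the middle angle there is a solution by the
intermediate value theorem, and concavity makes it unique (`exists_sideEq`, `sideEq_unique`). When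
the largest angle has cosine at most `√2 - 1`, the other two sides contribute only ends of the arc,
which are identified with that solution (`sideEq_largest`, `sideEq_smallest`). For an isosceles
triangle the axis and a parallel to the base always form a quadrisection; every other one has a
distinct mirror image, except the symmetric pair on the base, which occurs only for
`α : β = 175 : 162`, the ratio of `I₂` (`conway_of_encard_eq_two`, `quadrisections_eq_pair`). If the
apex angle lies strictly between `π / 3` and that of `I₁`, then `arcSlope` takes the value
`(β - α) / (α + β)` inside the arc, so there is a further pair on the legs
(`encard_ne_one_of_between`).
-/

open MeasureTheory Set

/-! ### Plane triangles, coordinates and area -/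

/-- The cross product (determinant) of two plane vectors. -/
def cross (a b : Plane) : ℝ := a 0 * b 1 - a 1 * b 0

/-- The affine form whose zero set is the line through `X` and `P` (for `X ≠ P`). -/
def lineForm (X P z : Plane) : ℝ := cross (P - X) (z - X)

lemma cross_sub_sub (A B C : Plane) :
    cross (B - A) (C - A) = (B 0 - A 0) * (C 1 - A 1) - (B 1 - A 1) * (C 0 - A 0) := by
  simp [cross]

lemma lineForm_eq (X P z : Plane) :
    lineForm X P z = (P 0 - X 0) * (z 1 - X 1) - (P 1 - X 1) * (z 0 - X 0) := by
  simp [lineForm, cross]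

/-- The open triangle with vertices `A`, `B`, `C`, in barycentric coordinates. -/
def openTriangle (A B C : Plane) : Set Plane :=
  {z | ∃ a b c : ℝ, 0 < a ∧ 0 < b ∧ 0 < c ∧ a + b + c = 1 ∧ z = a • A + b • B + c • C}

lemma openTriangle_swap (A B C : Plane) : openTriangle A C B = openTriangle A B C := by
  ext z
  constructor <;> rintro ⟨a, b, c, ha, hb, hc, h, rfl⟩ <;>
    exact ⟨a, c, b, ha, hc, hb, by linarith, by abel⟩

lemma openTriangle_rotate (A B C : Plane) : openTriangle B C A = openTriangle A B C := by
  ext z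
  constructor
  · rintro ⟨a, b, c, ha, hb, hc, h, rfl⟩
    exact ⟨c, a, b, hc, ha, hb, by linarith, by abel⟩
  · rintro ⟨a, b, c, ha, hb, hc, h, rfl⟩
    exact ⟨b, c, a, hb, hc, ha, by linarith, by abel⟩

lemma plane_ext {z w : Plane} (h0 : z 0 = w 0) (h1 : z 1 = w 1) : z = w := by
  ext i; fin_cases i <;> assumption

lemma cross_ne_zero_of_affineIndependent {T : Fin 3 → Plane} (hT : AffineIndependent ℝ T) :
    cross (T 1 - T 0) (T 2 - T 0) ≠ 0 := by
  intro h
  rw [cross_sub_sub] at h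
  rw [affineIndependent_iff] at hT
  have key : ∀ w0 w1 w2 : ℝ, w0 + w1 + w2 = 0 →
      w0 * T 0 0 + w1 * T 1 0 + w2 * T 2 0 = 0 →
      w0 * T 0 1 + w1 * T 1 1 + w2 * T 2 1 = 0 → w0 = 0 ∧ w1 = 0 ∧ w2 = 0 := by
    intro w0 w1 w2 hs h0 h1
    have := hT Finset.univ ![w0, w1, w2] (by simpa [Fin.sum_univ_three] using hs)
      (by
        apply plane_ext
        · simpa [Fin.sum_univ_three] using h0
        · simpa [Fin.sum_univ_three] using h1)
    exact ⟨by simpa using this 0, by simpa using this 1, by simpa using this 2⟩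
  obtain ⟨-, h1, h2⟩ := key ((T 1 0 - T 0 0) - (T 2 0 - T 0 0)) (T 2 0 - T 0 0) (-(T 1 0 - T 0 0))
    (by ring) (by ring) (by linarith)
  obtain ⟨-, h3, h4⟩ := key ((T 1 1 - T 0 1) - (T 2 1 - T 0 1)) (T 2 1 - T 0 1) (-(T 1 1 - T 0 1))
    (by ring) (by linarith) (by ring)
  obtain ⟨h5, -, -⟩ := key (-1) 1 0 (by ring) (by linarith) (by linarith)
  norm_num at h5

lemma affineIndependent_of_cross_ne_zero {T : Fin 3 → Plane}
    (h : cross (T 1 - T 0) (T 2 - T 0) ≠ 0) : AffineIndependent ℝ T := by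
  rw [affineIndependent_iff_of_fintype]
  intro w hw hz
  rw [Finset.univ.weightedVSub_eq_linear_combination hw] at hz
  rw [cross_sub_sub] at h
  simp only [Fin.sum_univ_three] at hw hz
  have h0 := congrArg (fun z : Plane => z 0) hz
  have h1 := congrArg (fun z : Plane => z 1) hz
  simp at h0 h1
  have e0 : w 0 = -(w 1 + w 2) := by linarith
  rw [e0] at h0 h1
  have h2 : w 2 = 0 := by
    refine (mul_eq_zero.1 (?_ : w 2 * ((T 1 0 - T 0 0) * (T 2 1 - T 0 1) -
      (T 1 1 - T 0 1) * (T 2 0 - T 0 0)) = 0)).resolve_right h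
    linear_combination (T 1 0 - T 0 0) * h1 - (T 1 1 - T 0 1) * h0
  have h3 : w 1 = 0 := by
    refine (mul_eq_zero.1 (?_ : w 1 * ((T 1 0 - T 0 0) * (T 2 1 - T 0 1) -
      (T 1 1 - T 0 1) * (T 2 0 - T 0 0)) = 0)).resolve_right h
    linear_combination -(T 2 0 - T 0 0) * h1 + (T 2 1 - T 0 1) * h0
  intro i
  fin_cases i
  · simp [e0, h2, h3]
  · exact h3
  · exact h2

/-- The vertices of a nondegenerate triangle as an affine basis of the plane. -/
noncomputable def triangleBasis (T : Fin 3 → Plane) (hT : AffineIndependent ℝ T) :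
    AffineBasis (Fin 3) ℝ Plane :=
  ⟨T, hT, by rw [hT.affineSpan_eq_top_iff_card_eq_finrank_add_one]; simp⟩

lemma triangleBasis_coord (T : Fin 3 → Plane) (hT : AffineIndependent ℝ T) (w : Fin 3 → ℝ)
    (hw : w 0 + w 1 + w 2 = 1) (i : Fin 3) :
    (triangleBasis T hT).coord i (w 0 • T 0 + w 1 • T 1 + w 2 • T 2) = w i := by
  have hs : Finset.univ.sum w = 1 := by simpa [Fin.sum_univ_three] using hw
  have := (triangleBasis T hT).coord_apply_combination_of_mem (Finset.mem_univ i) hs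
  rw [Finset.affineCombination_eq_linear_combination _ _ _ hs, Fin.sum_univ_three] at this
  exact this

lemma mem_triangleRegion {T : Fin 3 → Plane} (hT : AffineIndependent ℝ T) {z : Plane} :
    z ∈ triangleRegion T ↔ ∃ w : Fin 3 → ℝ, (∀ i, 0 ≤ w i) ∧ w 0 + w 1 + w 2 = 1 ∧
      z = w 0 • T 0 + w 1 • T 1 + w 2 • T 2 := by
  have h := (triangleBasis T hT).convexHull_eq_nonneg_coord
  change triangleRegion T = _ at h
  rw [h]
  constructor
  · intro hz
    refine ⟨fun i => (triangleBasis T hT).coord i z, hz, ?_, ?_⟩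
    · have := (triangleBasis T hT).sum_coord_apply_eq_one z
      rwa [Fin.sum_univ_three] at this
    · have := (triangleBasis T hT).linear_combination_coord_eq_self z
      rw [Fin.sum_univ_three] at this
      exact this.symm
  · rintro ⟨w, hw, hs, rfl⟩ i
    rw [triangleBasis_coord T hT w hs]
    exact hw i

lemma interior_triangleRegion {T : Fin 3 → Plane} (hT : AffineIndependent ℝ T) :
    interior (triangleRegion T) = openTriangle (T 0) (T 1) (T 2) := by
  have h := (triangleBasis T hT).interior_convexHull
  change interior (triangleRegion T) = _ at h
  rw [h]
  ext z
  constructor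
  · intro hz
    refine ⟨_, _, _, hz 0, hz 1, hz 2, ?_, ?_⟩
    · have := (triangleBasis T hT).sum_coord_apply_eq_one z
      rwa [Fin.sum_univ_three] at this
    · have := (triangleBasis T hT).linear_combination_coord_eq_self z
      rw [Fin.sum_univ_three] at this
      exact this.symm
  · rintro ⟨a, b, c, ha, hb, hc, hs, rfl⟩ i
    have := triangleBasis_coord T hT ![a, b, c] (by simpa using hs) i
    simp only [Matrix.cons_val_zero, Matrix.cons_val_one, Matrix.cons_val] at this
    rw [this]
    fin_cases i <;> simpa

lemma isClosed_triangleRegion (T : Fin 3 → Plane) : IsClosed (triangleRegion T) :=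
  (Set.finite_range T).isClosed_convexHull ℝ

lemma convex_triangleRegion (T : Fin 3 → Plane) : Convex ℝ (triangleRegion T) :=
  by unfold triangleRegion; exact convex_convexHull (𝕜 := ℝ) (range T)

lemma mem_frontier_triangleRegion {T : Fin 3 → Plane} (hT : AffineIndependent ℝ T) {z : Plane} :
    z ∈ frontier (triangleRegion T) ↔ ∃ w : Fin 3 → ℝ, (∀ i, 0 ≤ w i) ∧ w 0 + w 1 + w 2 = 1 ∧
      (∃ i, w i = 0) ∧ z = w 0 • T 0 + w 1 • T 1 + w 2 • T 2 := by
  have hI : interior (triangleRegion T) = {x | ∀ i, 0 < (triangleBasis T hT).coord i x} :=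
    (triangleBasis T hT).interior_convexHull
  rw [(isClosed_triangleRegion T).frontier_eq, mem_sdiff, mem_triangleRegion hT, hI]
  constructor
  · rintro ⟨⟨w, hw, hs, rfl⟩, hn⟩
    refine ⟨w, hw, hs, ?_, rfl⟩
    simp only [mem_ofPred_eq, triangleBasis_coord T hT w hs, not_forall, not_lt] at hn
    obtain ⟨i, hi⟩ := hn
    exact ⟨i, le_antisymm hi (hw i)⟩
  · rintro ⟨w, hw, hs, ⟨i, hi⟩, rfl⟩
    refine ⟨⟨w, hw, hs, rfl⟩, fun hn => ?_⟩
    have := hn i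
    rw [triangleBasis_coord T hT w hs, hi] at this
    exact lt_irrefl _ this

/-- The unit of area: the open triangle with vertices `0`, `e₀`, `e₁`. -/
def unitTriangle : Set Plane := {z | 0 < z 0 ∧ 0 < z 1 ∧ z 0 + z 1 < 1}

lemma volume_unitTriangle_pos : 0 < volume unitTriangle := by
  have ho : IsOpen unitTriangle := by
    have c0 : Continuous fun z : Plane => z 0 := by fun_prop
    have c1 : Continuous fun z : Plane => z 1 := by fun_prop
    exact (isOpen_lt continuous_const c0).inter
      ((isOpen_lt continuous_const c1).inter (isOpen_lt (c0.add c1) continuous_const))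
  refine ho.measure_pos _ ⟨!₂[1/4, 1/4], ?_⟩
  norm_num [unitTriangle]

lemma volume_unitTriangle_lt_top : volume unitTriangle < ⊤ := by
  refine (measure_mono (t := Metric.closedBall (0 : Plane) 2) ?_).trans_lt
    measure_closedBall_lt_top
  rintro z ⟨h0, h1, h2⟩
  rw [mem_closedBall_zero_iff, EuclideanSpace.norm_eq, Fin.sum_univ_two]
  refine Real.sqrt_le_iff.2 ⟨by norm_num, ?_⟩
  simp only [Real.norm_eq_abs, sq_abs]
  nlinarith

/-- The linear map sending the standard basis to `u`, `v`. -/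
noncomputable def frameMap (u v : Plane) : Plane →ₗ[ℝ] Plane where
  toFun z := z 0 • u + z 1 • v
  map_add' z w := by simp [add_smul]; abel
  map_smul' r z := by simp [mul_smul]

lemma det_frameMap (u v : Plane) : LinearMap.det (frameMap u v) = cross u v := by
  rw [← LinearMap.det_toMatrix (EuclideanSpace.basisFun (Fin 2) ℝ).toBasis, Matrix.det_fin_two]
  simp [LinearMap.toMatrix_apply, frameMap, cross]
  ring

lemma openTriangle_eq_image (A B C : Plane) :
    openTriangle A B C = (fun z => A + z) '' (frameMap (B - A) (C - A) '' unitTriangle) := by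
  ext z
  simp only [mem_image, exists_exists_and_eq_and]
  constructor
  · rintro ⟨a, b, c, ha, hb, hc, hs, rfl⟩
    refine ⟨!₂[b, c], ⟨by simpa, by simpa, by simp; linarith⟩, ?_⟩
    obtain rfl : a = 1 - b - c := by linarith
    simp only [frameMap, LinearMap.coe_mk, AddHom.coe_mk]
    apply plane_ext <;> simp <;> ring
  · rintro ⟨w, ⟨h0, h1, h2⟩, rfl⟩
    refine ⟨1 - w 0 - w 1, w 0, w 1, by linarith, h0, h1, by ring, ?_⟩
    simp only [frameMap, LinearMap.coe_mk, AddHom.coe_mk]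
    apply plane_ext <;> simp <;> ring

lemma volume_openTriangle (A B C : Plane) :
    volume (openTriangle A B C) =
      ENNReal.ofReal |cross (B - A) (C - A)| * volume unitTriangle := by
  rw [openTriangle_eq_image, image_add_left, measure_preimage_add,
    Measure.addHaar_image_linearMap, det_frameMap]

/-- Area, as a real number, in units of the standard triangle. -/
noncomputable def area (s : Set Plane) : ℝ := (volume s).toReal / (volume unitTriangle).toReal

lemma volume_unitTriangle_toReal_pos : 0 < (volume unitTriangle).toReal :=
  ENNReal.toReal_pos volume_unitTriangle_pos.ne' volume_unitTriangle_lt_top.ne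

lemma area_openTriangle (A B C : Plane) :
    area (openTriangle A B C) = |cross (B - A) (C - A)| := by
  rw [area, volume_openTriangle, ENNReal.toReal_mul, ENNReal.toReal_ofReal (abs_nonneg _),
    mul_div_assoc, div_self volume_unitTriangle_toReal_pos.ne', mul_one]

lemma convex_openTriangle (A B C : Plane) : Convex ℝ (openTriangle A B C) := by
  rintro _ ⟨a, b, c, ha, hb, hc, h, rfl⟩ _ ⟨a', b', c', ha', hb', hc', h', rfl⟩ r s hr hs hrs
  refine ⟨r * a + s * a', r * b + s * b', r * c + s * c', ?_, ?_, ?_, ?_, ?_⟩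
  · rcases hr.eq_or_lt with rfl | hr
    · have : s = 1 := by linarith
      subst this; simpa
    · positivity
  · rcases hr.eq_or_lt with rfl | hr
    · have : s = 1 := by linarith
      subst this; simpa
    · positivity
  · rcases hr.eq_or_lt with rfl | hr
    · have : s = 1 := by linarith
      subst this; simpa
    · positivity
  · linear_combination r * h + s * h' + hrs
  · apply plane_ext <;> simp <;> ring

lemma volume_triangleRegion {T : Fin 3 → Plane} (hT : AffineIndependent ℝ T) :
    volume (triangleRegion T) = volume (openTriangle (T 0) (T 1) (T 2)) := by
  rw [← interior_triangleRegion hT]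
  refine le_antisymm ?_ (measure_mono interior_subset)
  have h := (convex_triangleRegion T).addHaar_frontier volume
  calc volume (triangleRegion T) ≤
        volume (interior (triangleRegion T) ∪ frontier (triangleRegion T)) := by
          apply measure_mono
          rw [← closure_eq_interior_union_frontier]
          exact subset_closure
    _ ≤ _ := (measure_union_le _ _).trans (by rw [h, add_zero])

/-! ### Regions cut out by two chords -/

lemma continuous_lineForm (X P : Plane) : Continuous (lineForm X P) := by
  have : lineForm X P =
      fun z => (P 0 - X 0) * (z 1 - X 1) - (P 1 - X 1) * (z 0 - X 0) := by
    ext z; exact lineForm_eq X P z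
  rw [this]
  fun_prop

lemma lineForm_combination (X P z w : Plane) {a b : ℝ} (h : a + b = 1) :
    lineForm X P (a • z + b • w) = a * lineForm X P z + b * lineForm X P w := by
  obtain rfl : b = 1 - a := by linarith
  simp only [lineForm_eq, PiLp.add_apply, PiLp.smul_apply, smul_eq_mul]
  ring

lemma lineForm_combination₃ (X P z w y : Plane) {a b c : ℝ} (h : a + b + c = 1) :
    lineForm X P (a • z + b • w + c • y) =
      a * lineForm X P z + b * lineForm X P w + c * lineForm X P y := by
  obtain rfl : c = 1 - a - b := by linarith
  simp only [lineForm_eq, PiLp.add_apply, PiLp.smul_apply, smul_eq_mul]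
  ring

lemma lineForm_swap (X P z : Plane) : lineForm P X z = -lineForm X P z := by
  simp only [lineForm_eq]; ring

lemma convex_lineForm_pos (X P : Plane) (c : ℝ) : Convex ℝ {z | 0 < lineForm X P z * c} := by
  intro z hz w hw a b ha hb hab
  simp only [mem_ofPred_eq] at hz hw ⊢
  rw [lineForm_combination X P z w hab]
  rcases ha.eq_or_lt with rfl | ha
  · obtain rfl : b = 1 := by linarith
    simpa using hw
  · have := mul_pos ha hz
    nlinarith

lemma convex_lineForm_eq_zero (X P : Plane) : Convex ℝ {z | lineForm X P z = 0} := by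
  intro z hz w hw a b ha hb hab
  simp only [mem_ofPred_eq] at hz hw ⊢
  rw [lineForm_combination X P z w hab, hz, hw]
  ring

/-- The line through two distinct points is a null set. -/
lemma volume_lineForm_eq_zero {X P : Plane} (h : X ≠ P) :
    volume {z | lineForm X P z = 0} = 0 := by
  let s : AffineSubspace ℝ Plane :=
    { carrier := {z | lineForm X P z = 0}
      smul_vsub_vadd_mem' := by
        intro c p q r hp hq hr
        simp only [mem_ofPred_eq, lineForm_eq, vsub_eq_sub, vadd_eq_add, PiLp.add_apply,
          PiLp.smul_apply, PiLp.sub_apply, smul_eq_mul] at hp hq hr ⊢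
        linear_combination c * hp - c * hq + hr }
  refine Measure.addHaar_affineSubspace volume s fun hs => h ?_
  have hmem : X + !₂[-(P 1 - X 1), P 0 - X 0] ∈ s := hs ▸ AffineSubspace.mem_top ℝ _ _
  have h0 : lineForm X P (X + !₂[-(P 1 - X 1), P 0 - X 0]) = 0 := hmem
  simp [lineForm_eq] at h0
  have h1 : P 0 - X 0 = 0 := by nlinarith [sq_nonneg (P 0 - X 0), sq_nonneg (P 1 - X 1)]
  have h2 : P 1 - X 1 = 0 := by nlinarith [sq_nonneg (P 0 - X 0), sq_nonneg (P 1 - X 1)]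
  exact plane_ext (by linarith) (by linarith)

/-- Inside a triangle, a chord is the same as the line carrying it: that line leaves the interior at
the endpoints of the chord. -/
lemma mem_segment_iff_lineForm {T : Fin 3 → Plane} {X P z : Plane}
    (hX : X ∈ frontier (triangleRegion T)) (hP : P ∈ frontier (triangleRegion T)) (hXP : X ≠ P)
    (hz : z ∈ interior (triangleRegion T)) : z ∈ segment ℝ X P ↔ lineForm X P z = 0 := by
  constructor
  · rintro ⟨a, b, ha, hb, hab, rfl⟩
    rw [lineForm_combination X P X P hab]
    simp only [lineForm_eq]; ring
  · intro h
    have hXK : X ∈ triangleRegion T := (isClosed_triangleRegion T).frontier_subset hX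
    have hPK : P ∈ triangleRegion T := (isClosed_triangleRegion T).frontier_subset hP
    have hK := convex_triangleRegion T
    -- The parameter of `z` along the line from `X` to `P`.
    obtain ⟨r, rfl⟩ : ∃ r : ℝ, z = (1 - r) • X + r • P := by
      have hn : (P 0 - X 0) ^ 2 + (P 1 - X 1) ^ 2 ≠ 0 := by
        intro h0
        have h1 : P 0 - X 0 = 0 := by nlinarith [sq_nonneg (P 0 - X 0), sq_nonneg (P 1 - X 1)]
        have h2 : P 1 - X 1 = 0 := by nlinarith [sq_nonneg (P 0 - X 0), sq_nonneg (P 1 - X 1)]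
        exact hXP (plane_ext (by linarith) (by linarith))
      rw [lineForm_eq] at h
      refine ⟨((P 0 - X 0) * (z 0 - X 0) + (P 1 - X 1) * (z 1 - X 1)) /
        ((P 0 - X 0) ^ 2 + (P 1 - X 1) ^ 2), ?_⟩
      apply plane_ext <;> simp only [PiLp.add_apply, PiLp.smul_apply, smul_eq_mul] <;> field_simp
      · linear_combination (-(P 1 - X 1)) * h
      · linear_combination (P 0 - X 0) * h
    rcases lt_or_ge r 0 with hr | hr
    · exfalso
      refine hX.2 (hK.openSegment_interior_self_subset_interior hz hPK
        ⟨1 / (1 - r), -r / (1 - r), ?_, ?_, ?_, ?_⟩)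
      · exact div_pos one_pos (by linarith)
      · exact div_pos (by linarith) (by linarith)
      · have : 1 - r ≠ 0 := by linarith
        field_simp; ring
      · have : 1 - r ≠ 0 := by linarith
        apply plane_ext <;> simp only [PiLp.add_apply, PiLp.smul_apply, smul_eq_mul] <;>
          field_simp <;> ring
    rcases lt_or_ge 1 r with hr1 | hr1
    · exfalso
      refine hP.2 (hK.openSegment_interior_self_subset_interior hz hXK
        ⟨1 / r, (r - 1) / r, ?_, ?_, ?_, ?_⟩)
      · exact div_pos one_pos (by linarith)
      · exact div_pos (by linarith) (by linarith)
      · have : r ≠ 0 := by linarith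
        field_simp; ring
      · have : r ≠ 0 := by linarith
        apply plane_ext <;> simp only [PiLp.add_apply, PiLp.smul_apply, smul_eq_mul] <;>
          field_simp <;> ring
    exact ⟨1 - r, r, by linarith, hr, by ring, rfl⟩

/-- The part of `I` where `f` has the sign of `c` and `g` has the sign of `d`. -/
def signRegion (I : Set Plane) (f g : Plane → ℝ) (c d : ℝ) : Set Plane :=
  {z | z ∈ I ∧ 0 < f z * c ∧ 0 < g z * d}

lemma signRegion_of_pos_left {I : Set Plane} {f g : Plane → ℝ} {c c' d : ℝ} (h : 0 < c * c') :
    signRegion I f g c d = signRegion I f g c' d := by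
  ext z
  have : 0 < f z * c ↔ 0 < f z * c' := by
    rcases pos_and_pos_or_neg_and_neg_of_mul_pos h with ⟨h1, h2⟩ | ⟨h1, h2⟩
    · rw [mul_pos_iff_of_pos_right h1, mul_pos_iff_of_pos_right h2]
    · rw [← neg_mul_neg, ← neg_mul_neg _ c', mul_pos_iff_of_pos_right (neg_pos.2 h1),
        mul_pos_iff_of_pos_right (neg_pos.2 h2)]
  simp only [signRegion, mem_ofPred_eq, this]

lemma signRegion_comm (I : Set Plane) (f g : Plane → ℝ) (c d : ℝ) :
    signRegion I f g c d = signRegion I g f d c := by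
  ext z; simp only [signRegion, mem_ofPred_eq]; tauto

lemma signRegion_of_pos_right {I : Set Plane} {f g : Plane → ℝ} {c d d' : ℝ} (h : 0 < d * d') :
    signRegion I f g c d = signRegion I f g c d' := by
  rw [signRegion_comm, signRegion_of_pos_left h, signRegion_comm]

lemma connectedComponentIn_eq_signRegion {I s t : Set Plane} {f g : Plane → ℝ}
    (hI : Convex ℝ I) (hf : Continuous f) (hg : Continuous g)
    (cf : ∀ c, Convex ℝ {z | 0 < f z * c}) (cg : ∀ c, Convex ℝ {z | 0 < g z * c})
    (hs : ∀ z ∈ I, z ∈ s ↔ f z = 0) (ht : ∀ z ∈ I, z ∈ t ↔ g z = 0) {p : Plane}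
    (hp : p ∈ I \ (s ∪ t)) :
    connectedComponentIn (I \ (s ∪ t)) p = signRegion I f g (f p) (g p) := by
  have hfp : f p ≠ 0 := fun h => hp.2 (Or.inl ((hs p hp.1).2 h))
  have hgp : g p ≠ 0 := fun h => hp.2 (Or.inr ((ht p hp.1).2 h))
  have hU : ∀ z ∈ I \ (s ∪ t), f z ≠ 0 ∧ g z ≠ 0 := fun z hz =>
    ⟨fun h => hz.2 (Or.inl ((hs z hz.1).2 h)), fun h => hz.2 (Or.inr ((ht z hz.1).2 h))⟩
  apply Subset.antisymm
  · have hC : IsPreconnected (connectedComponentIn (I \ (s ∪ t)) p) :=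
      isPreconnected_connectedComponentIn
    have hpC := mem_connectedComponentIn hp
    -- A continuous function without zeros on a preconnected set keeps its sign there.
    have sign : ∀ h : Plane → ℝ, Continuous h → (∀ z ∈ I \ (s ∪ t), h z ≠ 0) →
        ∀ z ∈ connectedComponentIn (I \ (s ∪ t)) p, 0 < h z * h p := by
      intro h hh hne z hz
      by_contra hn
      have hc : Continuous fun w => h w * h p := hh.mul continuous_const
      have hmem : (0 : ℝ) ∈ Icc (h z * h p) (h p * h p) := ⟨not_lt.1 hn, mul_self_nonneg _⟩
      obtain ⟨w, hw, hw0⟩ := hC.intermediate_value hz hpC hc.continuousOn hmem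
      exact (mul_ne_zero (hne w (connectedComponentIn_subset _ _ hw)) (hne p hp)) hw0
    intro z hz
    exact ⟨(connectedComponentIn_subset _ _ hz).1, sign f hf (fun z hz => (hU z hz).1) z hz,
      sign g hg (fun z hz => (hU z hz).2) z hz⟩
  · have hconv : Convex ℝ (signRegion I f g (f p) (g p)) :=
      hI.inter ((cf (f p)).inter (cg (g p)))
    refine hconv.isPreconnected.subset_connectedComponentIn
      ⟨hp.1, mul_self_pos.2 hfp, mul_self_pos.2 hgp⟩ ?_
    rintro z ⟨hzI, h1, h2⟩
    refine ⟨hzI, ?_⟩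
    rintro (h | h)
    · rw [(hs z hzI).1 h] at h1; simp at h1
    · rw [(ht z hzI).1 h] at h2; simp at h2

/-- The regions cut out by two chords are the nonempty ones among the four sign regions. -/
lemma dividedRegions_eq {T : Fin 3 → Plane} {X P Y Q : Plane}
    (hX : X ∈ frontier (triangleRegion T)) (hP : P ∈ frontier (triangleRegion T))
    (hY : Y ∈ frontier (triangleRegion T)) (hQ : Q ∈ frontier (triangleRegion T))
    (hXP : X ≠ P) (hYQ : Y ≠ Q) :
    dividedRegions T (segment ℝ X P) (segment ℝ Y Q) =
      {K | K.Nonempty ∧ ∃ c d : ℝ, (c = 1 ∨ c = -1) ∧ (d = 1 ∨ d = -1) ∧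
        K = signRegion (interior (triangleRegion T)) (lineForm X P) (lineForm Y Q) c d} := by
  have comp := fun p hp => connectedComponentIn_eq_signRegion (p := p)
    (convex_triangleRegion T).interior (continuous_lineForm X P) (continuous_lineForm Y Q)
    (convex_lineForm_pos X P) (convex_lineForm_pos Y Q)
    (fun z hz => mem_segment_iff_lineForm hX hP hXP hz)
    (fun z hz => mem_segment_iff_lineForm hY hQ hYQ hz) hp
  have sgn : ∀ x : ℝ, x ≠ 0 → ∃ c : ℝ, (c = 1 ∨ c = -1) ∧ 0 < x * c := by
    intro x hx
    rcases lt_or_gt_of_ne hx with h | h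
    · exact ⟨-1, Or.inr rfl, by linarith⟩
    · exact ⟨1, Or.inl rfl, by linarith⟩
  ext K
  constructor
  · rintro ⟨p, hp, rfl⟩
    refine ⟨⟨p, mem_connectedComponentIn hp⟩, ?_⟩
    have h1 : lineForm X P p ≠ 0 := fun h =>
      hp.2 (Or.inl ((mem_segment_iff_lineForm hX hP hXP hp.1).2 h))
    have h2 : lineForm Y Q p ≠ 0 := fun h =>
      hp.2 (Or.inr ((mem_segment_iff_lineForm hY hQ hYQ hp.1).2 h))
    obtain ⟨c, hc, hc'⟩ := sgn _ h1
    obtain ⟨d, hd, hd'⟩ := sgn _ h2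
    exact ⟨c, d, hc, hd, by rw [comp p hp, signRegion_of_pos_left hc', signRegion_of_pos_right hd']⟩
  · rintro ⟨hne, c, d, hc, hd, rfl⟩
    obtain ⟨p, hpI, hp1, hp2⟩ := hne
    have hp : p ∈ interior (triangleRegion T) \ (segment ℝ X P ∪ segment ℝ Y Q) := by
      refine ⟨hpI, ?_⟩
      rintro (h | h)
      · rw [(mem_segment_iff_lineForm hX hP hXP hpI).1 h] at hp1; simp at hp1
      · rw [(mem_segment_iff_lineForm hY hQ hYQ hpI).1 h] at hp2; simp at hp2
    exact ⟨p, hp, by rw [comp p hp, signRegion_of_pos_left hp1, signRegion_of_pos_right hp2]⟩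

/-! ### Four regions of equal area -/

lemma volume_openTriangle_ne_top (A B C : Plane) : volume (openTriangle A B C) ≠ ⊤ := by
  rw [volume_openTriangle]
  exact ENNReal.mul_ne_top ENNReal.ofReal_ne_top volume_unitTriangle_lt_top.ne

lemma area_eq_iff {s t : Set Plane} (hs : volume s ≠ ⊤) (ht : volume t ≠ ⊤) :
    volume s = volume t / 4 ↔ area s = area t / 4 := by
  have hk := volume_unitTriangle_toReal_pos
  have h4 : volume t / 4 ≠ ⊤ := ENNReal.div_ne_top ht (by norm_num)
  rw [← ENNReal.toReal_eq_toReal_iff' hs h4, ENNReal.toReal_div, area, area]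
  simp only [ENNReal.toReal_ofNat]
  constructor
  · intro h; rw [h]; ring
  · intro h
    field_simp at h ⊢
    exact h

lemma area_union_eq {s u v : Set Plane} (hs : volume s ≠ ⊤) (hu : MeasurableSet v)
    (hus : u ⊆ s) (hvs : v ⊆ s) (hd : Disjoint u v) (hn : volume (s \ (u ∪ v)) = 0) :
    area s = area u + area v := by
  have h1 : volume s = volume (u ∪ v) := by
    refine le_antisymm ?_ (measure_mono (union_subset hus hvs))
    calc volume s ≤ volume ((u ∪ v) ∪ s \ (u ∪ v)) := 
          measure_mono (by rw [union_sdiff_self]; exact subset_union_right)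
      _ ≤ _ := (measure_union_le _ _).trans (by rw [hn, add_zero])
  have h2 := measure_union (μ := volume) hd hu
  have fu : volume u ≠ ⊤ := ((measure_mono hus).trans_lt hs.lt_top).ne
  have fv : volume v ≠ ⊤ := ((measure_mono hvs).trans_lt hs.lt_top).ne
  rw [area, area, area, h1, h2, ENNReal.toReal_add fu fv, add_div]

/-- The part of `I` where `f` has the sign of `c`. -/
def halfRegion (I : Set Plane) (f : Plane → ℝ) (c : ℝ) : Set Plane := {z | z ∈ I ∧ 0 < f z * c}

lemma halfRegion_of_pos {I : Set Plane} {f : Plane → ℝ} {c c' : ℝ} (h : 0 < c * c') :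
    halfRegion I f c = halfRegion I f c' := by
  have := signRegion_of_pos_left (I := I) (f := f) (g := fun _ => 1) (d := 1) h
  ext z
  have := Set.ext_iff.1 this z
  simpa [signRegion, halfRegion] using this

lemma area_split {s : Set Plane} (hs : volume s ≠ ⊤) (hm : MeasurableSet s) {g : Plane → ℝ}
    (hg : Continuous g) (h0 : volume {z | g z = 0} = 0) {d : ℝ} (hd : d ≠ 0) :
    area s = area (halfRegion s g d) + area (halfRegion s g (-d)) := by
  refine area_union_eq hs ?_ (fun z hz => hz.1) (fun z hz => hz.1) ?_ ?_
  · exact hm.inter (isOpen_lt continuous_const (hg.mul continuous_const)).measurableSet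
  · rw [Set.disjoint_left]
    rintro z ⟨-, h1⟩ ⟨-, h2⟩
    linarith
  · refine measure_mono_null ?_ h0
    rintro z ⟨hz, hn⟩
    by_contra hne
    rcases lt_or_gt_of_ne (mul_ne_zero hne hd) with h | h
    · exact hn (Or.inr ⟨hz, by linarith⟩)
    · exact hn (Or.inl ⟨hz, h⟩)

lemma isOpen_halfRegion {I : Set Plane} (hI : IsOpen I) {f : Plane → ℝ} (hf : Continuous f)
    (c : ℝ) : IsOpen (halfRegion I f c) :=
  hI.inter (isOpen_lt continuous_const (hf.mul continuous_const))

lemma halfRegion_halfRegion (I : Set Plane) (f g : Plane → ℝ) (c d : ℝ) :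
    halfRegion (halfRegion I f c) g d = signRegion I f g c d := by
  ext z; simp only [halfRegion, signRegion, mem_ofPred_eq]; tauto

/-- Two distinct lines that leave `I` cut out four quarters exactly when both lines halve `I`
and one of the four sign regions is a quarter. -/
lemma area_signRegion_eq_quarter_iff {I : Set Plane} (hI : IsOpen I) (hfin : volume I ≠ ⊤)
    {f g : Plane → ℝ} (hf : Continuous f) (hg : Continuous g)
    (h0f : volume {z | f z = 0} = 0) (h0g : volume {z | g z = 0} = 0) {c₀ d₀ : ℝ} (hc₀ : c₀ ≠ 0)
    (hd₀ : d₀ ≠ 0) :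
    (∀ c d, c ≠ 0 → d ≠ 0 → area (signRegion I f g c d) = area I / 4) ↔
      area (halfRegion I f c₀) = area I / 2 ∧ area (halfRegion I g d₀) = area I / 2 ∧
        area (signRegion I f g c₀ d₀) = area I / 4 := by
  have hsub : ∀ {f : Plane → ℝ} {c}, volume (halfRegion I f c) ≠ ⊤ := fun {f c} =>
    ((measure_mono (fun z hz => hz.1)).trans_lt hfin.lt_top).ne
  have e2 := area_split hfin hI.measurableSet hg h0g hd₀
  have e3 := fun c => area_split hsub (isOpen_halfRegion hI hf c).measurableSet hg h0g hd₀
  have e4 := fun d => area_split hsub (isOpen_halfRegion hI hg d).measurableSet hf h0f hc₀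
  simp only [halfRegion_halfRegion] at e3 e4
  have e31 := e3 c₀
  have e41 := e4 d₀
  have e42 := e4 (-d₀)
  simp only [signRegion_comm I g f] at e41 e42
  constructor
  · intro h
    have h1 := h c₀ d₀ hc₀ hd₀
    have h2 := h c₀ (-d₀) hc₀ (neg_ne_zero.2 hd₀)
    have h3 := h (-c₀) d₀ (neg_ne_zero.2 hc₀) hd₀
    exact ⟨by linarith, by linarith, h1⟩
  · rintro ⟨h1, h2, h3⟩ c d hc hd
    have sgn : ∀ {x y : ℝ}, x ≠ 0 → y ≠ 0 → 0 < x * y ∨ 0 < x * -y := by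
      intro x y hx hy
      rcases lt_or_gt_of_ne (mul_ne_zero hx hy) with h | h
      · right; linarith
      · left; exact h
    rcases sgn hc hc₀ with h | h <;> rcases sgn hd hd₀ with h' | h' <;>
      rw [signRegion_of_pos_left h, signRegion_of_pos_right h'] <;> linarith

lemma isQuadrisection_iff {T : Fin 3 → Plane} (hT : AffineIndependent ℝ T) {X P Y Q : Plane} :
    IsQuadrisection T X P Y Q ↔
      X ∈ frontier (triangleRegion T) ∧ P ∈ frontier (triangleRegion T) ∧
      Y ∈ frontier (triangleRegion T) ∧ Q ∈ frontier (triangleRegion T) ∧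
      X ≠ P ∧ Y ≠ Q ∧ inner ℝ (P - X) (Q - Y) = 0 ∧
      ∀ c d : ℝ, c ≠ 0 → d ≠ 0 →
        area (signRegion (openTriangle (T 0) (T 1) (T 2)) (lineForm X P) (lineForm Y Q) c d) =
          area (openTriangle (T 0) (T 1) (T 2)) / 4 := by
  set I := openTriangle (T 0) (T 1) (T 2) with hI
  have hIT : interior (triangleRegion T) = I := interior_triangleRegion hT
  have hfin : volume I ≠ ⊤ := volume_openTriangle_ne_top _ _ _
  have hapos : 0 < area I := by
    rw [hI, area_openTriangle]
    exact abs_pos.2 (cross_ne_zero_of_affineIndependent hT)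
  set R : ℝ × ℝ → Set Plane := fun p => signRegion I (lineForm X P) (lineForm Y Q) p.1 p.2 with hR
  have hRfin : ∀ p, volume (R p) ≠ ⊤ := fun p =>
    ((measure_mono (fun z hz => hz.1)).trans_lt hfin.lt_top).ne
  let F : Finset (ℝ × ℝ) := {(1, 1), (1, -1), (-1, 1), (-1, -1)}
  have hF : F.card = 4 := by
    have h1 : (1 : ℝ) ≠ -1 := by norm_num
    simp [F, h1, h1.symm]
  have hFmem : ∀ p : ℝ × ℝ, p ∈ F ↔ (p.1 = 1 ∨ p.1 = -1) ∧ (p.2 = 1 ∨ p.2 = -1) := by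
    rintro ⟨c, d⟩
    simp only [F, Finset.mem_insert, Finset.mem_singleton, Prod.mk.injEq]
    tauto
  have regions : X ∈ frontier (triangleRegion T) → P ∈ frontier (triangleRegion T) →
      Y ∈ frontier (triangleRegion T) → Q ∈ frontier (triangleRegion T) → X ≠ P → Y ≠ Q →
      dividedRegions T (segment ℝ X P) (segment ℝ Y Q) = R '' {p | p ∈ F ∧ (R p).Nonempty} := by
    intro hX hP hY hQ hXP hYQ
    rw [dividedRegions_eq hX hP hY hQ hXP hYQ, hIT]
    ext K
    constructor
    · rintro ⟨hne, c, d, hc, hd, rfl⟩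
      exact ⟨(c, d), ⟨(hFmem _).2 ⟨hc, hd⟩, hne⟩, rfl⟩
    · rintro ⟨p, ⟨hp, hne⟩, rfl⟩
      exact ⟨hne, p.1, p.2, ((hFmem p).1 hp).1, ((hFmem p).1 hp).2, rfl⟩
  have unit : ∀ c : ℝ, c ≠ 0 → ∃ c' : ℝ, (c' = 1 ∨ c' = -1) ∧ 0 < c * c' := by
    intro x hx
    rcases lt_or_gt_of_ne hx with h | h
    · exact ⟨-1, Or.inr rfl, by linarith⟩
    · exact ⟨1, Or.inl rfl, by linarith⟩
  constructor
  · rintro ⟨hX, hP, hY, hQ, hXP, hYQ, hperp, h4, harea⟩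
    refine ⟨hX, hP, hY, hQ, hXP, hYQ, hperp, fun c d hc hd => ?_⟩
    rw [regions hX hP hY hQ hXP hYQ] at h4 harea
    obtain ⟨c', hc', hcc⟩ := unit c hc
    obtain ⟨d', hd', hdd⟩ := unit d hd
    rw [signRegion_of_pos_left hcc, signRegion_of_pos_right hdd]
    have hmem : (c', d') ∈ F := (hFmem _).2 ⟨hc', hd'⟩
    have hne : (R (c', d')).Nonempty := by
      by_contra hempty
      have hle : {p | p ∈ F ∧ (R p).Nonempty} ⊆ (F.erase (c', d') : Set (ℝ × ℝ)) := by
        rintro p ⟨hp, hpne⟩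
        rw [Finset.mem_coe, Finset.mem_erase]
        exact ⟨fun h => hempty (h ▸ hpne), hp⟩
      have h3 := (encard_image_le R _).trans (encard_le_encard hle)
      rw [h4, encard_coe_eq_coe_finsetCard, Finset.card_erase_of_mem hmem, hF] at h3
      norm_num at h3
    have := harea _ ⟨(c', d'), ⟨hmem, hne⟩, rfl⟩
    rw [volume_triangleRegion hT] at this
    exact (area_eq_iff (hRfin _) hfin).1 this
  · rintro ⟨hX, hP, hY, hQ, hXP, hYQ, hperp, h⟩
    have hRa : ∀ p ∈ F, area (R p) = area I / 4 := by
      intro p hp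
      obtain ⟨h1, h2⟩ := (hFmem p).1 hp
      apply h
      · rcases h1 with h1 | h1 <;> rw [h1] <;> norm_num
      · rcases h2 with h1 | h1 <;> rw [h1] <;> norm_num
    have hne : ∀ p ∈ F, (R p).Nonempty := by
      intro p hp
      by_contra hempty
      have := hRa p hp
      rw [not_nonempty_iff_eq_empty.1 hempty] at this
      have h0 : area (∅ : Set Plane) = 0 := by simp [area]
      linarith
    refine ⟨hX, hP, hY, hQ, hXP, hYQ, hperp, ?_, ?_⟩
    · rw [regions hX hP hY hQ hXP hYQ]
      have : {p | p ∈ F ∧ (R p).Nonempty} = (F : Set (ℝ × ℝ)) := by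
        ext p; exact ⟨fun h => h.1, fun h => ⟨h, hne p h⟩⟩
      rw [this, InjOn.encard_image, encard_coe_eq_coe_finsetCard, hF]
      · norm_num
      · intro p hp q hq hpq
        obtain ⟨z, hz⟩ := hne p hp
        have hz' : z ∈ R q := hpq ▸ hz
        obtain ⟨-, a1, a2⟩ := hz
        obtain ⟨-, b1, b2⟩ := hz'
        have same : ∀ x y w : ℝ, (x = 1 ∨ x = -1) → (y = 1 ∨ y = -1) → 0 < w * x → 0 < w * y →
            x = y := by
          rintro x y w (rfl | rfl) (rfl | rfl) h1 h2 <;> first | rfl | (exfalso; linarith)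
        have hp' := (hFmem p).1 hp
        have hq' := (hFmem q).1 hq
        exact Prod.ext (same _ _ _ hp'.1 hq'.1 a1 b1) (same _ _ _ hp'.2 hq'.2 a2 b2)
    · rw [regions hX hP hY hQ hXP hYQ]
      rintro _ ⟨p, ⟨hp, -⟩, rfl⟩
      rw [volume_triangleRegion hT]
      exact (area_eq_iff (hRfin _) hfin).2 (hRa p hp)

/-! ### Chords with feet on one side -/

/-- The point dividing the side from `V` to `U` in the ratio `x : 1 - x`, measured from `V`. -/
noncomputable def sidePoint (x : ℝ) (U V : Plane) : Plane := x • U + (1 - x) • V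

lemma sidePoint_apply (x : ℝ) (U V : Plane) (i : Fin 2) :
    sidePoint x U V i = x * U i + (1 - x) * V i := by
  simp [sidePoint]

lemma lineForm_corner (A B C : Plane) (x p a b c : ℝ) (h : a + b + c = 1) :
    lineForm (sidePoint x B C) (sidePoint p A C) (a • A + b • B + c • C) =
      -cross (B - A) (C - A) * (x * p - x * a - p * b) := by
  obtain rfl : c = 1 - a - b := by linarith
  simp only [lineForm_eq, cross_sub_sub, sidePoint_apply, PiLp.add_apply, PiLp.smul_apply,
    smul_eq_mul]
  ring

lemma cross_rotate (A B C : Plane) : cross (C - B) (A - B) = cross (B - A) (C - A) := by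
  simp only [cross_sub_sub]; ring

lemma cross_swap (A B C : Plane) : cross (C - A) (B - A) = -cross (B - A) (C - A) := by
  simp only [cross_sub_sub]; ring

/-- A chord cutting off the corner `C`: the part of the triangle on the side of `C`. -/
lemma halfRegion_corner {A B C : Plane} (hD : cross (B - A) (C - A) ≠ 0) {x p : ℝ} (hx : 0 < x)
    (hx1 : x ≤ 1) (hp : 0 < p) (hp1 : p ≤ 1) :
    halfRegion (openTriangle A B C) (lineForm (sidePoint x B C) (sidePoint p A C))
      (-cross (B - A) (C - A)) = openTriangle C (sidePoint x B C) (sidePoint p A C) := by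
  have hD2 : 0 < cross (B - A) (C - A) ^ 2 := by positivity
  ext z
  constructor
  · rintro ⟨⟨a, b, c, ha, hb, hc, hs, rfl⟩, hz⟩
    rw [lineForm_corner A B C x p a b c hs] at hz
    have hz' : 0 < x * p - x * a - p * b := by
      refine pos_of_mul_pos_right (?_ : 0 < cross (B - A) (C - A) ^ 2 * _) hD2.le
      linarith
    refine ⟨(x * p - x * a - p * b) / (x * p), b / x, a / p, by positivity, by positivity,
      by positivity, by field_simp; ring, ?_⟩
    obtain rfl : c = 1 - a - b := by linarith
    apply plane_ext <;> simp only [sidePoint_apply, PiLp.add_apply, PiLp.smul_apply,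
      smul_eq_mul] <;> field_simp <;> ring
  · rintro ⟨c, b, a, hc, hb, ha, hs, rfl⟩
    obtain rfl : c = 1 - a - b := by linarith
    have e : (1 - a - b) • C + b • sidePoint x B C + a • sidePoint p A C =
        (a * p) • A + (b * x) • B + (1 - a * p - b * x) • C := by
      apply plane_ext <;> simp only [sidePoint_apply, PiLp.add_apply, PiLp.smul_apply,
        smul_eq_mul] <;> ring
    rw [e]
    refine ⟨⟨a * p, b * x, 1 - a * p - b * x, by positivity, by positivity, by nlinarith, by ring,
      rfl⟩, ?_⟩
    rw [lineForm_corner A B C x p _ _ _ (by ring)]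
    have : 0 < x * p * (1 - a - b) := by positivity
    nlinarith

lemma area_halfRegion_corner {A B C : Plane} (hD : cross (B - A) (C - A) ≠ 0) {x p : ℝ}
    (hx : 0 < x) (hx1 : x ≤ 1) (hp : 0 < p) (hp1 : p ≤ 1) :
    area (halfRegion (openTriangle A B C) (lineForm (sidePoint x B C) (sidePoint p A C))
      (-cross (B - A) (C - A))) = x * p * area (openTriangle A B C) := by
  have e : cross (sidePoint x B C - C) (sidePoint p A C - C) =
      -(x * p) * cross (B - A) (C - A) := by
    simp only [cross_sub_sub, sidePoint_apply]
    ring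
  rw [halfRegion_corner hD hx hx1 hp hp1, area_openTriangle, area_openTriangle, e, abs_mul,
    abs_neg, abs_of_pos (mul_pos hx hp)]

/-- Two chords with feet `X`, `Y` on the side `BC` that meet at `O` inside the triangle: the sign
region adjacent to `XY` is the triangle `OXY`. -/
lemma signRegion_foot {A B C X Y O P Q : Plane} {x y : ℝ} (hx0 : 0 ≤ x) (hx1 : x ≤ 1)
    (hy0 : 0 ≤ y) (hy1 : y ≤ 1) (hX : X = sidePoint x B C) (hY : Y = sidePoint y C B)
    (hO : O ∈ openTriangle A B C) (hOf : lineForm X P O = 0) (hOg : lineForm Y Q O = 0)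
    (hYf : lineForm X P Y ≠ 0) (hXg : lineForm Y Q X ≠ 0) :
    signRegion (openTriangle A B C) (lineForm X P) (lineForm Y Q) (lineForm X P Y)
      (lineForm Y Q X) = openTriangle O X Y := by
  have hXX : lineForm X P X = 0 := by simp [lineForm_eq]
  have hYY : lineForm Y Q Y = 0 := by simp [lineForm_eq]
  have hxy : x + y - 1 ≠ 0 := by
    intro h
    apply hYf
    have : Y = X := by
      rw [hX, hY]
      obtain rfl : y = 1 - x := by linarith
      apply plane_ext <;> simp only [sidePoint_apply] <;> ring
    rw [this, hXX]
  obtain ⟨a, b, c, ha, hb, hc, hs, hOe⟩ := hO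
  ext z
  constructor
  · rintro ⟨⟨a', b', c', ha', hb', hc', hs', hz⟩, h1, h2⟩
    set r := a' / a with hr
    set ξ := (b' - r * b - (1 - y) * (1 - r)) / (x + y - 1) with hξ
    have hrpos : 0 < r := div_pos ha' ha
    have e : z = r • O + ξ • X + (1 - r - ξ) • Y := by
      obtain rfl : c = 1 - a - b := by linarith
      obtain rfl : c' = 1 - a' - b' := by linarith
      have hra : a' = r * a := by rw [hr]; field_simp
      have hξ' : b' = ξ * (x + y - 1) + r * b + (1 - y) * (1 - r) := by
        rw [hξ]; field_simp; ring
      rw [hz, hOe, hX, hY]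
      apply plane_ext <;> simp only [sidePoint_apply, PiLp.add_apply, PiLp.smul_apply,
        smul_eq_mul] <;> rw [hξ', hra] <;> ring
    rw [e, lineForm_combination₃ _ _ _ _ _ (by ring), hOf, hXX] at h1
    rw [e, lineForm_combination₃ _ _ _ _ _ (by ring), hOg, hYY] at h2
    refine ⟨r, ξ, 1 - r - ξ, hrpos, ?_, ?_, by ring, e⟩
    · refine pos_of_mul_pos_left (?_ : 0 < ξ * (lineForm Y Q X * lineForm Y Q X))
        (mul_self_nonneg _)
      linarith
    · refine pos_of_mul_pos_left (?_ : 0 < (1 - r - ξ) * (lineForm X P Y * lineForm X P Y))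
        (mul_self_nonneg _)
      linarith
  · rintro ⟨r, ξ, η, hr, hξ, hη, hsum, rfl⟩
    refine ⟨⟨r * a, r * b + ξ * x + η * (1 - y), r * c + ξ * (1 - x) + η * y, by positivity,
      ?_, ?_, ?_, ?_⟩, ?_, ?_⟩
    · have := mul_nonneg hξ.le hx0
      have := mul_nonneg hη.le (sub_nonneg.2 hy1)
      positivity
    · have := mul_nonneg hξ.le (sub_nonneg.2 hx1)
      positivity
    · linear_combination r * hs + hsum
    · rw [hOe, hX, hY]
      apply plane_ext <;> simp only [sidePoint_apply, PiLp.add_apply, PiLp.smul_apply,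
        smul_eq_mul] <;> ring
    · rw [lineForm_combination₃ _ _ _ _ _ hsum, hOf, hXX]
      have := mul_pos hη (mul_self_pos.2 hYf)
      linarith
    · rw [lineForm_combination₃ _ _ _ _ _ hsum, hOg, hYY]
      have := mul_pos hξ (mul_self_pos.2 hXg)
      linarith

lemma area_openTriangle_foot (A B C : Plane) {x y a b c : ℝ} (ha : 0 < a) (hs : a + b + c = 1) :
    area (openTriangle (a • A + b • B + c • C) (sidePoint x B C) (sidePoint y C B)) =
      a * |x + y - 1| * area (openTriangle A B C) := by
  obtain rfl : c = 1 - a - b := by linarith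
  have e : cross (sidePoint x B C - (a • A + b • B + (1 - a - b) • C))
      (sidePoint y C B - (a • A + b • B + (1 - a - b) • C)) =
      a * (x + y - 1) * cross (B - A) (C - A) := by
    simp only [cross_sub_sub, sidePoint_apply, PiLp.add_apply, PiLp.smul_apply, smul_eq_mul]
    ring
  rw [area_openTriangle, area_openTriangle, e, abs_mul, abs_mul, abs_of_pos ha]

/-- If two lines cut a convex set into four nonempty parts, they meet inside it. -/
lemma exists_lineForm_eq_zero {I : Set Plane} (hI : Convex ℝ I) {X P Y Q : Plane}
    (h : ∀ c d : ℝ, c ≠ 0 → d ≠ 0 → (signRegion I (lineForm X P) (lineForm Y Q) c d).Nonempty) :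
    ∃ O ∈ I, lineForm X P O = 0 ∧ lineForm Y Q O = 0 := by
  have step : ∀ d : ℝ, d ≠ 0 → ∃ w ∈ I, lineForm X P w = 0 ∧ 0 < lineForm Y Q w * d := by
    intro d hd
    have hc : IsPreconnected (I ∩ {z | 0 < lineForm Y Q z * d}) :=
      (hI.inter (convex_lineForm_pos Y Q d)).isPreconnected
    obtain ⟨z, hz, hz1, hz2⟩ := h 1 d one_ne_zero hd
    obtain ⟨w, hw, hw1, hw2⟩ := h (-1) d (by norm_num) hd
    have hmem : (0 : ℝ) ∈ Icc (lineForm X P w) (lineForm X P z) := ⟨by linarith, by linarith⟩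
    obtain ⟨v, hv, hv0⟩ := hc.intermediate_value (f := lineForm X P) ⟨hw, hw2⟩ ⟨hz, hz2⟩
      (continuous_lineForm X P).continuousOn hmem
    exact ⟨v, hv.1, hv0, hv.2⟩
  obtain ⟨z, hz, hz1, hz2⟩ := step 1 one_ne_zero
  obtain ⟨w, hw, hw1, hw2⟩ := step (-1) (by norm_num)
  have hc : IsPreconnected (I ∩ {z | lineForm X P z = 0}) :=
    (hI.inter (convex_lineForm_eq_zero X P)).isPreconnected
  have hmem : (0 : ℝ) ∈ Icc (lineForm Y Q w) (lineForm Y Q z) := ⟨by linarith, by linarith⟩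
  obtain ⟨v, hv, hv0⟩ := hc.intermediate_value (f := lineForm Y Q) ⟨hw, hw1⟩ ⟨hz, hz1⟩
    (continuous_lineForm Y Q).continuousOn hmem
  exact ⟨v, hv.1, hv.2, hv0⟩

/-! ### The area condition on the feet -/

/-- The pairs `(x, y)` for which the chords with feet at the fractions `x` (from `C`) and `y`
(from `B`) of the side `BC`, each halving the triangle, cut it into four equal parts. -/
structure IsArc (x y : ℝ) : Prop where
  half_le_x : 1 / 2 ≤ x
  x_le_one : x ≤ 1
  half_le_y : 1 / 2 ≤ y
  y_le_one : y ≤ 1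
  one_lt : 1 < x + y
  eq : 4 * (x + y - 1) ^ 2 = 2 * x ^ 2 + 2 * y ^ 2 - 1

/-- Conway's triangle quantity at the vertex `A`. -/
noncomputable def conway (A B C : Plane) : ℝ := inner ℝ (B - A) (C - A)

lemma conway_eq (A B C : Plane) :
    conway A B C = (B 0 - A 0) * (C 0 - A 0) + (B 1 - A 1) * (C 1 - A 1) := by
  simp [conway, PiLp.inner_apply, Fin.sum_univ_two]
  ring

lemma conway_swap (A B C : Plane) : conway A C B = conway A B C := by
  simp only [conway_eq]; ring

/-- The condition that the two area-halving chords with feet at `x` and `y` are perpendicular. -/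
def PerpCond (A B C : Plane) (x y : ℝ) : Prop :=
  conway A B C = 2 * x ^ 2 * (2 * y ^ 2 - 1) * conway B C A +
    2 * y ^ 2 * (2 * x ^ 2 - 1) * conway C A B

lemma inner_chords_eq_zero_iff (A B C : Plane) {x y p q : ℝ} (hx : 0 < x) (hy : 0 < y)
    (hxp : x * p = 1 / 2) (hyq : y * q = 1 / 2) :
    inner ℝ (sidePoint p A C - sidePoint x B C) (sidePoint q A B - sidePoint y C B) = 0 ↔
      PerpCond A B C x y := by
  have e : 4 * x * y * inner ℝ (sidePoint p A C - sidePoint x B C)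
      (sidePoint q A B - sidePoint y C B) = conway A B C -
      (2 * x ^ 2 * (2 * y ^ 2 - 1) * conway B C A +
        2 * y ^ 2 * (2 * x ^ 2 - 1) * conway C A B) := by
    obtain rfl : p = 1 / (2 * x) := by field_simp; linarith
    obtain rfl : q = 1 / (2 * y) := by field_simp; linarith
    simp only [conway_eq, PiLp.inner_apply, Fin.sum_univ_two, sidePoint_apply, PiLp.sub_apply,
      RCLike.inner_apply, conj_trivial]
    field_simp
    ring
  rw [PerpCond]
  have hxy : 4 * x * y ≠ 0 := by positivity
  constructor
  · intro h; rw [h] at e; linarith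
  · intro h
    refine (mul_eq_zero.1 (?_ : 4 * x * y * _ = 0)).resolve_left hxy
    rw [e]; linarith

lemma area_openTriangle_pos {A B C : Plane} (hD : cross (B - A) (C - A) ≠ 0) :
    0 < area (openTriangle A B C) := by
  rw [area_openTriangle]; exact abs_pos.2 hD

lemma nonempty_of_area_pos {s : Set Plane} (h : 0 < area s) : s.Nonempty := by
  by_contra hn
  rw [not_nonempty_iff_eq_empty.1 hn] at h
  simp [area] at h

/-- A chord from the side `BC` to the side `CA` that halves the triangle. -/
lemma corner_of_half {A B C : Plane} (hD : cross (B - A) (C - A) ≠ 0) {x p : ℝ} (hx : 0 ≤ x)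
    (hx1 : x ≤ 1) (hp : 0 ≤ p) (hp1 : p ≤ 1)
    (h : area (halfRegion (openTriangle A B C) (lineForm (sidePoint x B C) (sidePoint p A C))
      (-cross (B - A) (C - A))) = area (openTriangle A B C) / 2) :
    0 < x ∧ 0 < p ∧ x * p = 1 / 2 := by
  have hA := area_openTriangle_pos hD
  obtain ⟨_, ⟨a, b, c, ha, hb, hc, hs, rfl⟩, hz⟩ :=
    nonempty_of_area_pos (s := halfRegion _ _ _) (by rw [h]; positivity)
  rw [lineForm_corner A B C x p a b c hs] at hz
  have hz' : 0 < x * p - x * a - p * b := by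
    refine pos_of_mul_pos_right (?_ : 0 < cross (B - A) (C - A) ^ 2 * _) (sq_nonneg _)
    linarith
  have hxp : 0 < x * p := by
    have := mul_nonneg hx ha.le
    have := mul_nonneg hp hb.le
    linarith
  have hx' : 0 < x := pos_of_mul_pos_left hxp hp
  have hp' : 0 < p := pos_of_mul_pos_right hxp hx
  refine ⟨hx', hp', ?_⟩
  rw [area_halfRegion_corner hD hx' hx1 hp' hp1] at h
  have : (x * p - 1 / 2) * area (openTriangle A B C) = 0 := by linarith
  rcases mul_eq_zero.1 this with h | h
  · linarith
  · exact absurd h hA.ne'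

/-- The middle triangle cut off by two chords with feet on `BC` that meet at the point with
barycentric coordinates `(a, b, c)`. -/
lemma area_signRegion_foot {A B C P Q : Plane} {x y a b c : ℝ} (hx : 0 ≤ x) (hx1 : x ≤ 1)
    (hy : 0 ≤ y) (hy1 : y ≤ 1) (ha : 0 < a) (hb : 0 < b) (hc : 0 < c) (hs : a + b + c = 1)
    (hf : lineForm (sidePoint x B C) P (a • A + b • B + c • C) = 0)
    (hg : lineForm (sidePoint y C B) Q (a • A + b • B + c • C) = 0)
    (hf0 : lineForm (sidePoint x B C) P (sidePoint y C B) ≠ 0)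
    (hg0 : lineForm (sidePoint y C B) Q (sidePoint x B C) ≠ 0) :
    area (signRegion (openTriangle A B C) (lineForm (sidePoint x B C) P)
      (lineForm (sidePoint y C B) Q) (lineForm (sidePoint x B C) P (sidePoint y C B))
      (lineForm (sidePoint y C B) Q (sidePoint x B C))) =
      a * |x + y - 1| * area (openTriangle A B C) := by
  rw [signRegion_foot hx hx1 hy hy1 rfl rfl ⟨a, b, c, ha, hb, hc, hs, rfl⟩ hf hg hf0 hg0,
    area_openTriangle_foot A B C ha hs]

/-- The lines `XP` and `YQ` cut the triangle `ABC` into four parts of equal area. -/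
def FourQuarters (A B C X P Y Q : Plane) : Prop :=
  ∀ c d : ℝ, c ≠ 0 → d ≠ 0 →
    area (signRegion (openTriangle A B C) (lineForm X P) (lineForm Y Q) c d) =
      area (openTriangle A B C) / 4

lemma isOpen_openTriangle {A B C : Plane} (hD : cross (B - A) (C - A) ≠ 0) :
    IsOpen (openTriangle A B C) := by
  have hT : AffineIndependent ℝ ![A, B, C] := affineIndependent_of_cross_ne_zero hD
  have := interior_triangleRegion hT
  simp only [Matrix.cons_val_zero, Matrix.cons_val_one, Matrix.cons_val] at this
  rw [← this]
  exact isOpen_interior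

lemma fourQuarters_iff {A B C X P Y Q : Plane} (hD : cross (B - A) (C - A) ≠ 0) (hXP : X ≠ P)
    (hYQ : Y ≠ Q) {c d : ℝ} (hc : c ≠ 0) (hd : d ≠ 0) :
    FourQuarters A B C X P Y Q ↔
      area (halfRegion (openTriangle A B C) (lineForm X P) c) = area (openTriangle A B C) / 2 ∧
      area (halfRegion (openTriangle A B C) (lineForm Y Q) d) = area (openTriangle A B C) / 2 ∧
      area (signRegion (openTriangle A B C) (lineForm X P) (lineForm Y Q) c d) =
        area (openTriangle A B C) / 4 :=
  area_signRegion_eq_quarter_iff (isOpen_openTriangle hD) (volume_openTriangle_ne_top _ _ _)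
    (continuous_lineForm _ _) (continuous_lineForm _ _) (volume_lineForm_eq_zero hXP)
    (volume_lineForm_eq_zero hYQ) hc hd

lemma FourQuarters.exists_meet {A B C X P Y Q : Plane} (hD : cross (B - A) (C - A) ≠ 0)
    (h : FourQuarters A B C X P Y Q) :
    ∃ O ∈ openTriangle A B C, lineForm X P O = 0 ∧ lineForm Y Q O = 0 := by
  refine exists_lineForm_eq_zero (convex_openTriangle A B C) fun c d hc hd => ?_
  apply nonempty_of_area_pos
  have := area_openTriangle_pos hD
  rw [h c d hc hd]
  positivity

lemma lineForm_corner' (A B C : Plane) (y q a b c : ℝ) (h : a + b + c = 1) :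
    lineForm (sidePoint y C B) (sidePoint q A B) (a • A + b • B + c • C) =
      cross (B - A) (C - A) * (y * q - y * a - q * c) := by
  have := lineForm_corner A C B y q a c b (by linarith)
  rw [cross_swap, add_right_comm] at this
  rw [this]; ring

lemma sidePoint_eq_sub (x : ℝ) (U V : Plane) : sidePoint x U V = sidePoint (1 - x) V U := by
  apply plane_ext <;> simp only [sidePoint_apply] <;> ring

lemma sidePoint_eq_combination (A B C : Plane) (x : ℝ) :
    sidePoint x B C = (0 : ℝ) • A + x • B + (1 - x) • C := by
  simp [sidePoint]

lemma lineForm_corner_foot (A B C : Plane) (x p y : ℝ) :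
    lineForm (sidePoint x B C) (sidePoint p A C) (sidePoint y C B) =
      -cross (B - A) (C - A) * (p * (x + y - 1)) := by
  rw [sidePoint_eq_sub y, sidePoint_eq_combination A B C (1 - y),
    lineForm_corner A B C _ _ _ _ _ (by ring)]
  ring

lemma lineForm_corner_foot' (A B C : Plane) (x q y : ℝ) :
    lineForm (sidePoint y C B) (sidePoint q A B) (sidePoint x B C) =
      cross (B - A) (C - A) * (q * (x + y - 1)) := by
  have := lineForm_corner_foot A C B y q x
  rw [cross_swap] at this
  rw [this]; ring

/-- Two chords from the side `BC`, one to each of the other sides. -/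
lemma isArc_of_fourQuarters {A B C : Plane} (hD : cross (B - A) (C - A) ≠ 0) {x p y q : ℝ}
    (hx : 0 ≤ x) (hx1 : x ≤ 1) (hp : 0 ≤ p) (hp1 : p ≤ 1) (hy : 0 ≤ y) (hy1 : y ≤ 1)
    (hq : 0 ≤ q) (hq1 : q ≤ 1) (hXP : sidePoint x B C ≠ sidePoint p A C)
    (hYQ : sidePoint y C B ≠ sidePoint q A B)
    (h : FourQuarters A B C (sidePoint x B C) (sidePoint p A C) (sidePoint y C B)
      (sidePoint q A B)) :
    IsArc x y ∧ x * p = 1 / 2 ∧ y * q = 1 / 2 := by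
  have hA := area_openTriangle_pos hD
  have hD' : cross (C - A) (B - A) ≠ 0 := by rw [cross_swap]; exact neg_ne_zero.2 hD
  obtain ⟨h1, h2, -⟩ := (fourQuarters_iff hD hXP hYQ (neg_ne_zero.2 hD) (neg_ne_zero.2 hD')).1 h
  rw [← openTriangle_swap] at h2
  obtain ⟨hx0, hp0, hxp⟩ := corner_of_half hD hx hx1 hp hp1 h1
  obtain ⟨hy0, hq0, hyq⟩ := corner_of_half hD' hy hy1 hq hq1 h2
  have hx2 : 1 / 2 ≤ x := by nlinarith
  have hy2 : 1 / 2 ≤ y := by nlinarith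
  obtain ⟨_, ⟨a, b, c, ha, hb, hc, hs, rfl⟩, hf, hg⟩ := h.exists_meet hD
  have ef := hf
  have eg := hg
  rw [lineForm_corner A B C _ _ _ _ _ hs, mul_eq_zero, or_iff_right (neg_ne_zero.2 hD)] at ef
  rw [lineForm_corner' A B C _ _ _ _ _ hs, mul_eq_zero, or_iff_right hD] at eg
  obtain rfl : p = 1 / (2 * x) := by field_simp; linarith
  obtain rfl : q = 1 / (2 * y) := by field_simp; linarith
  have hb' : b = x - 2 * a * x ^ 2 := by field_simp at ef; linarith
  have hc' : c = y - 2 * a * y ^ 2 := by field_simp at eg; linarith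
  have hsum : a * (2 * x ^ 2 + 2 * y ^ 2 - 1) = x + y - 1 := by linarith
  have hne : x + y - 1 ≠ 0 := by
    intro h0
    have : x = 1 / 2 := by linarith
    have : y = 1 / 2 := by linarith
    subst x y
    -- Both chords are then the same median.
    obtain ⟨z, -, hz1, hz2⟩ := nonempty_of_area_pos (s := signRegion _ _ _ _ _)
      (by rw [h 1 (-1) one_ne_zero (by norm_num)]; positivity)
    simp only [lineForm_eq, sidePoint_apply] at hz1 hz2
    linarith
  have hpos : 0 < x + y - 1 := lt_of_le_of_ne (by linarith) hne.symm
  have hf0 : lineForm (sidePoint x B C) (sidePoint (1 / (2 * x)) A C) (sidePoint y C B) ≠ 0 := by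
    rw [lineForm_corner_foot]
    exact mul_ne_zero (neg_ne_zero.2 hD) (mul_pos hp0 hpos).ne'
  have hg0 : lineForm (sidePoint y C B) (sidePoint (1 / (2 * y)) A B) (sidePoint x B C) ≠ 0 := by
    rw [lineForm_corner_foot']
    exact mul_ne_zero hD (mul_pos hq0 hpos).ne'
  have h3 := h _ _ hf0 hg0
  rw [area_signRegion_foot hx hx1 hy hy1 ha hb hc hs hf hg hf0 hg0, abs_of_pos hpos] at h3
  have h4 : a * (x + y - 1) = 1 / 4 := by
    have : (a * (x + y - 1) - 1 / 4) * area (openTriangle A B C) = 0 := by linarith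
    rcases mul_eq_zero.1 this with h | h
    · linarith
    · exact absurd h hA.ne'
  refine ⟨⟨hx2, hx1, hy2, hy1, by linarith, ?_⟩, hxp, hyq⟩
  have h5 : (4 * (x + y - 1) ^ 2 - (2 * x ^ 2 + 2 * y ^ 2 - 1)) * a = 0 := by
    linear_combination 4 * (x + y - 1) * h4 - hsum
  rcases mul_eq_zero.1 h5 with h | h
  · linarith
  · exact absurd h ha.ne'

/-- Two chords cutting off the same corner never give four quarters: the two triangular regions
between them force `x = 3y` or `y = 3x`, which the bounds `1/2 ≤ x, y ≤ 1` exclude. -/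
lemma not_fourQuarters_of_same_corner {A B C : Plane} (hD : cross (B - A) (C - A) ≠ 0)
    {x p y q : ℝ} (hx : 0 ≤ x) (hx1 : x ≤ 1) (hp : 0 ≤ p) (hp1 : p ≤ 1) (hy : 0 ≤ y)
    (hy1 : y ≤ 1) (hq : 0 ≤ q) (hq1 : q ≤ 1) (hXP : sidePoint x B C ≠ sidePoint p A C)
    (hYQ : sidePoint y B C ≠ sidePoint q A C) :
    ¬ FourQuarters A B C (sidePoint x B C) (sidePoint p A C) (sidePoint y B C)
      (sidePoint q A C) := by
  intro h
  have hA := area_openTriangle_pos hD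
  obtain ⟨h1, h2, -⟩ := (fourQuarters_iff hD hXP hYQ (neg_ne_zero.2 hD) (neg_ne_zero.2 hD)).1 h
  obtain ⟨hx0, hp0, hxp⟩ := corner_of_half hD hx hx1 hp hp1 h1
  obtain ⟨hy0, hq0, hyq⟩ := corner_of_half hD hy hy1 hq hq1 h2
  have hx2 : 1 / 2 ≤ x := by nlinarith
  have hy2 : 1 / 2 ≤ y := by nlinarith
  obtain ⟨_, ⟨a, b, c, ha, hb, hc, hs, rfl⟩, hf, hg⟩ := h.exists_meet hD
  have ef := hf
  have eg := hg
  rw [lineForm_corner A B C _ _ _ _ _ hs, mul_eq_zero, or_iff_right (neg_ne_zero.2 hD)] at ef eg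
  obtain rfl : p = 1 / (2 * x) := by field_simp; linarith
  obtain rfl : q = 1 / (2 * y) := by field_simp; linarith
  have hbx : b = x - 2 * a * x ^ 2 := by field_simp at ef; linarith
  have hby : b = y - 2 * a * y ^ 2 := by field_simp at eg; linarith
  have hf0 : lineForm (sidePoint x B C) (sidePoint (1 / (2 * x)) A C) (sidePoint y B C) =
      -cross (B - A) (C - A) * (1 / (2 * x) * (x - y)) := by
    rw [sidePoint_eq_sub y, lineForm_corner_foot]; ring
  have hg0 : lineForm (sidePoint y B C) (sidePoint (1 / (2 * y)) A C) (sidePoint x B C) =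
      -cross (B - A) (C - A) * (1 / (2 * y) * (y - x)) := by
    rw [sidePoint_eq_sub x, lineForm_corner_foot]; ring
  have hne : x - y ≠ 0 := by
    intro h0
    obtain rfl : x = y := by linarith
    have := h 1 (-1) one_ne_zero (by norm_num)
    obtain ⟨z, -, hz1, hz2⟩ := nonempty_of_area_pos (s := signRegion _ _ _ _ _)
      (by rw [this]; positivity)
    linarith
  have hf1 : lineForm (sidePoint x B C) (sidePoint (1 / (2 * x)) A C) (sidePoint y B C) ≠ 0 := by
    rw [hf0]; exact mul_ne_zero (neg_ne_zero.2 hD) (mul_ne_zero hp0.ne' hne)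
  have hg1 : lineForm (sidePoint y B C) (sidePoint (1 / (2 * y)) A C) (sidePoint x B C) ≠ 0 := by
    rw [hg0]
    exact mul_ne_zero (neg_ne_zero.2 hD) (mul_ne_zero hq0.ne' (by intro h; apply hne; linarith))
  have h3 := h _ _ hf1 hg1
  rw [sidePoint_eq_sub y] at hg hf1 hg1 h3
  rw [area_signRegion_foot hx hx1 (by linarith) (by linarith) ha hb hc hs hf hg hf1 hg1,
    show x + (1 - y) - 1 = x - y by ring] at h3
  have h4 : a * |x - y| = 1 / 4 := by
    have : (a * |x - y| - 1 / 4) * area (openTriangle A B C) = 0 := by linarith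
    rcases mul_eq_zero.1 this with h | h
    · linarith
    · exact absurd h hA.ne'
  have h5 : 2 * a * (x + y) = 1 := by
    have : (x - y) * (1 - 2 * a * (x + y)) = 0 := by linear_combination hby - hbx
    rcases mul_eq_zero.1 this with h | h
    · exact absurd h hne
    · linarith
  have h6 : |x - y| ≤ 1 / 2 := abs_le.2 ⟨by linarith, by linarith⟩
  have h7 : |x - y| ≤ x + y - 1 := abs_le.2 ⟨by linarith, by linarith⟩
  have h8 : 1 / 2 ≤ a := by nlinarith
  nlinarith

/-- Conversely, every point of the arc gives four quarters. -/
lemma fourQuarters_of_isArc {A B C : Plane} (hD : cross (B - A) (C - A) ≠ 0) {x p y q : ℝ}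
    (h : IsArc x y) (hxp : x * p = 1 / 2) (hyq : y * q = 1 / 2)
    (hXP : sidePoint x B C ≠ sidePoint p A C) (hYQ : sidePoint y C B ≠ sidePoint q A B) :
    FourQuarters A B C (sidePoint x B C) (sidePoint p A C) (sidePoint y C B)
      (sidePoint q A B) := by
  obtain ⟨hx2, hx1, hy2, hy1, hlt, heq⟩ := h
  have hx : 0 < x := by linarith
  have hy : 0 < y := by linarith
  have hD' : cross (C - A) (B - A) ≠ 0 := by rw [cross_swap]; exact neg_ne_zero.2 hD
  obtain rfl : p = 1 / (2 * x) := by field_simp; linarith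
  obtain rfl : q = 1 / (2 * y) := by field_simp; linarith
  have hp1 : 1 / (2 * x) ≤ 1 := by rw [div_le_one (by positivity)]; linarith
  have hq1 : 1 / (2 * y) ≤ 1 := by rw [div_le_one (by positivity)]; linarith
  have hp0 : 0 < 1 / (2 * x) := by positivity
  have hq0 : 0 < 1 / (2 * y) := by positivity
  have hpos : 0 < x + y - 1 := by linarith
  -- The arc lies on the branch `5/3 ≤ x + y` of a hyperbola.
  have hs53 : 5 / 3 ≤ x + y := by
    have : (3 * (x + y) - 5) * (x + y - 1) = (x - y) ^ 2 := by linarith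
    by_contra hcon
    have : (3 * (x + y) - 5) * (x + y - 1) < 0 := mul_neg_of_neg_of_pos (by linarith) hpos
    nlinarith [sq_nonneg (x - y)]
  obtain ⟨a, ha⟩ : ∃ a, a = 1 / (4 * (x + y - 1)) := ⟨_, rfl⟩
  have ha0 : 0 < a := by rw [ha]; positivity
  have h4 : a * (x + y - 1) = 1 / 4 := by rw [ha]; field_simp
  have hsum : a * (2 * x ^ 2 + 2 * y ^ 2 - 1) = x + y - 1 := by
    rw [← heq]; linear_combination 4 * (x + y - 1) * h4
  have hb : 0 < x - 2 * a * x ^ 2 := by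
    have : 2 * a * x < 1 := by
      have : 0 < a * (2 * (x + y - 1) - x) := mul_pos ha0 (by linarith)
      linarith
    nlinarith
  have hc : 0 < y - 2 * a * y ^ 2 := by
    have : 2 * a * y < 1 := by
      have : 0 < a * (2 * (x + y - 1) - y) := mul_pos ha0 (by linarith)
      linarith
    nlinarith
  have hs : a + (x - 2 * a * x ^ 2) + (y - 2 * a * y ^ 2) = 1 := by linarith
  have hf0 : lineForm (sidePoint x B C) (sidePoint (1 / (2 * x)) A C) (sidePoint y C B) ≠ 0 := by
    rw [lineForm_corner_foot]
    exact mul_ne_zero (neg_ne_zero.2 hD) (mul_pos hp0 hpos).ne'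
  have hg0 : lineForm (sidePoint y C B) (sidePoint (1 / (2 * y)) A B) (sidePoint x B C) ≠ 0 := by
    rw [lineForm_corner_foot']
    exact mul_ne_zero hD (mul_pos hq0 hpos).ne'
  have hf : lineForm (sidePoint x B C) (sidePoint (1 / (2 * x)) A C)
      (a • A + (x - 2 * a * x ^ 2) • B + (y - 2 * a * y ^ 2) • C) = 0 := by
    rw [lineForm_corner A B C _ _ _ _ _ hs]
    field_simp; ring
  have hg : lineForm (sidePoint y C B) (sidePoint (1 / (2 * y)) A B)
      (a • A + (x - 2 * a * x ^ 2) • B + (y - 2 * a * y ^ 2) • C) = 0 := by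
    rw [lineForm_corner' A B C _ _ _ _ _ hs]
    field_simp; ring
  rw [fourQuarters_iff hD hXP hYQ hf0 hg0]
  refine ⟨?_, ?_, ?_⟩
  · rw [halfRegion_of_pos (c' := -cross (B - A) (C - A)),
      area_halfRegion_corner hD hx hx1 hp0 hp1, hxp]
    · ring
    · rw [lineForm_corner_foot]
      have : 0 < cross (B - A) (C - A) ^ 2 * (1 / (2 * x) * (x + y - 1)) := by positivity
      linarith
  · rw [halfRegion_of_pos (c' := -cross (C - A) (B - A)), ← openTriangle_swap,
      area_halfRegion_corner hD' hy hy1 hq0 hq1, hyq]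
    · ring
    · rw [lineForm_corner_foot', cross_swap A B C]
      have : 0 < cross (B - A) (C - A) ^ 2 * (1 / (2 * y) * (x + y - 1)) := by positivity
      linarith
  · rw [area_signRegion_foot hx.le hx1 hy.le hy1 ha0 hb hc hs hf hg hf0 hg0, abs_of_pos hpos, h4]
    ring

/-! ### Quadrisections along the three sides -/

/-- The pair of area-halving chords with feet at the fractions `x` (from `C`) and `y` (from `B`)
of the side `BC`. -/
noncomputable def chordPair (A B C : Plane) (x y : ℝ) : Sym2 (Set Plane) :=
  s(segment ℝ (sidePoint x B C) (sidePoint (1 / (2 * x)) A C),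
    segment ℝ (sidePoint y C B) (sidePoint (1 / (2 * y)) A B))

/-- `q` is a quadrisection whose triangular region lies along the side `BC`. -/
def FromSide (A B C : Plane) (q : Sym2 (Set Plane)) : Prop :=
  ∃ x y, IsArc x y ∧ PerpCond A B C x y ∧ q = chordPair A B C x y

lemma IsArc.symm {x y : ℝ} (h : IsArc x y) : IsArc y x :=
  ⟨h.half_le_y, h.y_le_one, h.half_le_x, h.x_le_one, by linarith [h.one_lt], by
    linear_combination h.eq⟩

lemma chordPair_swap (A B C : Plane) (x y : ℝ) : chordPair A C B y x = chordPair A B C x y :=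
  Sym2.eq_swap

lemma perpCond_swap {A B C : Plane} {x y : ℝ} : PerpCond A C B y x ↔ PerpCond A B C x y := by
  rw [PerpCond, PerpCond, conway_swap A B C, conway_swap C A B, conway_swap B C A, add_comm]

lemma FromSide.swap {A B C : Plane} {q : Sym2 (Set Plane)} (h : FromSide A B C q) :
    FromSide A C B q := by
  obtain ⟨x, y, hxy, hp, rfl⟩ := h
  exact ⟨y, x, hxy.symm, perpCond_swap.2 hp, (chordPair_swap A B C x y).symm⟩

lemma FourQuarters.swap_left {A B C X P Y Q : Plane} (h : FourQuarters A B C X P Y Q) :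
    FourQuarters A B C P X Y Q := by
  intro c d hc hd
  rw [← h (-c) d (neg_ne_zero.2 hc) hd]
  congr 1
  ext z
  simp [signRegion, lineForm_swap X P]

lemma FourQuarters.swap_right {A B C X P Y Q : Plane} (h : FourQuarters A B C X P Y Q) :
    FourQuarters A B C X P Q Y := by
  intro c d hc hd
  rw [← h c (-d) hc (neg_ne_zero.2 hd)]
  congr 1
  ext z
  simp [signRegion, lineForm_swap Y Q]

lemma FourQuarters.swap {A B C X P Y Q : Plane} (h : FourQuarters A B C X P Y Q) :
    FourQuarters A B C Y Q X P := fun c d hc hd => by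
  rw [signRegion_comm]; exact h d c hd hc

/-- A chord lying in one side does not divide the triangle. -/
lemma not_fourQuarters_of_same_side {A B C Y Q : Plane} (hD : cross (B - A) (C - A) ≠ 0)
    {x p : ℝ} : ¬ FourQuarters A B C (sidePoint x B C) (sidePoint p B C) Y Q := by
  intro h
  have hA := area_openTriangle_pos hD
  have e : ∀ a b c : ℝ, a + b + c = 1 →
      lineForm (sidePoint x B C) (sidePoint p B C) (a • A + b • B + c • C) =
        a * ((x - p) * cross (B - A) (C - A)) := by
    intro a b c hs
    obtain rfl : c = 1 - a - b := by linarith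
    simp only [lineForm_eq, cross_sub_sub, sidePoint_apply, PiLp.add_apply, PiLp.smul_apply,
      smul_eq_mul]
    ring
  obtain ⟨_, ⟨a, b, c, ha, hb, hc, hs, rfl⟩, hz, -⟩ :=
    nonempty_of_area_pos (s := signRegion _ _ _ _ _)
      (by rw [h 1 1 one_ne_zero one_ne_zero]; positivity)
  obtain ⟨_, ⟨a', b', c', ha', hb', hc', hs', rfl⟩, hz', -⟩ :=
    nonempty_of_area_pos (s := signRegion _ _ _ _ _)
      (by rw [h (-1) 1 (by norm_num) one_ne_zero]; positivity)
  rw [e a b c hs, mul_one] at hz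
  rw [e a' b' c' hs'] at hz'
  have := pos_of_mul_pos_right hz ha.le
  nlinarith [mul_pos ha' this]

/-- `X` lies on the side of `T` opposite to the vertex `T i`. -/
def OnSide (T : Fin 3 → Plane) (i : Fin 3) (X : Plane) : Prop :=
  ∃ w : Fin 3 → ℝ, (∀ l, 0 ≤ w l) ∧ w 0 + w 1 + w 2 = 1 ∧ w i = 0 ∧
    X = w 0 • T 0 + w 1 • T 1 + w 2 • T 2

lemma OnSide.exists_sidePoint {T : Fin 3 → Plane} {i j k : Fin 3} (hij : i ≠ j) (hik : i ≠ k)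
    (hjk : j ≠ k) {X : Plane} (h : OnSide T i X) :
    ∃ x : ℝ, 0 ≤ x ∧ x ≤ 1 ∧ X = sidePoint x (T j) (T k) := by
  obtain ⟨w, hw, hs, hi, rfl⟩ := h
  have h3 : w i + w j + w k = 1 := by
    rw [← hs]
    fin_cases i <;> fin_cases j <;> fin_cases k <;> simp at hij hik hjk ⊢ <;> ring
  have e : w 0 • T 0 + w 1 • T 1 + w 2 • T 2 = w i • T i + w j • T j + w k • T k := by
    fin_cases i <;> fin_cases j <;> fin_cases k <;> simp at hij hik hjk ⊢ <;> abel
  refine ⟨w j, hw j, by linarith [hw k], ?_⟩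
  rw [e, hi, zero_smul, zero_add, sidePoint]
  congr 2
  linarith

lemma onSide_sidePoint {T : Fin 3 → Plane} {i j k : Fin 3} (hij : i ≠ j) (hik : i ≠ k)
    (hjk : j ≠ k) {x : ℝ} (hx : 0 ≤ x) (hx1 : x ≤ 1) : OnSide T i (sidePoint x (T j) (T k)) := by
  have hx2 := sub_nonneg.2 hx1
  refine ⟨fun l => if l = j then x else if l = k then 1 - x else 0, ?_, ?_, ?_, ?_⟩
  · intro l
    dsimp only
    split_ifs <;> first | assumption | exact le_rfl
  · fin_cases i <;> fin_cases j <;> fin_cases k <;> simp at hij hik hjk ⊢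
  · simp [hij, hik]
  · fin_cases i <;> fin_cases j <;> fin_cases k <;> simp [sidePoint] at hij hik hjk ⊢ <;> abel

lemma mem_frontier_iff_onSide {T : Fin 3 → Plane} (hT : AffineIndependent ℝ T) {X : Plane} :
    X ∈ frontier (triangleRegion T) ↔ ∃ i, OnSide T i X := by
  rw [mem_frontier_triangleRegion hT]
  constructor
  · rintro ⟨w, hw, hs, ⟨i, hi⟩, rfl⟩
    exact ⟨i, w, hw, hs, hi, rfl⟩
  · rintro ⟨i, w, hw, hs, hi, rfl⟩
    exact ⟨w, hw, hs, ⟨i, hi⟩, rfl⟩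

lemma openTriangle_perm (T : Fin 3 → Plane) {i j k : Fin 3} (hij : i ≠ j) (hik : i ≠ k)
    (hjk : j ≠ k) : openTriangle (T i) (T j) (T k) = openTriangle (T 0) (T 1) (T 2) := by
  have h1 := openTriangle_rotate (T 0) (T 1) (T 2)
  have h2 := openTriangle_rotate (T 1) (T 2) (T 0)
  have h3 := openTriangle_swap (T 0) (T 1) (T 2)
  have h4 := openTriangle_swap (T 1) (T 2) (T 0)
  have h5 := openTriangle_swap (T 2) (T 0) (T 1)
  fin_cases i <;> fin_cases j <;> fin_cases k <;> simp at hij hik hjk ⊢ <;>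
    simp only [h5, h4, h3, h2, h1]

lemma cross_ne_zero_perm {T : Fin 3 → Plane} (hT : AffineIndependent ℝ T) {i j k : Fin 3}
    (hij : i ≠ j) (hik : i ≠ k) (hjk : j ≠ k) : cross (T j - T i) (T k - T i) ≠ 0 := by
  intro h
  apply cross_ne_zero_of_affineIndependent hT
  rw [cross_sub_sub] at h ⊢
  fin_cases i <;> fin_cases j <;> fin_cases k <;> simp at hij hik hjk h ⊢ <;>
    first | linear_combination h | linear_combination -h

lemma FourQuarters.perm {T : Fin 3 → Plane} {X P Y Q : Plane} {i j k : Fin 3} (hij : i ≠ j)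
    (hik : i ≠ k) (hjk : j ≠ k) :
    FourQuarters (T i) (T j) (T k) X P Y Q ↔ FourQuarters (T 0) (T 1) (T 2) X P Y Q := by
  unfold FourQuarters
  rw [openTriangle_perm T hij hik hjk]

lemma exists_third (i j : Fin 3) : ∃ k, i ≠ k ∧ j ≠ k := by
  revert i j; decide

lemma fromSide_of_fourQuarters {T : Fin 3 → Plane} (hT : AffineIndependent ℝ T)
    {X P Y Q : Plane} (hXP : X ≠ P) (hYQ : Y ≠ Q) (hperp : inner ℝ (P - X) (Q - Y) = 0)
    (h : FourQuarters (T 0) (T 1) (T 2) X P Y Q) {i j k : Fin 3} (hij : i ≠ j) (hik : i ≠ k)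
    (hX : OnSide T i X) (hY : OnSide T i Y) (hP : OnSide T j P) (hQ : OnSide T k Q) :
    ∃ i j k : Fin 3, i ≠ j ∧ i ≠ k ∧ j ≠ k ∧
      FromSide (T i) (T j) (T k) s(segment ℝ X P, segment ℝ Y Q) := by
  rcases eq_or_ne j k with rfl | hjk
  · exfalso
    obtain ⟨l, hil, hjl⟩ := exists_third i j
    obtain ⟨x, hx, hx1, rfl⟩ := hX.exists_sidePoint hij hil hjl
    obtain ⟨p, hp, hp1, rfl⟩ := hP.exists_sidePoint hij.symm hjl hil
    obtain ⟨y, hy, hy1, rfl⟩ := hY.exists_sidePoint hij hil hjl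
    obtain ⟨q, hq, hq1, rfl⟩ := hQ.exists_sidePoint hij.symm hjl hil
    exact not_fourQuarters_of_same_corner (cross_ne_zero_perm hT hij hil hjl) hx hx1 hp hp1
      hy hy1 hq hq1 hXP hYQ ((FourQuarters.perm hij hil hjl).2 h)
  · obtain ⟨x, hx, hx1, rfl⟩ := hX.exists_sidePoint hij hik hjk
    obtain ⟨p, hp, hp1, rfl⟩ := hP.exists_sidePoint hij.symm hjk hik
    obtain ⟨y, hy, hy1, rfl⟩ := hY.exists_sidePoint hik hij hjk.symm
    obtain ⟨q, hq, hq1, rfl⟩ := hQ.exists_sidePoint hik.symm hjk.symm hij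
    obtain ⟨harc, hxp, hyq⟩ := isArc_of_fourQuarters (cross_ne_zero_perm hT hij hik hjk) hx hx1
      hp hp1 hy hy1 hq hq1 hXP hYQ ((FourQuarters.perm hij hik hjk).2 h)
    have hx0 : 0 < x := by linarith [harc.half_le_x]
    have hy0 : 0 < y := by linarith [harc.half_le_y]
    refine ⟨i, j, k, hij, hik, hjk, x, y, harc,
      (inner_chords_eq_zero_iff _ _ _ hx0 hy0 hxp hyq).1 hperp, ?_⟩
    obtain rfl : p = 1 / (2 * x) := by field_simp; linarith
    obtain rfl : q = 1 / (2 * y) := by field_simp; linarith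
    rfl

lemma OnSide.ne_of_fourQuarters {T : Fin 3 → Plane} (hT : AffineIndependent ℝ T)
    {X P Y Q : Plane} (h : FourQuarters (T 0) (T 1) (T 2) X P Y Q) {i j : Fin 3}
    (hX : OnSide T i X) (hP : OnSide T j P) : i ≠ j := by
  rintro rfl
  have other : ∀ i : Fin 3, ∃ j, i ≠ j := by decide
  obtain ⟨j, hij⟩ := other i
  obtain ⟨k, hik, hjk⟩ := exists_third i j
  obtain ⟨x, hx, hx1, rfl⟩ := hX.exists_sidePoint hij hik hjk
  obtain ⟨p, hp, hp1, rfl⟩ := hP.exists_sidePoint hij hik hjk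
  exact not_fourQuarters_of_same_side (cross_ne_zero_perm hT hij hik hjk)
    ((FourQuarters.perm hij hik hjk).2 h)

lemma sidePoint_ne {A B C : Plane} (hD : cross (B - A) (C - A) ≠ 0) {x p : ℝ} (hp : p ≠ 0) :
    sidePoint x B C ≠ sidePoint p A C := by
  intro h
  have h0 := congrArg (fun z : Plane => z 0) h
  have h1 := congrArg (fun z : Plane => z 1) h
  simp only [sidePoint_apply] at h0 h1
  rw [cross_sub_sub] at hD
  refine hD ((mul_eq_zero.1 (?_ : p * _ = 0)).resolve_left hp)
  linear_combination (C 1 - B 1) * h0 - (C 0 - B 0) * h1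

lemma isQuadrisection_of_isArc {T : Fin 3 → Plane} (hT : AffineIndependent ℝ T) {i j k : Fin 3}
    (hij : i ≠ j) (hik : i ≠ k) (hjk : j ≠ k) {x y : ℝ} (h : IsArc x y)
    (hperp : PerpCond (T i) (T j) (T k) x y) :
    IsQuadrisection T (sidePoint x (T j) (T k)) (sidePoint (1 / (2 * x)) (T i) (T k))
      (sidePoint y (T k) (T j)) (sidePoint (1 / (2 * y)) (T i) (T j)) := by
  have hD := cross_ne_zero_perm hT hij hik hjk
  have hx0 : 0 < x := by linarith [h.half_le_x]
  have hy0 : 0 < y := by linarith [h.half_le_y]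
  have hxp : x * (1 / (2 * x)) = 1 / 2 := by field_simp
  have hyq : y * (1 / (2 * y)) = 1 / 2 := by field_simp
  have hp0 : 0 < 1 / (2 * x) := by positivity
  have hq0 : 0 < 1 / (2 * y) := by positivity
  have hp1 : 1 / (2 * x) ≤ 1 := by rw [div_le_one (by positivity)]; linarith [h.half_le_x]
  have hq1 : 1 / (2 * y) ≤ 1 := by rw [div_le_one (by positivity)]; linarith [h.half_le_y]
  have hXP := sidePoint_ne (x := x) hD hp0.ne'
  have hYQ := sidePoint_ne (x := y) (cross_ne_zero_perm hT hik hij hjk.symm) hq0.ne'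
  rw [isQuadrisection_iff hT]
  simp only [mem_frontier_iff_onSide hT]
  exact ⟨⟨i, onSide_sidePoint hij hik hjk hx0.le h.x_le_one⟩,
    ⟨j, onSide_sidePoint hij.symm hjk hik hp0.le hp1⟩,
    ⟨i, onSide_sidePoint hik hij hjk.symm hy0.le h.y_le_one⟩,
    ⟨k, onSide_sidePoint hik.symm hjk.symm hij hq0.le hq1⟩, hXP, hYQ,
    (inner_chords_eq_zero_iff _ _ _ hx0 hy0 hxp hyq).2 hperp,
    (FourQuarters.perm hij hik hjk).1 (fourQuarters_of_isArc hD h hxp hyq hXP hYQ)⟩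

/-- The quadrisections of a triangle are the perpendicular chord pairs of the arc, taken along each
of the three sides. -/
theorem mem_quadrisections_iff {T : Fin 3 → Plane} (hT : AffineIndependent ℝ T)
    {q : Sym2 (Set Plane)} :
    q ∈ quadrisections T ↔ FromSide (T 0) (T 1) (T 2) q ∨ FromSide (T 1) (T 2) (T 0) q ∨
      FromSide (T 2) (T 0) (T 1) q := by
  have back : ∀ i j k : Fin 3, i ≠ j → i ≠ k → j ≠ k → FromSide (T i) (T j) (T k) q →
      q ∈ quadrisections T := by
    rintro i j k hij hik hjk ⟨x, y, h, hperp, rfl⟩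
    exact ⟨_, _, _, _, isQuadrisection_of_isArc hT hij hik hjk h hperp, rfl⟩
  constructor
  · rintro ⟨X, P, Y, Q, hq, rfl⟩
    rw [isQuadrisection_iff hT] at hq
    obtain ⟨hX, hP, hY, hQ, hXP, hYQ, hperp, h⟩ := hq
    change FourQuarters (T 0) (T 1) (T 2) X P Y Q at h
    simp only [mem_frontier_iff_onSide hT] at hX hP hY hQ
    obtain ⟨i, hX⟩ := hX
    obtain ⟨j, hP⟩ := hP
    obtain ⟨i', hY⟩ := hY
    obtain ⟨j', hQ⟩ := hQ
    have hij := hX.ne_of_fourQuarters hT h hP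
    have hij' := hY.ne_of_fourQuarters hT h.swap hQ
    have hperp1 : inner ℝ (X - P) (Q - Y) = 0 := by
      rw [← neg_sub P X, inner_neg_left, hperp, neg_zero]
    have hperp2 : inner ℝ (P - X) (Y - Q) = 0 := by
      rw [← neg_sub Q Y, inner_neg_right, hperp, neg_zero]
    have hperp3 : inner ℝ (X - P) (Y - Q) = 0 := by
      rw [← neg_sub Q Y, inner_neg_right, hperp1, neg_zero]
    have common : i = i' ∨ i = j' ∨ j = i' ∨ j = j' := by
      have : ∀ i j i' j' : Fin 3, i ≠ j → i' ≠ j' → i = i' ∨ i = j' ∨ j = i' ∨ j = j' := by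
        decide
      exact this i j i' j' hij hij'
    have key : ∃ i j k : Fin 3, i ≠ j ∧ i ≠ k ∧ j ≠ k ∧
        FromSide (T i) (T j) (T k) s(segment ℝ X P, segment ℝ Y Q) := by
      rcases common with rfl | rfl | rfl | rfl
      · exact fromSide_of_fourQuarters hT hXP hYQ hperp h hij hij' hX hY hP hQ
      · rw [segment_symm ℝ Y Q]
        exact fromSide_of_fourQuarters hT hXP hYQ.symm hperp2 h.swap_right hij hij'.symm
          hX hQ hP hY
      · rw [segment_symm ℝ X P]
        exact fromSide_of_fourQuarters hT hXP.symm hYQ hperp1 h.swap_left hij.symm hij'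
          hP hY hX hQ
      · rw [segment_symm ℝ Y Q, segment_symm ℝ X P]
        exact fromSide_of_fourQuarters hT hXP.symm hYQ.symm hperp3 h.swap_left.swap_right
          hij.symm hij'.symm hP hQ hX hY
    obtain ⟨i, j, k, hij, hik, hjk, hF⟩ := key
    have hF' := hF.swap
    clear hX hP hY hQ common hij'
    fin_cases i <;> fin_cases j <;> fin_cases k <;> simp at hij hik hjk hF hF' <;> tauto
  · rintro (h | h | h)
    · exact back 0 1 2 (by decide) (by decide) (by decide) h
    · exact back 1 2 0 (by decide) (by decide) (by decide) h
    · exact back 2 0 1 (by decide) (by decide) (by decide) h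

/-! ### The rational parametrization of the arc -/

/-- The bound of the arc parameter. -/
noncomputable def arcEnd : ℝ := √2 - 1

/-- Half of `x + y - 1` on the arc. -/
noncomputable def arcV (t : ℝ) : ℝ := 1 / (3 - t ^ 2)

/-- The coordinate `x` on the arc, in the rational parametrization of the hyperbola by
`t = (x - y) / (x + y - 1)`; the coordinate `y` is `arcX (-t)`. -/
noncomputable def arcX (t : ℝ) : ℝ := 1 / 2 + arcV t + t * arcV t

/-- The difference of the two coefficients in `PerpCond`. -/
noncomputable def arcM (t : ℝ) : ℝ := 4 * t * arcV t * (1 + 2 * arcV t)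

/-- The sum of the two coefficients in `PerpCond`. -/
noncomputable def arcP (t : ℝ) : ℝ :=
  1 + (1 - 8 * arcV t ^ 2) * (8 * arcV t - 4 * arcV t ^ 2 - 3 / 2)

/-- The slope of the chord from the point `(arcM t, arcP t)` to the end `(1, 1)` of the coefficient
curve, up to sign. That it increases is the concavity of the curve as seen from that end. -/
noncomputable def arcSlope (t : ℝ) : ℝ :=
  (8 * arcV t - 4 * arcV t ^ 2 - 3 / 2) / (24 * arcV t ^ 2 + 16 * arcV t + 1) * (1 + arcM t)

lemma sqrt_two_sq : √2 ^ 2 = (2 : ℝ) := Real.sq_sqrt (by norm_num)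

lemma sqrt_two_bounds : 1.414 < √2 ∧ √2 < 1.415 := by
  constructor
  · exact Real.lt_sqrt_of_sq_lt (by norm_num)
  · rw [Real.sqrt_lt' (by norm_num)]; norm_num

lemma arcEnd_pos : 0 < arcEnd := by
  have := sqrt_two_bounds.1
  unfold arcEnd; linarith

lemma arcEnd_sq : arcEnd ^ 2 = 3 - 2 * √2 := by
  have := sqrt_two_sq
  unfold arcEnd; linear_combination this

lemma sq_le_of_mem {t : ℝ} (ht : t ∈ Icc (-arcEnd) arcEnd) : t ^ 2 ≤ 3 - 2 * √2 := by
  rw [← arcEnd_sq]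
  exact sq_le_sq' ht.1 ht.2

lemma arcDen_pos {t : ℝ} (ht : t ∈ Icc (-arcEnd) arcEnd) : 0 < 3 - t ^ 2 := by
  have := sq_le_of_mem ht
  have := sqrt_two_bounds
  linarith

lemma arcV_mul {t : ℝ} (ht : t ∈ Icc (-arcEnd) arcEnd) : t ^ 2 * arcV t = 3 * arcV t - 1 := by
  have := arcDen_pos ht
  unfold arcV; field_simp; ring

lemma arcV_neg (t : ℝ) : arcV (-t) = arcV t := by simp [arcV]

lemma arcM_neg (t : ℝ) : arcM (-t) = -arcM t := by
  simp only [arcM, arcV_neg]; ring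

lemma arcP_neg (t : ℝ) : arcP (-t) = arcP t := by simp only [arcP, arcV_neg]

lemma neg_mem_arc {t : ℝ} (ht : t ∈ Icc (-arcEnd) arcEnd) : -t ∈ Icc (-arcEnd) arcEnd :=
  ⟨by linarith [ht.2], by linarith [ht.1]⟩

lemma end_mem_arc : arcEnd ∈ Icc (-arcEnd) arcEnd := ⟨by linarith [arcEnd_pos], le_rfl⟩

lemma zero_mem_arc : (0 : ℝ) ∈ Icc (-arcEnd) arcEnd := ⟨by linarith [arcEnd_pos], arcEnd_pos.le⟩

lemma arcV_ge {t : ℝ} (ht : t ∈ Icc (-arcEnd) arcEnd) : 1 / 3 ≤ arcV t := by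
  have := arcDen_pos ht
  unfold arcV
  exact one_div_le_one_div_of_le this (by linarith [sq_nonneg t])

lemma arcV_sq_le {t : ℝ} (ht : t ∈ Icc (-arcEnd) arcEnd) : 8 * arcV t ^ 2 ≤ 1 := by
  have h1 := arcDen_pos ht
  have h2 := sq_le_of_mem ht
  have h3 : 8 ≤ (3 - t ^ 2) ^ 2 := by
    have := sqrt_two_sq
    have := sqrt_two_bounds
    nlinarith
  unfold arcV
  rw [div_pow, one_pow, mul_one_div, div_le_one (by positivity)]
  exact h3

lemma arcV_le {t : ℝ} (ht : t ∈ Icc (-arcEnd) arcEnd) : arcV t ≤ 9 / 25 := by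
  have := arcV_sq_le ht
  nlinarith

lemma arcV_lt {s t : ℝ} (ht : t ∈ Icc (-arcEnd) arcEnd) (hst : s ^ 2 < t ^ 2) :
    arcV s < arcV t := by
  unfold arcV
  exact one_div_lt_one_div_of_lt (arcDen_pos ht) (by linarith)

lemma arcV_end : arcV arcEnd = √2 / 4 := by
  have := sqrt_two_sq
  have := sqrt_two_bounds
  rw [arcV, arcEnd_sq, show 3 - (3 - 2 * √2) = 2 * √2 by ring,
    div_eq_div_iff (by linarith) (by norm_num)]
  nlinarith

lemma arcX_end : arcX arcEnd = 1 := by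
  have := sqrt_two_sq
  rw [arcX, arcV_end, arcEnd]
  linear_combination (1 / 4) * this

lemma arcX_neg_end : arcX (-arcEnd) = √2 / 2 := by
  have := sqrt_two_sq
  rw [arcX, arcV_neg, arcV_end, arcEnd]
  linear_combination (-1 / 4) * this

lemma arcM_end : arcM arcEnd = 1 := by
  have := sqrt_two_sq
  rw [arcM, arcV_end, arcEnd]
  linear_combination (√2 / 2 + 1 / 2) * this

lemma arcP_end : arcP arcEnd = 1 := by
  have := sqrt_two_sq
  rw [arcP, arcV_end]
  linear_combination (-1 / 2) * (8 * (√2 / 4) - 4 * (√2 / 4) ^ 2 - 3 / 2) * this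

lemma one_sub_arcM_sq {t : ℝ} (ht : t ∈ Icc (-arcEnd) arcEnd) :
    1 - arcM t ^ 2 = (1 - 8 * arcV t ^ 2) * (24 * arcV t ^ 2 + 16 * arcV t + 1) := by
  have := arcV_mul ht
  rw [arcM]
  linear_combination (-16 * arcV t * (1 + 2 * arcV t) ^ 2) * this

lemma arcP_eq {t : ℝ} (ht : t ∈ Icc (-arcEnd) arcEnd) :
    arcP t = 1 + arcSlope t * (1 - arcM t) := by
  have h1 := one_sub_arcM_sq ht
  have h2 := arcV_ge ht
  have h3 : 24 * arcV t ^ 2 + 16 * arcV t + 1 ≠ 0 := by positivity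
  have h4 : (1 + arcM t) * (1 - arcM t) =
    (1 - 8 * arcV t ^ 2) * (24 * arcV t ^ 2 + 16 * arcV t + 1) := by rw [← h1]; ring
  rw [arcP, arcSlope, mul_assoc, h4]
  field_simp

lemma coeff_sum {t : ℝ} (ht : t ∈ Icc (-arcEnd) arcEnd) :
    2 * arcX t ^ 2 * (2 * arcX (-t) ^ 2 - 1) + 2 * arcX (-t) ^ 2 * (2 * arcX t ^ 2 - 1) =
      arcP t := by
  have := arcV_mul ht
  simp only [arcX, arcV_neg, arcP]
  generalize arcV t = v at this ⊢
  linear_combination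
    (8 * v * (-(1 / 2 + v) ^ 2 * 2) + 8 * v ^ 2 * (t ^ 2 * v + 3 * v - 1) - 4 * v) * this

lemma coeff_diff (t : ℝ) :
    2 * arcX (-t) ^ 2 * (2 * arcX t ^ 2 - 1) - 2 * arcX t ^ 2 * (2 * arcX (-t) ^ 2 - 1) =
      arcM t := by
  simp only [arcX, arcV_neg, arcM]; ring

/-! ### Monotonicity along the arc -/

lemma arcV_continuousOn : ContinuousOn arcV (Icc (-arcEnd) arcEnd) := by
  unfold arcV
  exact continuousOn_const.div (by fun_prop) fun t ht => (arcDen_pos ht).ne'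

lemma arcM_continuousOn : ContinuousOn arcM (Icc (-arcEnd) arcEnd) := by
  have := arcV_continuousOn
  unfold arcM
  fun_prop

lemma arcP_continuousOn : ContinuousOn arcP (Icc (-arcEnd) arcEnd) := by
  have := arcV_continuousOn
  unfold arcP
  fun_prop

lemma arcSlope_continuousOn : ContinuousOn arcSlope (Icc (-arcEnd) arcEnd) := by
  have h1 := arcV_continuousOn
  have h2 := arcM_continuousOn
  unfold arcSlope
  refine (ContinuousOn.div (by fun_prop) (by fun_prop) fun t ht => ?_).mul (by fun_prop)
  have := arcV_ge ht
  positivity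

lemma sq_lt_sq_of_nonneg {s t : ℝ} (hs : 0 ≤ s) (hst : s < t) : s ^ 2 < t ^ 2 := by nlinarith

lemma arcM_lt_of_nonneg {s t : ℝ} (ht : t ∈ Icc (-arcEnd) arcEnd) (hs : 0 ≤ s) (hst : s < t) :
    arcM s < arcM t := by
  have hsm : s ∈ Icc (-arcEnd) arcEnd := ⟨by linarith [arcEnd_pos], by linarith [ht.2]⟩
  have h1 := arcV_lt ht (sq_lt_sq_of_nonneg hs hst)
  have h2 := arcV_ge hsm
  have hs0 : 0 < arcV s := by linarith
  have ht0 : 0 < arcV t := by linarith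
  unfold arcM
  have h3 : s * (arcV s * (1 + 2 * arcV s)) ≤ s * (arcV t * (1 + 2 * arcV t)) := by
    gcongr
  have h4 : s * (arcV t * (1 + 2 * arcV t)) < t * (arcV t * (1 + 2 * arcV t)) := by
    have : 0 < arcV t * (1 + 2 * arcV t) := by positivity
    gcongr
  linarith

lemma arcM_strictMonoOn : StrictMonoOn arcM (Icc (-arcEnd) arcEnd) := by
  intro s hs t ht hst
  have h0 : arcM 0 = 0 := by simp [arcM]
  rcases le_or_gt 0 s with h | h
  · exact arcM_lt_of_nonneg ht h hst
  rcases le_or_gt t 0 with h' | h'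
  · have := arcM_lt_of_nonneg (neg_mem_arc hs) (neg_nonneg.2 h') (neg_lt_neg hst)
    rw [arcM_neg, arcM_neg] at this
    linarith
  · have h1 := arcM_lt_of_nonneg ht le_rfl h'
    have h2 := arcM_lt_of_nonneg (neg_mem_arc hs) le_rfl (neg_pos.2 h)
    rw [arcM_neg] at h2
    linarith

lemma arcM_neg_end : arcM (-arcEnd) = -1 := by rw [arcM_neg, arcM_end]

lemma arcM_ge {t : ℝ} (ht : t ∈ Icc (-arcEnd) arcEnd) : -1 ≤ arcM t := by
  rw [← arcM_neg_end]
  exact arcM_strictMonoOn.monotoneOn (neg_mem_arc end_mem_arc) ht ht.1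

lemma arcM_lt_one {t : ℝ} (ht : t ∈ Icc (-arcEnd) arcEnd) (h : t < arcEnd) : arcM t < 1 := by
  rw [← arcM_end]
  exact arcM_strictMonoOn ht end_mem_arc h

lemma arcM_le {t : ℝ} (ht : t ∈ Icc (-arcEnd) arcEnd) : arcM t ≤ 1 := by
  rw [← arcM_end]
  exact arcM_strictMonoOn.monotoneOn ht end_mem_arc ht.2

lemma arcP_lt_of_sq_lt {s t : ℝ} (hs : s ∈ Icc (-arcEnd) arcEnd) (ht : t ∈ Icc (-arcEnd) arcEnd)
    (h : s ^ 2 < t ^ 2) : arcP t < arcP s := by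
  have h1 := arcV_lt ht h
  have h2 := arcV_ge hs
  have h3 := arcV_le ht
  unfold arcP
  generalize arcV s = v at *
  generalize arcV t = w at *
  have e : (1 + (1 - 8 * v ^ 2) * (8 * v - 4 * v ^ 2 - 3 / 2)) -
      (1 + (1 - 8 * w ^ 2) * (8 * w - 4 * w ^ 2 - 3 / 2)) =
      (w - v) * (64 * (v ^ 2 + v * w + w ^ 2) - 8 - 8 * (v + w) -
        32 * (v + w) * (v ^ 2 + w ^ 2)) := by ring
  have hpos : 0 < 64 * (v ^ 2 + v * w + w ^ 2) - 8 - 8 * (v + w) -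
      32 * (v + w) * (v ^ 2 + w ^ 2) := by
    have a1 : 1 / 9 ≤ v ^ 2 := by nlinarith
    have a2 : 1 / 9 ≤ w ^ 2 := by nlinarith
    have a3 : 1 / 9 ≤ v * w := by nlinarith
    have a4 : v ^ 2 + w ^ 2 ≤ 0.26 := by nlinarith
    have a5 : (v + w) * (v ^ 2 + w ^ 2) ≤ 0.72 * 0.26 := by
      apply mul_le_mul <;> first | positivity | linarith
    linarith
  nlinarith [mul_pos (sub_pos.2 h1) hpos]

lemma arcSlope_nonneg {t : ℝ} (ht : t ∈ Icc (-arcEnd) arcEnd) : 0 ≤ arcSlope t := by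
  have h1 := arcV_ge ht
  have h2 := arcV_le ht
  have h3 := arcM_ge ht
  have h4 : 0 ≤ 8 * arcV t - 4 * arcV t ^ 2 - 3 / 2 := by nlinarith
  unfold arcSlope
  exact mul_nonneg (by positivity) (by linarith)

lemma arcSlope_lt_of_nonneg {s t : ℝ} (ht : t ∈ Icc (-arcEnd) arcEnd) (hs : 0 ≤ s)
    (hst : s < t) : arcSlope s < arcSlope t := by
  have hsm : s ∈ Icc (-arcEnd) arcEnd := ⟨by linarith [arcEnd_pos], by linarith [ht.2]⟩
  have h1 := arcV_lt ht (sq_lt_sq_of_nonneg hs hst)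
  have h2 := arcV_ge hsm
  have h3 := arcV_le ht
  have h4 := arcM_lt_of_nonneg ht hs hst
  have h5 : 0 ≤ arcM s := by
    have := arcM_strictMonoOn.monotoneOn zero_mem_arc hsm hs
    simpa [arcM] using this
  unfold arcSlope
  generalize arcM s = m at *
  generalize arcM t = n at *
  generalize arcV s = v at *
  generalize arcV t = w at *
  have hv0 : 0 < v := by linarith
  have hw0 : 0 < w := by linarith
  have hv : 0 < 24 * v ^ 2 + 16 * v + 1 := by positivity
  have hw : 0 < 24 * w ^ 2 + 16 * w + 1 := by positivity
  have hN : 0 < 8 * v - 4 * v ^ 2 - 3 / 2 := by nlinarith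
  have hφ : (8 * v - 4 * v ^ 2 - 3 / 2) / (24 * v ^ 2 + 16 * v + 1) <
      (8 * w - 4 * w ^ 2 - 3 / 2) / (24 * w ^ 2 + 16 * w + 1) := by
    rw [div_lt_div_iff₀ hv hw]
    have e : (8 * w - 4 * w ^ 2 - 3 / 2) * (24 * v ^ 2 + 16 * v + 1) -
        (8 * v - 4 * v ^ 2 - 3 / 2) * (24 * w ^ 2 + 16 * w + 1) =
        (w - v) * (32 + 32 * (v + w) - 256 * (v * w)) := by ring
    have hpos : 0 < 32 + 32 * (v + w) - 256 * (v * w) := by nlinarith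
    nlinarith [mul_pos (sub_pos.2 h1) hpos]
  apply mul_lt_mul'' hφ (by linarith) (by positivity) (by linarith)

/-- The concavity of the coefficient curve, seen from its end. On the left half the curve itself
rises, on the right half both factors of the slope increase. -/
lemma arcSlope_strictMonoOn : StrictMonoOn arcSlope (Icc (-arcEnd) arcEnd) := by
  have left : ∀ s ∈ Icc (-arcEnd) arcEnd, ∀ t ∈ Icc (-arcEnd) arcEnd, s < t → t ≤ 0 →
      arcSlope s < arcSlope t := by
    intro s hs t ht hst ht0
    have h1 := arcP_lt_of_sq_lt ht hs (by nlinarith)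
    rw [arcP_eq hs, arcP_eq ht] at h1
    have h2 := arcM_strictMonoOn hs ht hst
    have h3 := arcSlope_nonneg ht
    have h4 := arcM_lt_one ht (by linarith [arcEnd_pos])
    by_contra hcon
    nlinarith [mul_nonneg h3 (by linarith : 0 ≤ arcM t - arcM s),
      mul_nonneg (sub_nonneg.2 (not_lt.1 hcon)) (by linarith : 0 ≤ 1 - arcM s)]
  intro s hs t ht hst
  rcases le_or_gt 0 s with h | h
  · exact arcSlope_lt_of_nonneg ht h hst
  rcases le_or_gt t 0 with h' | h'
  · exact left s hs t ht hst h'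
  · exact (left s hs 0 zero_mem_arc h le_rfl).trans (arcSlope_lt_of_nonneg ht le_rfl h')

lemma arcSlope_end : arcSlope arcEnd = 3 - 2 * √2 := by
  have := sqrt_two_sq
  rw [arcSlope, arcM_end, arcV_end]
  have : 24 * (√2 / 4) ^ 2 + 16 * (√2 / 4) + 1 ≠ 0 := by positivity
  field_simp
  ring_nf
  rw [show √2 ^ 3 = 2 * √2 by rw [pow_succ, sqrt_two_sq], sqrt_two_sq]
  ring

lemma arcSlope_neg_end : arcSlope (-arcEnd) = 0 := by
  rw [arcSlope, arcM_neg_end]; ring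

lemma arcSlope_lt {t : ℝ} (ht : t ∈ Icc (-arcEnd) arcEnd) (h : t < arcEnd) :
    arcSlope t < 3 - 2 * √2 := by
  rw [← arcSlope_end]; exact arcSlope_strictMonoOn ht end_mem_arc h

lemma arcSlope_pos {t : ℝ} (ht : t ∈ Icc (-arcEnd) arcEnd) (h : -arcEnd < t) :
    0 < arcSlope t := by
  rw [← arcSlope_neg_end]; exact arcSlope_strictMonoOn (neg_mem_arc end_mem_arc) ht h

lemma isArc_arcX {t : ℝ} (ht : t ∈ Icc (-arcEnd) arcEnd) : IsArc (arcX t) (arcX (-t)) := by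
  have hv := arcV_ge ht
  have hq := arcV_mul ht
  have hs := sqrt_two_bounds
  have hs2 := sqrt_two_sq
  have h1 : ∀ s ∈ Icc (-arcEnd) arcEnd, 1 / 2 ≤ arcX s ∧ arcX s ≤ 1 := by
    intro s hs'
    have hv := arcV_ge hs'
    have hd := arcDen_pos hs'
    have hdv : (3 - s ^ 2) * arcV s = 1 := by unfold arcV; field_simp
    obtain ⟨ha, hb⟩ := hs'
    unfold arcEnd at ha hb
    unfold arcX
    constructor
    · nlinarith
    · have : 2 * (1 + s) ≤ 3 - s ^ 2 := by nlinarith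
      have := mul_le_mul_of_nonneg_right this (by linarith : 0 ≤ arcV s)
      linarith
  refine ⟨(h1 t ht).1, (h1 t ht).2, (h1 _ (neg_mem_arc ht)).1, (h1 _ (neg_mem_arc ht)).2, ?_, ?_⟩
  · simp only [arcX, arcV_neg]; linarith
  · simp only [arcX, arcV_neg]
    linear_combination (-4 * arcV t) * hq

lemma IsArc.exists_arcX {x y : ℝ} (h : IsArc x y) :
    ∃ t ∈ Icc (-arcEnd) arcEnd, x = arcX t ∧ y = arcX (-t) := by
  obtain ⟨hx2, hx1, hy2, hy1, hlt, heq⟩ := h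
  have hr : 0 < x + y - 1 := by linarith
  obtain ⟨t, ht⟩ : ∃ t, t = (x - y) / (x + y - 1) := ⟨_, rfl⟩
  have htr : t * (x + y - 1) = x - y := by rw [ht]; field_simp
  have h3 : (3 - t ^ 2) * (x + y - 1) = 2 := by
    have : ((3 - t ^ 2) * (x + y - 1) - 2) * (x + y - 1) = 0 := by
      linear_combination (-(t * (x + y - 1)) - (x - y)) * htr + heq
    rcases mul_eq_zero.1 this with h | h
    · linarith
    · exact absurd h hr.ne'
  have hden : 3 - t ^ 2 ≠ 0 := by
    intro h0; rw [h0] at h3; norm_num at h3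
  have hv : arcV t = (x + y - 1) / 2 := by
    unfold arcV; field_simp; linarith
  have bound : ∀ s : ℝ, (1 + s) * (x + y - 1) ≤ 1 → s ^ 2 = t ^ 2 → s ≤ arcEnd := by
    intro s hs hst
    have h4 : (1 + s) ^ 2 ≤ 2 := by
      rw [← hst] at h3
      have : ((1 + s) * 2 - (3 - s ^ 2)) * (x + y - 1) ≤ 0 := by linarith
      have := nonpos_of_mul_nonpos_left this hr
      linarith
    have := Real.le_sqrt_of_sq_le h4
    unfold arcEnd; linarith
  refine ⟨t, ⟨?_, bound t (by linarith) rfl⟩, ?_, ?_⟩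
  · have := bound (-t) (by linarith) (by ring)
    linarith
  · rw [arcX, hv]; linarith
  · rw [arcX, arcV_neg, hv]; linarith

/-- Membership in the family of one side, in the arc parameter. -/
lemma fromSide_iff {A B C : Plane} {q : Sym2 (Set Plane)} :
    FromSide A B C q ↔ ∃ t ∈ Icc (-arcEnd) arcEnd,
      2 * conway A B C = (conway B C A + conway C A B) * arcP t +
        (conway C A B - conway B C A) * arcM t ∧ q = chordPair A B C (arcX t) (arcX (-t)) := by
  have key : ∀ t ∈ Icc (-arcEnd) arcEnd, PerpCond A B C (arcX t) (arcX (-t)) ↔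
      2 * conway A B C = (conway B C A + conway C A B) * arcP t +
        (conway C A B - conway B C A) * arcM t := by
    intro t ht
    have h1 := coeff_sum ht
    have h2 := coeff_diff t
    rw [PerpCond, ← h1, ← h2]
    constructor <;> intro h <;> linarith
  constructor
  · rintro ⟨x, y, h, hp, rfl⟩
    obtain ⟨t, ht, rfl, rfl⟩ := h.exists_arcX
    exact ⟨t, ht, (key t ht).1 hp, rfl⟩
  · rintro ⟨t, ht, hp, rfl⟩
    exact ⟨_, _, isArc_arcX ht, (key t ht).2 hp, rfl⟩

/-! ### Triangles with a large angle -/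

/-- The chord pair at the arc parameter `t` along the side `BC`. -/
noncomputable def arcChord (A B C : Plane) (t : ℝ) : Sym2 (Set Plane) :=
  chordPair A B C (arcX t) (arcX (-t))

/-- The perpendicularity condition at the arc parameter `t`, where `α` is the Conway quantity at
the vertex opposite to the side carrying the feet. -/
def SideEq (α β γ t : ℝ) : Prop := 2 * α = (β + γ) * arcP t + (γ - β) * arcM t

lemma fromSide_iff_sideEq {A B C : Plane} {q : Sym2 (Set Plane)} :
    FromSide A B C q ↔ ∃ t ∈ Icc (-arcEnd) arcEnd,
      SideEq (conway A B C) (conway B C A) (conway C A B) t ∧ q = arcChord A B C t :=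
  fromSide_iff

lemma arcChord_swap (A B C : Plane) (t : ℝ) : arcChord A C B (-t) = arcChord A B C t := by
  rw [arcChord, neg_neg, chordPair_swap, arcChord]

lemma SideEq.swap {α β γ t : ℝ} (h : SideEq α β γ t) : SideEq α γ β (-t) := by
  rw [SideEq, arcP_neg, arcM_neg]
  rw [SideEq] at h
  linarith

lemma one_div_two_mul_sqrt_two_div_two : 1 / (2 * (√2 / 2)) = √2 / 2 := by
  have := sqrt_two_sq
  have := sqrt_two_bounds
  rw [div_eq_div_iff (by positivity) (by norm_num)]
  nlinarith

/-- At the end of the arc one chord is the median from `B`, and the pair belongs to the families of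
both sides through `B`. -/
lemma arcChord_end (A B C : Plane) :
    arcChord A B C arcEnd = s(segment ℝ B (sidePoint (1 / 2) A C),
      segment ℝ (sidePoint (√2 / 2) C B) (sidePoint (√2 / 2) A B)) := by
  have h1 : sidePoint 1 B C = B := by simp [sidePoint]
  rw [arcChord, chordPair, arcX_end, arcX_neg_end, one_div_two_mul_sqrt_two_div_two, h1, mul_one]

lemma arcChord_end_glue (A B C : Plane) : arcChord A B C arcEnd = arcChord C B A arcEnd := by
  rw [arcChord_end, arcChord_end, segment_symm ℝ (sidePoint _ C B), sidePoint_eq_sub (1 / 2) A C]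
  norm_num

lemma conway_add (A B C : Plane) : conway A B C + conway B C A = dist A B ^ 2 := by
  rw [EuclideanSpace.dist_eq, Real.sq_sqrt (by positivity), Fin.sum_univ_two, Real.dist_eq,
    Real.dist_eq, sq_abs, sq_abs, conway_eq, conway_eq]
  ring

lemma conway_add_pos {A B C : Plane} (hD : cross (B - A) (C - A) ≠ 0) :
    0 < conway A B C + conway B C A := by
  rw [conway_add]
  have : A ≠ B := by
    rintro rfl
    simp [cross] at hD
  have := dist_pos.2 this
  positivity

lemma cross_rotate_ne_zero {A B C : Plane} (hD : cross (B - A) (C - A) ≠ 0) :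
    cross (C - B) (A - B) ≠ 0 := by rwa [cross_rotate]

lemma cross_swap_ne_zero {A B C : Plane} (hD : cross (B - A) (C - A) ≠ 0) :
    cross (C - A) (B - A) ≠ 0 := by rw [cross_swap]; exact neg_ne_zero.2 hD

lemma arcP_ge {t : ℝ} (ht : t ∈ Icc (-arcEnd) arcEnd) : 1 ≤ arcP t := by
  rw [arcP_eq ht]
  have := mul_nonneg (arcSlope_nonneg ht) (sub_nonneg.2 (arcM_le ht))
  linarith

lemma eq_end_of_arcP_eq_one {t : ℝ} (ht : t ∈ Icc (-arcEnd) arcEnd) (h : arcP t = 1) :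
    t = -arcEnd ∨ t = arcEnd := by
  rw [arcP_eq ht] at h
  by_contra hcon
  push Not at hcon
  have h1 := arcSlope_pos ht (lt_of_le_of_ne ht.1 hcon.1.symm)
  have h2 := arcM_lt_one ht (lt_of_le_of_ne ht.2 hcon.2)
  have := mul_pos h1 (sub_pos.2 h2)
  linarith

/-- On the side opposite to the middle angle a solution exists, by the intermediate value
theorem. -/
lemma exists_sideEq {α β γ : ℝ} (h1 : α ≤ β) (h2 : β ≤ γ) :
    ∃ t ∈ Icc (-arcEnd) arcEnd, SideEq β α γ t := by
  have hc : ContinuousOn (fun t => (α + γ) * arcP t + (γ - α) * arcM t)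
      (Icc (-arcEnd) arcEnd) := by
    have := arcP_continuousOn
    have := arcM_continuousOn
    fun_prop
  have hle : -arcEnd ≤ arcEnd := by linarith [arcEnd_pos]
  obtain ⟨t, ht, h⟩ := intermediate_value_Icc hle hc (show 2 * β ∈ _ by
    rw [arcP_neg, arcP_end, arcM_neg_end, arcM_end]
    constructor <;> linarith)
  exact ⟨t, ht, h.symm⟩

/-- On the side opposite to the middle angle there is only one solution. -/
lemma sideEq_unique {α β γ s t : ℝ} (h2 : β ≤ γ) (hpos : 0 < α + γ)
    (hiso : β = γ → √2 * α ≤ β) (hs : s ∈ Icc (-arcEnd) arcEnd) (ht : t ∈ Icc (-arcEnd) arcEnd)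
    (es : SideEq β α γ s) (et : SideEq β α γ t) : s = t := by
  wlog hst : s < t generalizing s t
  · rcases lt_trichotomy s t with h | h | h
    · exact this hs ht es et h
    · exact h
    · exact (this ht hs et es h).symm
  exfalso
  rw [SideEq, arcP_eq hs] at es
  rw [SideEq, arcP_eq ht] at et
  have hslope := arcSlope_strictMonoOn hs ht hst
  have hM := arcM_strictMonoOn hs ht hst
  have hMs := arcM_lt_one hs (hst.trans_le ht.2)
  rcases ht.2.eq_or_lt with h | h
  · rw [h, arcM_end] at et
    have hβ : β = γ := by linarith
    have hα := hiso hβ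
    have hρ := arcSlope_lt hs (hst.trans_le ht.2)
    have e1 : (1 - arcM s) * ((α + γ) * arcSlope s - (γ - α)) = 0 := by
      rw [hβ] at es; linarith
    have e2 : (α + γ) * arcSlope s = γ - α := by
      rcases mul_eq_zero.1 e1 with h | h <;> linarith
    have e3 : (α + γ) * arcSlope s < (α + γ) * (3 - 2 * √2) := by gcongr
    have := sqrt_two_bounds
    have := sqrt_two_sq
    rw [← hβ] at e2 e3 hpos
    nlinarith
  · have hMt := arcM_lt_one ht h
    have e1 : (1 - arcM s) * ((α + γ) * arcSlope s - (γ - α)) = -2 * (γ - β) := by linarith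
    have e2 : (1 - arcM t) * ((α + γ) * arcSlope t - (γ - α)) = -2 * (γ - β) := by linarith
    have e3 : (α + γ) * arcSlope s < (α + γ) * arcSlope t := by gcongr
    have e4 : (α + γ) * arcSlope t - (γ - α) ≤ 0 := by
      by_contra hcon
      have := mul_pos (sub_pos.2 hMt) (not_le.1 hcon)
      linarith
    nlinarith [mul_nonneg (by linarith : 0 ≤ arcM t - arcM s) (neg_nonneg.2 e4),
      mul_pos (sub_pos.2 hMs) (sub_pos.2 e3)]

/-- The largest angle has cosine at most `√2 - 1`. -/
def ObtuseEnough (α β γ : ℝ) : Prop :=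
  α ≤ 0 ∨ α ^ 2 ≤ (√2 - 1) ^ 2 * ((α + β) * (α + γ))

lemma ObtuseEnough.lt {α β γ : ℝ} (h : ObtuseEnough α β γ) (h1 : α ≤ β) (h2 : β ≤ γ)
    (hpos : 0 < α + β) (hβ : α = β) : β < γ := by
  by_contra hcon
  obtain rfl : β = γ := le_antisymm h2 (not_lt.1 hcon)
  subst hβ
  rcases h with h | h
  · linarith
  · have := sqrt_two_bounds
    have h3 : (√2 - 1) ^ 2 ≤ 0.18 := by nlinarith
    nlinarith [mul_pos hpos hpos]

lemma ObtuseEnough.le_of_eq {α β γ : ℝ} (h : ObtuseEnough α β γ) (hpos : 0 < α + β)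
    (hβ : β = γ) : √2 * α ≤ β := by
  subst hβ
  have h1 := sqrt_two_bounds
  have h2 := sqrt_two_sq
  rcases h with h | h
  · nlinarith
  · have h3 : α ^ 2 ≤ ((√2 - 1) * (α + β)) ^ 2 := by linarith
    have h4 : α ≤ (√2 - 1) * (α + β) :=
      (abs_le_of_sq_le_sq' h3 (mul_nonneg (by linarith) hpos.le)).2
    nlinarith

/-- On the side opposite to the smallest angle only the end of the arc can be a solution. -/
lemma sideEq_smallest {α β γ t : ℝ} (h : ObtuseEnough α β γ) (h1 : α ≤ β) (h2 : β ≤ γ)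
    (hpos : 0 < α + β) (ht : t ∈ Icc (-arcEnd) arcEnd) (e : SideEq γ α β t) :
    t = arcEnd ∧ γ = β := by
  have hq := sqrt_two_bounds
  have hq2 := sqrt_two_sq
  rcases ht.2.eq_or_lt with hend | hlt
  · refine ⟨hend, ?_⟩
    rw [SideEq, hend, arcP_end, arcM_end] at e
    linarith
  exfalso
  rw [SideEq, arcP_eq ht] at e
  have hM := arcM_lt_one ht hlt
  have hM' := arcM_ge ht
  have hρ := arcSlope_lt ht hlt
  have e1 : (1 - arcM t) * ((α + β) * arcSlope t - (β - α)) = 2 * (γ - β) := by linarith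
  have e3 : (α + β) * arcSlope t < (α + β) * (3 - 2 * √2) := by gcongr
  rcases le_or_gt (√2 * α) β with hc | hc
  · have : (α + β) * (3 - 2 * √2) ≤ β - α := by nlinarith
    have := mul_neg_of_pos_of_neg (sub_pos.2 hM)
      (by linarith : (α + β) * arcSlope t - (β - α) < 0)
    linarith
  · have hα : 0 < α := by nlinarith
    rcases h with h | h
    · linarith
    obtain ⟨k, hk⟩ : ∃ k, k = (3 - 2 * √2) * (α + β) := ⟨_, rfl⟩
    have hkpos : 0 < k := by rw [hk]; exact mul_pos (by linarith) hpos
    have hγ : γ < α + k := by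
      have h3 : 0 ≤ (α + β) * arcSlope t - (β - α) := by
        by_contra hcon
        have := mul_neg_of_pos_of_neg (sub_pos.2 hM) (not_le.1 hcon)
        linarith
      nlinarith [mul_nonneg (by linarith : 0 ≤ 1 + arcM t) h3]
    have hkle : k ≤ (√2 - 1) * α := by
      have : (√2 - 1) * α - k = (3 - 2 * √2) * (√2 * α - β) := by
        rw [hk]; linear_combination (2 * α) * hq2
      have := mul_pos (by linarith : 0 < 3 - 2 * √2) (sub_pos.2 hc)
      linarith
    have h4 : α ^ 2 ≤ k * (α + γ) := by
      have : (√2 - 1) ^ 2 * ((α + β) * (α + γ)) = k * (α + γ) := by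
        rw [hk]; linear_combination ((α + β) * (α + γ)) * hq2
      linarith
    have h5 : k * (α + γ) < k * (2 * α + k) := by
      apply mul_lt_mul_of_pos_left _ hkpos; linarith
    have h6 : √2 * k ≤ α - k := by nlinarith
    have h7 : (√2 * k) ^ 2 ≤ (α - k) ^ 2 := by gcongr
    nlinarith

/-- On the side opposite to the largest angle only an end of the arc can be a solution. -/
lemma sideEq_largest {α β γ t : ℝ} (h : ObtuseEnough α β γ) (h1 : α ≤ β) (h2 : β ≤ γ)
    (hpos : 0 < α + β) (ht : t ∈ Icc (-arcEnd) arcEnd) (e : SideEq α β γ t) :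
    t = -arcEnd ∧ β = α := by
  rw [SideEq] at e
  have hP := arcP_ge ht
  have hM := arcM_ge ht
  have hβγ : 0 < β + γ := by linarith
  have e1 := mul_nonneg hβγ.le (sub_nonneg.2 hP)
  have e2 := mul_nonneg (sub_nonneg.2 h2) (by linarith : 0 ≤ arcM t + 1)
  have hβ : α = β := by linarith
  have hγ := h.lt h1 h2 hpos hβ
  have e3 : (β + γ) * (arcP t - 1) = 0 := by linarith
  have e4 : arcP t = 1 := by
    rcases mul_eq_zero.1 e3 with h | h <;> linarith
  refine ⟨(eq_end_of_arcP_eq_one ht e4).resolve_right fun hend => ?_, hβ.symm⟩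
  rw [hend, arcM_end] at e2 e
  rw [← hend, e4] at e
  linarith

lemma cross_ne_zero_triple {A B C : Plane} (hD : cross (B - A) (C - A) ≠ 0) :
    AffineIndependent ℝ ![A, B, C] := affineIndependent_of_cross_ne_zero hD

lemma mem_quadrisections_triple {A B C : Plane} (hD : cross (B - A) (C - A) ≠ 0)
    {q : Sym2 (Set Plane)} :
    q ∈ quadrisections ![A, B, C] ↔ FromSide A B C q ∨ FromSide B C A q ∨ FromSide C A B q :=
  mem_quadrisections_iff (cross_ne_zero_triple hD)

theorem encard_quadrisections_eq_one_of_sorted {A B C : Plane} (hD : cross (B - A) (C - A) ≠ 0)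
    (h1 : conway A B C ≤ conway B C A) (h2 : conway B C A ≤ conway C A B)
    (h : ObtuseEnough (conway A B C) (conway B C A) (conway C A B)) :
    (quadrisections ![A, B, C]).encard = 1 := by
  have hpos := conway_add_pos hD
  have hpos2 : 0 < conway A B C + conway C A B := by linarith
  obtain ⟨t, ht, e⟩ := exists_sideEq h1 h2
  have uniq := fun s hs es => sideEq_unique (s := s) h2 hpos2 (h.le_of_eq hpos) hs ht es e
  rw [encard_eq_one]
  refine ⟨arcChord B A C t, ?_⟩
  ext q
  rw [mem_quadrisections_triple hD, mem_singleton_iff]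
  constructor
  · rintro (hq | hq | hq)
    · obtain ⟨s, hs, es, rfl⟩ := fromSide_iff_sideEq.1 hq
      obtain ⟨rfl, hβ⟩ := sideEq_largest h h1 h2 hpos hs es
      have hend := uniq (-arcEnd) hs (by
        rw [SideEq, arcP_neg, arcP_end, arcM_neg_end]; linarith)
      rw [← hend, ← arcChord_swap, neg_neg, arcChord_end_glue, ← arcChord_swap]
    · obtain ⟨s, hs, es, rfl⟩ := fromSide_iff_sideEq.1 hq.swap
      rw [conway_swap B C A, conway_swap A B C, conway_swap C A B] at es
      rw [uniq s hs es]
    · obtain ⟨s, hs, es, rfl⟩ := fromSide_iff_sideEq.1 hq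
      obtain ⟨rfl, hγ⟩ := sideEq_smallest h h1 h2 hpos hs es
      rw [← uniq arcEnd hs (by rw [SideEq, arcP_end, arcM_end]; linarith), arcChord_end_glue]
  · rintro rfl
    refine Or.inr (Or.inl (FromSide.swap (fromSide_iff_sideEq.2 ⟨t, ht, ?_, rfl⟩)))
    rwa [conway_swap B C A, conway_swap A B C, conway_swap C A B]

/-! ### Distinctness of chord pairs -/

/-- The points of the two chords. -/
def pairSupport (q : Sym2 (Set Plane)) : Set Plane := {z | ∃ s ∈ q, z ∈ s}

lemma mem_pairSupport {s t : Set Plane} {z : Plane} :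
    z ∈ pairSupport s(s, t) ↔ z ∈ s ∨ z ∈ t := by
  simp [pairSupport, Sym2.mem_iff]

lemma lineForm_sidePoint (X P U V : Plane) (x : ℝ) :
    lineForm X P (sidePoint x U V) = x * lineForm X P U + (1 - x) * lineForm X P V :=
  lineForm_combination X P U V (by ring)

lemma eq_left_of_lineForm {X P U V z : Plane} (hz : z ∈ segment ℝ U V)
    (h : lineForm X P z = 0) (hU : 0 ≤ lineForm X P U * lineForm X P V)
    (hV : lineForm X P V ≠ 0) : z = U := by
  obtain ⟨a, b, ha, hb, hab, rfl⟩ := hz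
  rw [lineForm_combination X P U V hab] at h
  have h1 : b * lineForm X P V ^ 2 = 0 := by
    have h2 : a * (lineForm X P U * lineForm X P V) + b * lineForm X P V ^ 2 = 0 := by
      linear_combination lineForm X P V * h
    have := mul_nonneg ha hU
    have := mul_nonneg hb (sq_nonneg (lineForm X P V))
    linarith
  have hb0 : b = 0 := (mul_eq_zero.1 h1).resolve_right (pow_ne_zero 2 hV)
  obtain rfl : a = 1 := by linarith
  simp [hb0]

lemma IsArc.half_lt_y {x y : ℝ} (h : IsArc x y) : 1 / 2 < y := by
  refine lt_of_le_of_ne h.half_le_y fun hy => ?_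
  subst hy
  have h1 := h.eq
  have h2 := h.one_lt
  have h3 := h.x_le_one
  nlinarith

lemma lineForm_left (X P : Plane) : lineForm X P X = 0 := by simp [lineForm_eq]

lemma lineForm_right (X P : Plane) : lineForm X P P = 0 := by simp [lineForm_eq]; ring

lemma lineForm_side (A B C : Plane) : lineForm B C A = cross (B - A) (C - A) := by
  rw [lineForm, cross_rotate]

/-- The chords meet the line `BC` exactly in their feet. -/
lemma pairSupport_inter_base {A B C : Plane} (hD : cross (B - A) (C - A) ≠ 0) {x y : ℝ}
    (h : IsArc x y) :
    pairSupport (chordPair A B C x y) ∩ {z | lineForm B C z = 0} =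
      {sidePoint x B C, sidePoint y C B} := by
  have hx := h.half_le_x
  have hy := h.half_le_y
  have hp : 0 < 1 / (2 * x) := by positivity
  have hq : 0 < 1 / (2 * y) := by positivity
  have eX : lineForm B C (sidePoint x B C) = 0 := by
    rw [lineForm_sidePoint, lineForm_left, lineForm_right]; ring
  have eY : lineForm B C (sidePoint y C B) = 0 := by
    rw [lineForm_sidePoint, lineForm_left, lineForm_right]; ring
  have eP : lineForm B C (sidePoint (1 / (2 * x)) A C) ≠ 0 := by
    rw [lineForm_sidePoint, lineForm_right, lineForm_side, mul_zero, add_zero]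
    exact mul_ne_zero hp.ne' hD
  have eQ : lineForm B C (sidePoint (1 / (2 * y)) A B) ≠ 0 := by
    rw [lineForm_sidePoint, lineForm_left, lineForm_side, mul_zero, add_zero]
    exact mul_ne_zero hq.ne' hD
  ext z
  rw [chordPair, mem_inter_iff, mem_pairSupport]
  constructor
  · rintro ⟨hz | hz, h0⟩
    · exact Or.inl (eq_left_of_lineForm hz h0 (by rw [eX, zero_mul]) eP)
    · exact Or.inr (eq_left_of_lineForm hz h0 (by rw [eY, zero_mul]) eQ)
  · rintro (rfl | rfl)
    · exact ⟨Or.inl (left_mem_segment ℝ _ _), eX⟩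
    · exact ⟨Or.inr (left_mem_segment ℝ _ _), eY⟩

/-- Unless a chord passes through `C`, the chords meet the line `CA` in one point only. -/
lemma pairSupport_inter_side {A B C : Plane} (hD : cross (B - A) (C - A) ≠ 0) {x y : ℝ}
    (h : IsArc x y) (hy1 : y < 1) :
    pairSupport (chordPair A B C x y) ∩ {z | lineForm A C z = 0} ⊆
      {sidePoint (1 / (2 * x)) A C} := by
  have hx := h.half_le_x
  have hy := h.half_lt_y
  have hB : lineForm A C B ≠ 0 := by
    rw [lineForm_side]
    exact cross_swap_ne_zero (cross_rotate_ne_zero hD)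
  have hB2 : 0 < lineForm A C B ^ 2 := by positivity
  have hq : 1 / (2 * y) < 1 := by rw [div_lt_one (by linarith)]; linarith
  have eX : lineForm A C (sidePoint x B C) ≠ 0 := by
    rw [lineForm_sidePoint, lineForm_right, mul_zero, add_zero]
    exact mul_ne_zero (by linarith) hB
  have eP : lineForm A C (sidePoint (1 / (2 * x)) A C) = 0 := by
    rw [lineForm_sidePoint, lineForm_right, lineForm_left]; ring
  have eY : lineForm A C (sidePoint y C B) = (1 - y) * lineForm A C B := by
    rw [lineForm_sidePoint, lineForm_right]; ring
  have eQ : lineForm A C (sidePoint (1 / (2 * y)) A B) = (1 - 1 / (2 * y)) * lineForm A C B := by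
    rw [lineForm_sidePoint, lineForm_left]; ring
  rintro z ⟨hz, h0⟩
  rw [chordPair, mem_pairSupport] at hz
  rcases hz with hz | hz
  · rw [segment_symm] at hz
    exact eq_left_of_lineForm hz h0 (by rw [eP, zero_mul]) eX
  · exfalso
    have hQ : lineForm A C (sidePoint (1 / (2 * y)) A B) ≠ 0 := by
      rw [eQ]; exact mul_ne_zero (by linarith) hB
    have := eq_left_of_lineForm hz h0 (by
      rw [eY, eQ]
      have := mul_nonneg (mul_nonneg (sub_nonneg.2 hy1.le) (sub_nonneg.2 hq.le)) hB2.le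
      linarith) hQ
    rw [this, mem_ofPred_eq, eY] at h0
    exact mul_ne_zero (by linarith) hB h0

lemma sidePoint_injective {U V : Plane} (h : U ≠ V) {x y : ℝ}
    (hxy : sidePoint x U V = sidePoint y U V) : x = y := by
  by_contra hne
  have h0 := congrArg (fun z : Plane => z 0) hxy
  have h1 := congrArg (fun z : Plane => z 1) hxy
  simp only [sidePoint_apply] at h0 h1
  refine h (plane_ext ?_ ?_)
  · have : (x - y) * (U 0 - V 0) = 0 := by linarith
    rcases mul_eq_zero.1 this with h | h
    · exact absurd (by linarith) hne
    · linarith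
  · have : (x - y) * (U 1 - V 1) = 0 := by linarith
    rcases mul_eq_zero.1 this with h | h
    · exact absurd (by linarith) hne
    · linarith

lemma base_ne {A B C : Plane} (hD : cross (B - A) (C - A) ≠ 0) : B ≠ C := by
  rintro rfl
  apply hD
  simp only [cross_sub_sub]; ring

lemma arcChord_injOn {A B C : Plane} (hD : cross (B - A) (C - A) ≠ 0) {s t : ℝ}
    (hs : s ∈ Icc (-arcEnd) arcEnd) (ht : t ∈ Icc (-arcEnd) arcEnd)
    (h : arcChord A B C s = arcChord A B C t) : s = t := by
  have h1 := pairSupport_inter_base hD (isArc_arcX hs)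
  have h2 := pairSupport_inter_base hD (isArc_arcX ht)
  rw [arcChord, arcChord] at h
  rw [h, h2, sidePoint_eq_sub (arcX (-s)), sidePoint_eq_sub (arcX (-t)), pair_eq_pair_iff] at h1
  have inj := fun x y => sidePoint_injective (x := x) (y := y) (base_ne hD)
  have l1 := (isArc_arcX hs).one_lt
  have l2 := (isArc_arcX ht).one_lt
  rcases h1 with ⟨ha, hb⟩ | ⟨ha, hb⟩
  · have e1 := inj _ _ ha
    have e2 := inj _ _ hb
    simp only [arcX, arcV_neg] at e1 e2
    have e3 : arcV s = arcV t := by linarith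
    rw [e3] at e1
    have := arcV_ge ht
    have : (s - t) * arcV t = 0 := by linarith
    rcases mul_eq_zero.1 this with h | h <;> linarith
  · have e1 := inj _ _ ha
    have e2 := inj _ _ hb
    linarith

lemma arcX_lt_one {t : ℝ} (ht : t ∈ Icc (-arcEnd) arcEnd) (h : t < arcEnd) : arcX t < 1 := by
  refine lt_of_le_of_ne (isArc_arcX ht).x_le_one fun h1 => ?_
  -- At `x = 1` the arc equation leaves only `y = 1/√2`, the value at the end.
  have e := (isArc_arcX ht).eq
  have hy := (isArc_arcX ht).half_le_y
  rw [h1] at e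
  have e2 : arcX (-t) ^ 2 = (√2 / 2) ^ 2 := by
    have := sqrt_two_sq
    linarith
  have e3 : arcX (-t) = √2 / 2 := by
    have := sqrt_two_bounds
    exact (sq_eq_sq₀ (by linarith) (by linarith)).1 e2
  have e4 := arcX_end
  have e5 := arcX_neg_end
  simp only [arcX, arcV_neg] at h1 e3 e4 e5
  have e6 : arcV t = arcV arcEnd := by linarith
  rw [e6] at h1
  have := arcV_ge end_mem_arc
  have : (t - arcEnd) * arcV arcEnd = 0 := by linarith
  rcases mul_eq_zero.1 this with h | h <;> linarith

/-- A chord pair without vertices belongs to the family of one side only. -/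
lemma arcChord_ne_of_side {A B C : Plane} (hD : cross (B - A) (C - A) ≠ 0) {s t : ℝ}
    (ht : t ∈ Icc (-arcEnd) arcEnd) (h : -arcEnd < t) (hs : s ∈ Icc (-arcEnd) arcEnd) :
    arcChord A B C t ≠ arcChord B A C s := by
  intro heq
  have hD' : cross (A - B) (C - B) ≠ 0 :=
    cross_swap_ne_zero (cross_rotate_ne_zero hD)
  have h1 := pairSupport_inter_side hD (isArc_arcX ht)
    (arcX_lt_one (neg_mem_arc ht) (by linarith))
  have h2 := pairSupport_inter_base hD' (isArc_arcX hs)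
  rw [arcChord, arcChord] at heq
  rw [heq, h2] at h1
  have e1 := h1 (mem_insert _ _)
  have e2 := h1 (mem_insert_of_mem _ rfl)
  rw [mem_singleton_iff] at e1 e2
  have e3 := e1.trans e2.symm
  rw [sidePoint_eq_sub (arcX (-s))] at e3
  have := sidePoint_injective (base_ne hD') e3
  have := (isArc_arcX hs).one_lt
  linarith

lemma arcChord_ne_of_side' {A B C : Plane} (hD : cross (B - A) (C - A) ≠ 0) {s t : ℝ}
    (ht : t ∈ Icc (-arcEnd) arcEnd) (h : t < arcEnd) (hs : s ∈ Icc (-arcEnd) arcEnd) :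
    arcChord A B C t ≠ arcChord C A B s := by
  rw [← arcChord_swap]
  exact arcChord_ne_of_side (cross_swap_ne_zero hD) (neg_mem_arc ht) (by linarith) hs

lemma encard_ne_two_of_three {α : Type*} {S : Set α} {a b c : α} (ha : a ∈ S) (hb : b ∈ S)
    (hc : c ∈ S) (hab : a ≠ b) (hac : a ≠ c) (hbc : b ≠ c) : S.encard ≠ 2 := by
  intro h
  obtain ⟨x, y, -, rfl⟩ := encard_eq_two.1 h
  simp only [mem_insert_iff, mem_singleton_iff] at ha hb hc
  rcases ha with rfl | rfl <;> rcases hb with rfl | rfl <;> rcases hc with rfl | rfl <;>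
    simp at hab hac hbc

/-! ### Isosceles triangles -/

section Isosceles

variable {A B C : Plane}

/-- In an isosceles triangle with apex `A` the axis and a chord parallel to the base form a
quadrisection. -/
lemma axis_mem (hD : cross (B - A) (C - A) ≠ 0) (hiso : conway C A B = conway B C A) :
    arcChord B A C arcEnd ∈ quadrisections ![A, B, C] := by
  rw [mem_quadrisections_triple hD]
  refine Or.inr (Or.inl (FromSide.swap (fromSide_iff_sideEq.2 ⟨_, end_mem_arc, ?_, rfl⟩)))
  rw [SideEq, arcP_end, arcM_end, conway_swap B C A, conway_swap C A B, hiso]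
  ring

lemma base_mem (hD : cross (B - A) (C - A) ≠ 0) (hiso : conway C A B = conway B C A) {t : ℝ}
    (ht : t ∈ Icc (-arcEnd) arcEnd) (h : conway A B C = conway B C A * arcP t) :
    arcChord A B C t ∈ quadrisections ![A, B, C] := by
  rw [mem_quadrisections_triple hD]
  refine Or.inl (fromSide_iff_sideEq.2 ⟨t, ht, ?_, rfl⟩)
  rw [SideEq, hiso, h]
  ring

lemma leg_mem (hD : cross (B - A) (C - A) ≠ 0) (hiso : conway C A B = conway B C A) {t : ℝ}
    (ht : t ∈ Icc (-arcEnd) arcEnd)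
    (h : SideEq (conway B C A) (conway A B C) (conway B C A) t) :
    arcChord B A C t ∈ quadrisections ![A, B, C] ∧
      arcChord C A B t ∈ quadrisections ![A, B, C] := by
  rw [mem_quadrisections_triple hD, mem_quadrisections_triple hD]
  refine ⟨Or.inr (Or.inl (FromSide.swap (fromSide_iff_sideEq.2 ⟨t, ht, ?_, rfl⟩))),
    Or.inr (Or.inr (fromSide_iff_sideEq.2 ⟨t, ht, ?_, rfl⟩))⟩
  · rwa [conway_swap B C A, conway_swap A B C, conway_swap C A B, hiso]
  · rwa [hiso]

/-- The quadrisections of an isosceles triangle: the solutions on the base and those on the legs. -/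
lemma mem_isosceles (hD : cross (B - A) (C - A) ≠ 0) (hiso : conway C A B = conway B C A)
    {q : Sym2 (Set Plane)} (hq : q ∈ quadrisections ![A, B, C]) :
    ∃ t ∈ Icc (-arcEnd) arcEnd,
      (conway A B C = conway B C A * arcP t ∧ q = arcChord A B C t) ∨
      (SideEq (conway B C A) (conway A B C) (conway B C A) t ∧
        (q = arcChord B A C t ∨ q = arcChord C A B t)) := by
  rcases (mem_quadrisections_triple hD).1 hq with hq | hq | hq
  · obtain ⟨t, ht, e, rfl⟩ := fromSide_iff_sideEq.1 hq
    rw [SideEq, hiso] at e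
    exact ⟨t, ht, Or.inl ⟨by linarith, rfl⟩⟩
  · obtain ⟨t, ht, e, rfl⟩ := fromSide_iff_sideEq.1 hq.swap
    rw [conway_swap B C A, conway_swap A B C, conway_swap C A B, hiso] at e
    exact ⟨t, ht, Or.inr ⟨e, Or.inl rfl⟩⟩
  · obtain ⟨t, ht, e, rfl⟩ := fromSide_iff_sideEq.1 hq
    rw [hiso] at e
    exact ⟨t, ht, Or.inr ⟨e, Or.inr rfl⟩⟩

lemma base_conway_pos (hD : cross (B - A) (C - A) ≠ 0) (hiso : conway C A B = conway B C A) :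
    0 < conway B C A := by
  have := conway_add_pos (cross_rotate_ne_zero hD)
  linarith

lemma arcP_zero : arcP 0 = 175 / 162 := by
  norm_num [arcP, arcV]

lemma eq_zero_of_arcP {t : ℝ} (ht : t ∈ Icc (-arcEnd) arcEnd) (h : arcP t = 175 / 162) :
    t = 0 := by
  by_contra hne
  have h1 := arcP_lt_of_sq_lt zero_mem_arc ht (by
    have := pow_pos (abs_pos.2 hne) 2
    rw [sq_abs] at this
    simpa using this)
  rw [h, arcP_zero] at h1
  exact lt_irrefl _ h1

/-- Apex angle between `π / 3` and that of `I₁`: the legs carry a solution besides the axis. -/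
lemma encard_ne_one_of_between (hD : cross (B - A) (C - A) ≠ 0)
    (hiso : conway C A B = conway B C A) (h1 : conway A B C < conway B C A)
    (h2 : conway B C A < √2 * conway A B C) : (quadrisections ![A, B, C]).encard ≠ 1 := by
  have hβ := base_conway_pos hD hiso
  have hq := sqrt_two_bounds
  have hq2 := sqrt_two_sq
  have hα : 0 < conway A B C := by nlinarith
  have hle : -arcEnd ≤ arcEnd := by linarith [arcEnd_pos]
  have hmem : (conway B C A - conway A B C) / (conway A B C + conway B C A) ∈
      Icc (arcSlope (-arcEnd)) (arcSlope arcEnd) := by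
    rw [arcSlope_neg_end, arcSlope_end]
    refine ⟨div_nonneg (by linarith) (by linarith), ?_⟩
    rw [div_le_iff₀ (by linarith)]
    nlinarith
  obtain ⟨t, ht, hρ⟩ := intermediate_value_Icc hle arcSlope_continuousOn hmem
  have e : SideEq (conway B C A) (conway A B C) (conway B C A) t := by
    rw [SideEq, arcP_eq ht, hρ]
    field_simp
    ring
  have hne : t ≠ arcEnd := by
    rintro rfl
    rw [arcSlope_end, eq_div_iff (by linarith)] at hρ
    nlinarith
  intro h
  obtain ⟨q, hq⟩ := encard_eq_one.1 h
  have m1 := (leg_mem hD hiso ht e).1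
  have m2 := axis_mem hD hiso
  rw [hq, mem_singleton_iff] at m1 m2
  have hD' : cross (A - B) (C - B) ≠ 0 := cross_swap_ne_zero (cross_rotate_ne_zero hD)
  exact hne (arcChord_injOn hD' ht end_mem_arc (m1.trans m2.symm))

lemma quadrisections_eq_pair (hD : cross (B - A) (C - A) ≠ 0)
    (hiso : conway C A B = conway B C A) (h : 162 * conway A B C = 175 * conway B C A) :
    quadrisections ![A, B, C] = {arcChord A B C 0, arcChord B A C arcEnd} := by
  have hβ := base_conway_pos hD hiso
  ext q
  constructor
  · intro hq
    obtain ⟨t, ht, ⟨e, rfl⟩ | ⟨e, hq⟩⟩ := mem_isosceles hD hiso hq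
    · have h0 : arcP t = 175 / 162 := by
        have : conway B C A * (arcP t - 175 / 162) = 0 := by linarith
        rcases mul_eq_zero.1 this with h | h <;> linarith
      rw [eq_zero_of_arcP ht h0]
      exact mem_insert _ _
    · have hP := arcP_ge ht
      have hM := arcM_le ht
      rw [SideEq] at e
      have e1 : (conway A B C + conway B C A) * (arcP t - 1) +
          (conway A B C - conway B C A) * (1 - arcM t) = 0 := by linarith
      have e2 := mul_nonneg (by linarith : 0 ≤ conway A B C + conway B C A) (sub_nonneg.2 hP)
      have hend : t = arcEnd := by
        by_contra hne
        have := arcM_lt_one ht (lt_of_le_of_ne ht.2 hne)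
        have := mul_pos (by linarith : 0 < conway A B C - conway B C A) (sub_pos.2 this)
        linarith
      subst hend
      right
      rcases hq with rfl | rfl
      · rfl
      · exact arcChord_end_glue C A B
  · rintro (rfl | rfl)
    · exact base_mem hD hiso zero_mem_arc (by rw [arcP_zero]; linarith)
    · exact axis_mem hD hiso

lemma base_ne_axis (hD : cross (B - A) (C - A) ≠ 0) :
    arcChord A B C 0 ≠ arcChord B A C arcEnd :=
  arcChord_ne_of_side hD zero_mem_arc (by linarith [arcEnd_pos]) end_mem_arc

/-- Every quadrisection besides the axis pair and the symmetric one on the base has a distinct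
mirror image, so two quadrisections in all force the symmetric one on the base. -/
lemma conway_of_encard_eq_two (hD : cross (B - A) (C - A) ≠ 0)
    (hiso : conway C A B = conway B C A) (h : (quadrisections ![A, B, C]).encard = 2) :
    162 * conway A B C = 175 * conway B C A := by
  have hβ := base_conway_pos hD hiso
  have hDB : cross (A - B) (C - B) ≠ 0 := cross_swap_ne_zero (cross_rotate_ne_zero hD)
  have hDC : cross (A - C) (B - C) ≠ 0 := cross_rotate_ne_zero (cross_rotate_ne_zero hD)
  have hax := axis_mem hD hiso
  have hpos := arcEnd_pos
  have axis' : arcChord B A C arcEnd = arcChord C A B arcEnd := arcChord_end_glue B A C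
  by_contra hne
  -- A base solution is accompanied by its mirror image and the axis pair.
  have base : ∀ t ∈ Icc (-arcEnd) arcEnd, conway A B C ≠ conway B C A * arcP t := by
    intro t ht e
    have ht0 : t ≠ 0 := by
      rintro rfl
      rw [arcP_zero] at e
      exact hne (by linarith)
    have m1 := base_mem hD hiso ht e
    have m2 := base_mem hD hiso (neg_mem_arc ht) (by rwa [arcP_neg])
    have n1 : ∀ s ∈ Icc (-arcEnd) arcEnd, arcChord A B C s ≠ arcChord B A C arcEnd := by
      intro s hs
      rcases hs.1.eq_or_lt with hend | hlt
      · rw [← hend, ← arcChord_swap, neg_neg, arcChord_end_glue, ← arcChord_swap]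
        intro heq
        have := arcChord_injOn hDB (neg_mem_arc end_mem_arc) end_mem_arc heq
        linarith
      · exact arcChord_ne_of_side hD hs hlt end_mem_arc
    refine encard_ne_two_of_three m1 m2 hax ?_ (n1 t ht) (n1 _ (neg_mem_arc ht)) h
    intro heq
    have := arcChord_injOn hD ht (neg_mem_arc ht) heq
    exact ht0 (by linarith)
  obtain ⟨q, hq, hqne⟩ : ∃ q ∈ quadrisections ![A, B, C], q ≠ arcChord B A C arcEnd := by
    obtain ⟨x, y, hxy, hS⟩ := encard_eq_two.1 h
    rw [hS]
    by_cases hx : x = arcChord B A C arcEnd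
    · exact ⟨y, by simp, fun hy => hxy (hx.trans hy.symm)⟩
    · exact ⟨x, by simp, hx⟩
  obtain ⟨t, ht, ⟨e, rfl⟩ | ⟨e, hq⟩⟩ := mem_isosceles hD hiso hq
  · exact base t ht e
  · have htend : t ≠ arcEnd := by
      rintro rfl
      rcases hq with rfl | rfl
      · exact hqne rfl
      · exact hqne axis'.symm
    obtain ⟨m1, m2⟩ := leg_mem hD hiso ht e
    have hlt := lt_of_le_of_ne ht.2 htend
    refine encard_ne_two_of_three m1 m2 hax ?_ ?_ ?_ h
    · rw [← arcChord_swap C A B]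
      exact arcChord_ne_of_side' hDB ht hlt (neg_mem_arc ht)
    · intro heq
      exact htend (arcChord_injOn hDB ht end_mem_arc heq)
    · rw [axis']
      intro heq
      exact htend (arcChord_injOn hDC ht end_mem_arc heq)

end Isosceles

/-! ### Permutations, angles and similarity -/

lemma quadrisections_congr {T T' : Fin 3 → Plane} (h : range T = range T') :
    quadrisections T = quadrisections T' := by
  have hreg : triangleRegion T = triangleRegion T' := by rw [triangleRegion, h, triangleRegion]
  have hdiv : dividedRegions T = dividedRegions T' := by
    funext s t
    rw [dividedRegions, dividedRegions, hreg]
  have hq : ∀ X P Y Q, IsQuadrisection T X P Y Q ↔ IsQuadrisection T' X P Y Q := by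
    intro X P Y Q
    constructor <;> rintro ⟨h1, h2, h3, h4, h5, h6, h7, h8, h9⟩
    · exact ⟨hreg ▸ h1, hreg ▸ h2, hreg ▸ h3, hreg ▸ h4, h5, h6, h7, hdiv ▸ h8, hreg ▸ hdiv ▸ h9⟩
    · exact ⟨hreg ▸ h1, hreg ▸ h2, hreg ▸ h3, hreg ▸ h4, h5, h6, h7, hdiv ▸ h8, hreg ▸ hdiv ▸ h9⟩
  simp only [quadrisections, hq]

lemma range_triple (A B C : Plane) : range ![A, B, C] = {A, B, C} := by
  simp only [Matrix.range_cons, Matrix.range_empty, union_empty, singleton_union]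

lemma quadrisections_swap (A B C : Plane) :
    quadrisections ![A, C, B] = quadrisections ![A, B, C] :=
  quadrisections_congr (by rw [range_triple, range_triple, pair_comm])

lemma quadrisections_swap_left (A B C : Plane) :
    quadrisections ![B, A, C] = quadrisections ![A, B, C] :=
  quadrisections_congr (by rw [range_triple, range_triple, insert_comm])

lemma ObtuseEnough.comm {α β γ : ℝ} (h : ObtuseEnough α β γ) : ObtuseEnough α γ β := by
  rcases h with h | h
  · exact Or.inl h
  · exact Or.inr (by linarith)

/-- If some angle is large enough, so is the largest one. -/
lemma ObtuseEnough.of_le {α β γ : ℝ} (h : ObtuseEnough α β γ) (hβ : β ≤ α) (hγ : β ≤ γ)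
    (h2 : 0 < α + γ) (h3 : 0 < β + γ) : ObtuseEnough β α γ := by
  rcases h with h | h
  · exact Or.inl (by linarith)
  rcases le_or_gt β 0 with h0 | h0
  · exact Or.inl h0
  right
  have hα : 0 < α := by linarith
  have e1 : β ^ 2 * (α + γ) ≤ α ^ 2 * (β + γ) := by
    have : 0 ≤ (α - β) * (α * β + γ * (α + β)) := by
      refine mul_nonneg (by linarith) ?_
      have hγ0 : 0 < γ := by linarith
      positivity
    linarith
  have e2 : α ^ 2 * (β + γ) ≤ (√2 - 1) ^ 2 * ((α + β) * (α + γ)) * (β + γ) := by gcongr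
  have e3 : (β ^ 2 - (√2 - 1) ^ 2 * ((β + α) * (β + γ))) * (α + γ) ≤ 0 := by linarith
  have := nonpos_of_mul_nonpos_left e3 h2
  linarith

theorem encard_quadrisections_eq_one_of_obtuseEnough {A B C : Plane}
    (hD : cross (B - A) (C - A) ≠ 0)
    (h : ObtuseEnough (conway A B C) (conway B C A) (conway C A B)) :
    (quadrisections ![A, B, C]).encard = 1 := by
  -- First sort the two vertices other than the largest angle.
  have sorted : ∀ A B C : Plane, cross (B - A) (C - A) ≠ 0 →
      ObtuseEnough (conway A B C) (conway B C A) (conway C A B) →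
      conway A B C ≤ conway B C A → conway A B C ≤ conway C A B →
      (quadrisections ![A, B, C]).encard = 1 := by
    intro A B C hD h h1 h2
    rcases le_total (conway B C A) (conway C A B) with h3 | h3
    · exact encard_quadrisections_eq_one_of_sorted hD h1 h3 h
    · rw [← quadrisections_swap]
      have e1 := conway_swap A B C
      have e2 := conway_swap B C A
      have e3 := conway_swap C A B
      refine encard_quadrisections_eq_one_of_sorted (cross_swap_ne_zero hD) ?_ ?_ ?_
      · rw [e1, e3]; exact h2
      · rw [e2, e3]; exact h3
      · rw [e1, e2, e3]; exact h.comm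
  -- It may happen that `B` or `C` carries the largest angle; then one of these takes its place.
  have second : ∀ A B C : Plane, cross (B - A) (C - A) ≠ 0 →
      ObtuseEnough (conway A B C) (conway B C A) (conway C A B) →
      conway B C A ≤ conway A B C → conway B C A ≤ conway C A B →
      (quadrisections ![A, B, C]).encard = 1 := by
    intro A B C hD h h1 h2
    have p2 := conway_add_pos (cross_rotate_ne_zero hD)
    have p3 := conway_add_pos (cross_rotate_ne_zero (cross_rotate_ne_zero hD))
    rw [← quadrisections_swap_left]
    have e1 := conway_swap A B C
    have e2 := conway_swap B C A
    have e3 := conway_swap C A B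
    refine sorted B A C (cross_swap_ne_zero (cross_rotate_ne_zero hD)) ?_ ?_ ?_
    · rw [e1, e2, e3]; exact h.of_le h1 h2 (by linarith) p2
    · rw [e1, e2]; exact h1
    · rw [e2, e3]; exact h2
  rcases le_total (conway A B C) (conway B C A) with h1 | h1 <;>
    rcases le_total (conway A B C) (conway C A B) with h2 | h2
  · exact sorted A B C hD h h1 h2
  · rw [← quadrisections_swap]
    have e1 := conway_swap A B C
    have e2 := conway_swap B C A
    have e3 := conway_swap C A B
    refine second A C B (cross_swap_ne_zero hD) ?_ ?_ ?_
    · rw [e1, e2, e3]; exact h.comm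
    · rw [e1, e3]; exact h2
    · rw [e2, e3]; linarith
  · exact second A B C hD h h1 (by linarith)
  · rcases le_total (conway B C A) (conway C A B) with h3 | h3
    · exact second A B C hD h h1 h3
    · rw [← quadrisections_swap]
      have e1 := conway_swap A B C
      have e2 := conway_swap B C A
      have e3 := conway_swap C A B
      refine second A C B (cross_swap_ne_zero hD) ?_ ?_ ?_
      · rw [e1, e2, e3]; exact h.comm
      · rw [e1, e3]; exact h2
      · rw [e2, e3]; exact h3

lemma eq_triple (T : Fin 3 → Plane) : T = ![T 0, T 1, T 2] := by
  ext i; fin_cases i <;> rfl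

lemma cos_vertexAngle (T : Fin 3 → Plane) :
    Real.cos (vertexAngle T) =
      conway (T 0) (T 1) (T 2) / (dist (T 0) (T 1) * dist (T 0) (T 2)) := by
  rw [vertexAngle, EuclideanGeometry.angle, InnerProductGeometry.cos_angle, conway,
    dist_comm (T 0), dist_comm (T 0), dist_eq_norm, dist_eq_norm, vsub_eq_sub, vsub_eq_sub]

lemma vertexAngle_mem (T : Fin 3 → Plane) : vertexAngle T ∈ Icc 0 Real.pi :=
  ⟨EuclideanGeometry.angle_nonneg _ _ _, EuclideanGeometry.angle_le_pi _ _ _⟩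

lemma vertexAngle_le_iff (T T' : Fin 3 → Plane) :
    vertexAngle T ≤ vertexAngle T' ↔ Real.cos (vertexAngle T') ≤ Real.cos (vertexAngle T) :=
  (Real.strictAntiOn_cos.le_iff_ge (vertexAngle_mem T') (vertexAngle_mem T)).symm

lemma conway_add' (A B C : Plane) : conway A B C + conway C A B = dist A C ^ 2 := by
  rw [← conway_add A C B, conway_swap, conway_swap C A B]

lemma obtuseEnough_of_cos_le {T : Fin 3 → Plane}
    (hD : cross (T 1 - T 0) (T 2 - T 0) ≠ 0)
    (h : Real.cos (vertexAngle T) ≤ √2 - 1) :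
    ObtuseEnough (conway (T 0) (T 1) (T 2)) (conway (T 1) (T 2) (T 0))
      (conway (T 2) (T 0) (T 1)) := by
  rcases le_or_gt (conway (T 0) (T 1) (T 2)) 0 with h0 | h0
  · exact Or.inl h0
  right
  have hb : 0 < dist (T 0) (T 1) := by
    have := conway_add_pos hD
    rw [conway_add] at this
    exact lt_of_le_of_ne dist_nonneg fun h => by rw [← h] at this; norm_num at this
  have hc : 0 < dist (T 0) (T 2) := by
    have := conway_add_pos (cross_swap_ne_zero hD)
    rw [conway_add] at this
    exact lt_of_le_of_ne dist_nonneg fun h => by rw [← h] at this; norm_num at this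
  rw [cos_vertexAngle, div_le_iff₀ (mul_pos hb hc)] at h
  rw [conway_add, conway_add', ← mul_pow, ← mul_pow]
  gcongr

lemma isosceles_conway {T : Fin 3 → Plane} (hT : IsIsoscelesTriangle T) :
    conway (T 2) (T 0) (T 1) = conway (T 1) (T 2) (T 0) := by
  have h1 := conway_add (T 0) (T 1) (T 2)
  have h2 := conway_add' (T 0) (T 1) (T 2)
  rw [hT.2] at h1
  linarith

lemma isosceles_cos {T : Fin 3 → Plane} (hT : IsIsoscelesTriangle T) :
    Real.cos (vertexAngle T) = conway (T 0) (T 1) (T 2) /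
      (conway (T 0) (T 1) (T 2) + conway (T 1) (T 2) (T 0)) := by
  rw [cos_vertexAngle, conway_add, hT.2, sq]

/-- Two isosceles triangles are similar exactly when their Conway quantities are proportional. -/
lemma isosceles_similar_iff {T T' : Fin 3 → Plane} (hT : IsIsoscelesTriangle T)
    (hT' : IsIsoscelesTriangle T') :
    Similar T T' ↔ conway (T 0) (T 1) (T 2) * conway (T' 1) (T' 2) (T' 0) =
      conway (T' 0) (T' 1) (T' 2) * conway (T 1) (T 2) (T 0) := by
  have a1 := conway_add (T 0) (T 1) (T 2)
  have a2 := conway_add (T 1) (T 2) (T 0)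
  have b1 := conway_add (T' 0) (T' 1) (T' 2)
  have b2 := conway_add (T' 1) (T' 2) (T' 0)
  have ia := isosceles_conway hT
  have ib := isosceles_conway hT'
  rw [ia] at a2
  rw [ib] at b2
  have hβ := base_conway_pos (cross_ne_zero_of_affineIndependent hT.1) ia
  have hβ' := base_conway_pos (cross_ne_zero_of_affineIndependent hT'.1) ib
  constructor
  · intro h
    obtain ⟨r, -, hr⟩ := h.exists_dist_eq
    rw [hr] at a1 a2
    have e1 : conway (T 1) (T 2) (T 0) = r ^ 2 * conway (T' 1) (T' 2) (T' 0) := by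
      linear_combination (1 / 2) * a2 - (r : ℝ) ^ 2 / 2 * b2
    have e2 : conway (T 0) (T 1) (T 2) = r ^ 2 * conway (T' 0) (T' 1) (T' 2) := by
      linear_combination a1 - (r : ℝ) ^ 2 * b1 - e1
    rw [e1, e2]; ring
  · intro h
    set β := conway (T 1) (T 2) (T 0)
    set β' := conway (T' 1) (T' 2) (T' 0)
    have hr : 0 < √(β / β') := Real.sqrt_pos.2 (div_pos hβ hβ')
    have hr2 : √(β / β') ^ 2 = β / β' := Real.sq_sqrt (div_pos hβ hβ').le
    have scale : ∀ x y : ℝ, 0 ≤ x → 0 ≤ y → x ^ 2 * β' = β * y ^ 2 → x = √(β / β') * y := by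
      intro x y hx hy hxy
      refine (sq_eq_sq₀ hx (mul_nonneg hr.le hy)).1 ?_
      rw [mul_pow, hr2]
      field_simp
      linarith
    have d01 : dist (T 0) (T 1) = √(β / β') * dist (T' 0) (T' 1) := by
      refine scale _ _ dist_nonneg dist_nonneg ?_
      rw [← a1, ← b1]; linarith
    have d12 : dist (T 1) (T 2) = √(β / β') * dist (T' 1) (T' 2) := by
      refine scale _ _ dist_nonneg dist_nonneg ?_
      rw [← a2, ← b2]; ring
    have d02 : dist (T 0) (T 2) = √(β / β') * dist (T' 0) (T' 2) := by
      rw [← hT.2, ← hT'.2, d01]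
    refine similar_iff_exists_pos_dist_eq.2 ⟨√(β / β'), hr, ?_⟩
    have d10 := d01
    have d21 := d12
    have d20 := d02
    rw [dist_comm (T 0), dist_comm (T' 0)] at d10 d20
    rw [dist_comm (T 1), dist_comm (T' 1)] at d21
    intro i j
    fin_cases i <;> fin_cases j <;> simp <;> assumption

/-! ### The triangles `I₁` and `I₂` -/

lemma triangleI₂_apply : triangleI₂ 0 = !₂[1 / 2, 8 / 9] ∧ triangleI₂ 1 = !₂[0, 0] ∧
    triangleI₂ 2 = !₂[1, 0] := ⟨rfl, rfl, rfl⟩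

lemma triangleI₁_apply : triangleI₁ 0 = !₂[1, 0] ∧ triangleI₁ 1 = !₂[0, 0] ∧
    triangleI₁ 2 = !₂[2 - √2, √(2 * √2 - 2)] := ⟨rfl, rfl, rfl⟩

lemma cross_I₂ : cross (triangleI₂ 1 - triangleI₂ 0) (triangleI₂ 2 - triangleI₂ 0) = 8 / 9 := by
  norm_num [cross_sub_sub, triangleI₂_apply]

lemma conway_I₂_apex : conway (triangleI₂ 0) (triangleI₂ 1) (triangleI₂ 2) = 175 / 324 := by
  norm_num [conway_eq, triangleI₂_apply]

lemma conway_I₂_base : conway (triangleI₂ 1) (triangleI₂ 2) (triangleI₂ 0) = 1 / 2 := by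
  norm_num [conway_eq, triangleI₂_apply]

lemma isosceles_I₂ : IsIsoscelesTriangle triangleI₂ := by
  refine ⟨affineIndependent_of_cross_ne_zero (by rw [cross_I₂]; norm_num), ?_⟩
  rw [EuclideanSpace.dist_eq, EuclideanSpace.dist_eq]
  congr 1
  norm_num [Fin.sum_univ_two, triangleI₂_apply, Real.dist_eq]

lemma cos_vertexAngle_I₂ : Real.cos (vertexAngle triangleI₂) = 175 / 337 := by
  rw [isosceles_cos isosceles_I₂, conway_I₂_apex, conway_I₂_base]
  norm_num

lemma vertexAngle_I₂ : vertexAngle triangleI₂ = 2 * Real.arctan (9 / 16) := by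
  have h1 : 0 < Real.arctan (9 / 16) := Real.arctan_pos.2 (by norm_num)
  have h2 := Real.arctan_lt_pi_div_two (9 / 16)
  refine Real.injOn_cos (vertexAngle_mem _) ⟨by linarith, by linarith⟩ ?_
  rw [cos_vertexAngle_I₂, Real.cos_two_mul, Real.cos_sq_arctan]
  norm_num

lemma sin_vertexAngle (T : Fin 3 → Plane) :
    Real.sin (vertexAngle T) = √(1 - Real.cos (vertexAngle T) ^ 2) := by
  rw [← Real.sin_sq_add_cos_sq (vertexAngle T), add_sub_cancel_right,
    Real.sqrt_sq (Real.sin_nonneg_of_mem_Icc (vertexAngle_mem T))]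

lemma lt_of_sin_lt {x y : ℝ} (hx : x ∈ Icc (-(Real.pi / 2)) (Real.pi / 2))
    (hy : y ∈ Icc (-(Real.pi / 2)) (Real.pi / 2)) (h : Real.sin x < Real.sin y) : x < y :=
  (Real.strictMonoOn_sin.lt_iff_lt hx hy).1 h

lemma sqrt_three_bounds : 1.7320508 < √3 ∧ √3 < 1.7320509 := by
  constructor
  · exact Real.lt_sqrt_of_sq_lt (by norm_num)
  · rw [Real.sqrt_lt' (by norm_num)]; norm_num

lemma vertexAngle_I₂_lt : vertexAngle triangleI₂ < Real.pi / 3 := by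
  rw [← not_le]
  intro h
  have := Real.strictAntiOn_cos.antitoneOn (a := Real.pi / 3) (b := vertexAngle triangleI₂)
    ⟨by positivity, by linarith [Real.pi_pos]⟩ (vertexAngle_mem _) h
  rw [Real.cos_pi_div_three, cos_vertexAngle_I₂] at this
  norm_num at this

/-- The value in degrees is read off from the sine of the small difference to `π / 3`. -/
lemma vertexAngle_I₂_degrees :
    |vertexAngle triangleI₂ * (180 / Real.pi) - 58.72| < 0.005 := by
  have hπ := Real.pi_pos
  have hπ1 := Real.pi_gt_d6
  have hπ2 := Real.pi_lt_d6
  have hq := sqrt_three_bounds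
  obtain ⟨h0, -⟩ := vertexAngle_mem triangleI₂
  have hlt := vertexAngle_I₂_lt
  have hs : Real.sin (vertexAngle triangleI₂) = 288 / 337 := by
    rw [sin_vertexAngle, cos_vertexAngle_I₂, show (1 : ℝ) - (175 / 337) ^ 2 = (288 / 337) ^ 2 by
      norm_num, Real.sqrt_sq (by norm_num)]
  have hψ : Real.sin (Real.pi / 3 - vertexAngle triangleI₂) =
      √3 / 2 * (175 / 337) - 1 / 2 * (288 / 337) := by
    rw [Real.sin_sub, Real.sin_pi_div_three, Real.cos_pi_div_three, hs, cos_vertexAngle_I₂]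
  have upper : Real.pi / 3 - vertexAngle triangleI₂ < 1.285 * Real.pi / 180 := by
    refine lt_of_sin_lt ⟨by linarith, by linarith⟩ ⟨by linarith, by linarith⟩ ?_
    have hb : (0 : ℝ) < 1.285 * Real.pi / 180 := by positivity
    have h3 : 1.285 * Real.pi / 180 < 0.02243 := by linarith
    have h4 : (1.285 * Real.pi / 180) ^ 3 < 0.02243 ^ 3 := by gcongr
    have := Real.sin_gt_sub_cube hb
    rw [hψ]
    norm_num at h4
    linarith
  have lower : 1.275 * Real.pi / 180 < Real.pi / 3 - vertexAngle triangleI₂ := by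
    refine lt_of_sin_lt ⟨by linarith, by linarith⟩ ⟨by linarith, by linarith⟩ ?_
    have := Real.sin_lt (x := 1.275 * Real.pi / 180) (by positivity)
    rw [hψ]
    linarith
  rw [abs_lt]
  have e : vertexAngle triangleI₂ * (180 / Real.pi) - 58.72 =
      (vertexAngle triangleI₂ * 180 - 58.72 * Real.pi) / Real.pi := by field_simp
  rw [e, lt_div_iff₀ hπ, div_lt_iff₀ hπ]
  constructor <;> linarith

lemma sqrt_I₁_sq : √(2 * √2 - 2) ^ 2 = 2 * √2 - 2 :=
  Real.sq_sqrt (by linarith [sqrt_two_bounds.1])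

lemma cross_I₁ : cross (triangleI₁ 1 - triangleI₁ 0) (triangleI₁ 2 - triangleI₁ 0) =
    -√(2 * √2 - 2) := by
  norm_num [cross_sub_sub, triangleI₁_apply]

lemma conway_I₁_apex : conway (triangleI₁ 0) (triangleI₁ 1) (triangleI₁ 2) = √2 - 1 := by
  norm_num [conway_eq, triangleI₁_apply]
  ring

lemma conway_I₁_base : conway (triangleI₁ 1) (triangleI₁ 2) (triangleI₁ 0) = 2 - √2 := by
  norm_num [conway_eq, triangleI₁_apply]

lemma isosceles_I₁ : IsIsoscelesTriangle triangleI₁ := by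
  refine ⟨affineIndependent_of_cross_ne_zero ?_, ?_⟩
  · rw [cross_I₁, neg_ne_zero]
    exact (Real.sqrt_pos.2 (by linarith [sqrt_two_bounds.1])).ne'
  · rw [EuclideanSpace.dist_eq, EuclideanSpace.dist_eq]
    congr 1
    have h2 := sqrt_two_sq
    simp only [Fin.sum_univ_two, triangleI₁_apply, Real.dist_eq, sq_abs]
    simp
    linear_combination -h2

lemma cos_vertexAngle_I₁ : Real.cos (vertexAngle triangleI₁) = √2 - 1 := by
  rw [isosceles_cos isosceles_I₁, conway_I₁_apex, conway_I₁_base]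
  norm_num

lemma one_sub_cos_sq_I₁ : 1 - (√2 - 1) ^ 2 = 2 * √2 - 2 := by
  linear_combination -sqrt_two_sq

lemma vertexAngle_I₁ : vertexAngle triangleI₁ = Real.arcsin (√(2 * √2 - 2)) := by
  rw [← one_sub_cos_sq_I₁, ← Real.arccos_eq_arcsin (by linarith [sqrt_two_bounds.1]),
    ← cos_vertexAngle_I₁, Real.arccos_cos (vertexAngle_mem _).1 (vertexAngle_mem _).2]

lemma pi_div_three_lt_iff {T : Fin 3 → Plane} :
    Real.pi / 3 < vertexAngle T ↔ Real.cos (vertexAngle T) < 1 / 2 := by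
  rw [← Real.cos_pi_div_three]
  exact (Real.strictAntiOn_cos.lt_iff_gt (vertexAngle_mem T)
    ⟨by positivity, by linarith [Real.pi_pos]⟩).symm

lemma pi_div_three_lt_I₁ : Real.pi / 3 < vertexAngle triangleI₁ := by
  rw [pi_div_three_lt_iff, cos_vertexAngle_I₁]
  linarith [sqrt_two_bounds.2]

lemma vertexAngle_I₁_degrees :
    |vertexAngle triangleI₁ * (180 / Real.pi) - 65.53| < 0.005 := by
  have hπ := Real.pi_pos
  have hπ1 := Real.pi_gt_d6
  have hπ2 := Real.pi_lt_d6
  have hq := sqrt_three_bounds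
  have hr1 : 1.4142135 < √2 := Real.lt_sqrt_of_sq_lt (by norm_num)
  have hr2 : √2 < 1.4142136 := by rw [Real.sqrt_lt' (by norm_num)]; norm_num
  have hlt := pi_div_three_lt_I₁
  have hle : vertexAngle triangleI₁ ≤ Real.pi / 2 := by
    rw [vertexAngle_I₁]; exact Real.arcsin_le_pi_div_two _
  have hs : Real.sin (vertexAngle triangleI₁) = √(2 * √2 - 2) := by
    rw [sin_vertexAngle, cos_vertexAngle_I₁, one_sub_cos_sq_I₁]
  have hs1 : 0.91017 < √(2 * √2 - 2) := by
    apply Real.lt_sqrt_of_sq_lt; norm_num; linarith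
  have hs2 : √(2 * √2 - 2) < 0.91019 := by
    rw [Real.sqrt_lt' (by norm_num)]; norm_num; linarith
  have hψ : Real.sin (vertexAngle triangleI₁ - Real.pi / 3) =
      √(2 * √2 - 2) * (1 / 2) - (√2 - 1) * (√3 / 2) := by
    rw [Real.sin_sub, Real.sin_pi_div_three, Real.cos_pi_div_three, hs, cos_vertexAngle_I₁]
  have hprod1 : 0.71743 < (√2 - 1) * √3 := by nlinarith
  have hprod2 : (√2 - 1) * √3 < 0.71745 := by nlinarith
  have upper : vertexAngle triangleI₁ - Real.pi / 3 < 5.535 * Real.pi / 180 := by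
    refine lt_of_sin_lt ⟨by linarith, by linarith⟩ ⟨by linarith, by linarith⟩ ?_
    have hb : (0 : ℝ) < 5.535 * Real.pi / 180 := by positivity
    have h3 : 5.535 * Real.pi / 180 < 0.09661 := by linarith
    have h4 : (5.535 * Real.pi / 180) ^ 3 < 0.09661 ^ 3 := by gcongr
    have := Real.sin_gt_sub_cube hb
    rw [hψ]
    norm_num at h4
    linarith
  have lower : 5.525 * Real.pi / 180 < vertexAngle triangleI₁ - Real.pi / 3 := by
    refine lt_of_sin_lt ⟨by linarith, by linarith⟩ ⟨by linarith, by linarith⟩ ?_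
    have hb : (0 : ℝ) < 5.525 * Real.pi / 180 := by positivity
    have h3 : 5.525 * Real.pi / 180 < 0.09643 := by linarith
    have h3' : 0.09642 < 5.525 * Real.pi / 180 := by linarith
    have h4 : (0.09642 : ℝ) ^ 3 < (5.525 * Real.pi / 180) ^ 3 := by gcongr
    have h5 : (5.525 * Real.pi / 180) ^ 5 < 0.09643 ^ 5 := by gcongr
    have := (abs_le.1 (Real.sin_bound (x := 5.525 * Real.pi / 180)
      (by rw [abs_of_pos hb]; linarith))).2
    rw [abs_of_pos hb] at this
    rw [hψ]
    norm_num at h4 h5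
    linarith
  rw [abs_lt]
  have e : vertexAngle triangleI₁ * (180 / Real.pi) - 65.53 =
      (vertexAngle triangleI₁ * 180 - 65.53 * Real.pi) / Real.pi := by field_simp
  rw [e, lt_div_iff₀ hπ, div_lt_iff₀ hπ]
  constructor <;> linarith

/-- A triangle with an angle at least that of `I₁` has exactly one quadrisection. -/
lemma encard_eq_one_of_angle {T : Fin 3 → Plane} (hT : AffineIndependent ℝ T)
    (h : ∃ σ : Equiv.Perm (Fin 3), vertexAngle triangleI₁ ≤ vertexAngle (T ∘ σ)) :
    (quadrisections T).encard = 1 := by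
  obtain ⟨σ, h⟩ := h
  have hT' : AffineIndependent ℝ (T ∘ σ) := hT.comp_embedding σ.toEmbedding
  have hD := cross_ne_zero_of_affineIndependent hT'
  rw [vertexAngle_le_iff, cos_vertexAngle_I₁] at h
  rw [← quadrisections_congr (σ.surjective.range_comp T), eq_triple (T ∘ σ)]
  exact encard_quadrisections_eq_one_of_obtuseEnough hD (obtuseEnough_of_cos_le hD h)

lemma encard_eq_two_iff_similar {T : Fin 3 → Plane} (hT : IsIsoscelesTriangle T) :
    (quadrisections T).encard = 2 ↔ Similar T triangleI₂ := by
  have hD := cross_ne_zero_of_affineIndependent hT.1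
  rw [isosceles_similar_iff hT isosceles_I₂, conway_I₂_apex, conway_I₂_base]
  constructor
  · intro h
    rw [eq_triple T] at h
    have := conway_of_encard_eq_two hD (isosceles_conway hT) h
    linarith
  · intro h
    rw [eq_triple T, quadrisections_eq_pair hD (isosceles_conway hT) (by linarith)]
    exact encard_pair (base_ne_axis hD)

lemma vertexAngle_I₁_lt {T : Fin 3 → Plane} (hT : IsIsoscelesTriangle T)
    (h60 : Real.pi / 3 < vertexAngle T) (h1 : (quadrisections T).encard = 1)
    (hns : ¬ Similar T triangleI₁) : vertexAngle triangleI₁ < vertexAngle T := by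
  by_contra hle
  rw [not_lt, vertexAngle_le_iff, cos_vertexAngle_I₁] at hle
  rw [pi_div_three_lt_iff] at h60
  have hD := cross_ne_zero_of_affineIndependent hT.1
  have hpos := conway_add_pos hD
  have hq := sqrt_two_bounds
  have hq2 := sqrt_two_sq
  rw [isosceles_cos hT, le_div_iff₀ hpos] at hle
  rw [isosceles_cos hT, div_lt_iff₀ hpos] at h60
  rw [isosceles_similar_iff hT isosceles_I₁, conway_I₁_apex, conway_I₁_base] at hns
  rw [eq_triple T] at h1
  refine encard_ne_one_of_between hD (isosceles_conway hT) (by linarith) ?_ h1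
  refine lt_of_le_of_ne (by nlinarith) fun he => hns ?_
  rw [he]
  linear_combination (-conway (T 0) (T 1) (T 2)) * hq2

lemma IsRationalPoint.sidePoint {U V : Plane} (hU : IsRationalPoint U) (hV : IsRationalPoint V)
    {x : ℝ} {r : ℚ} (hx : x = r) : IsRationalPoint (sidePoint x U V) := by
  intro i
  obtain ⟨u, hu⟩ := hU i
  obtain ⟨v, hv⟩ := hV i
  exact ⟨r * u + (1 - r) * v, by rw [sidePoint_apply, hu, hv, hx]; push_cast; ring⟩

lemma isRationalPoint_I₂ (i : Fin 3) : IsRationalPoint (triangleI₂ i) := by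
  intro j
  fin_cases i <;> fin_cases j
  · exact ⟨1 / 2, by simp [triangleI₂_apply]⟩
  · exact ⟨8 / 9, by simp [triangleI₂_apply]⟩
  · exact ⟨0, by simp [triangleI₂_apply]⟩
  · exact ⟨0, by simp [triangleI₂_apply]⟩
  · exact ⟨1, by simp [triangleI₂_apply]⟩
  · exact ⟨0, by simp [triangleI₂_apply]⟩

lemma arcX_zero : arcX 0 = 5 / 6 := by norm_num [arcX, arcV]

lemma quadrisections_I₂ : quadrisections triangleI₂ =
    {arcChord (triangleI₂ 0) (triangleI₂ 1) (triangleI₂ 2) 0,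
      arcChord (triangleI₂ 1) (triangleI₂ 0) (triangleI₂ 2) arcEnd} := by
  have h := quadrisections_eq_pair (A := triangleI₂ 0) (B := triangleI₂ 1) (C := triangleI₂ 2)
    (by rw [cross_I₂]; norm_num) (isosceles_conway isosceles_I₂)
    (by rw [conway_I₂_apex, conway_I₂_base]; norm_num)
  rwa [← eq_triple] at h

/-- A segment determines its rightmost endpoint, so a segment with an irrational one has no rational
endpoints. -/
lemma segment_ne_of_irrational {a b U V : Plane} (ha : IsRationalPoint a)
    (hb : IsRationalPoint b) (hUV : V 0 ≤ U 0) (hU : Irrational (U 0)) :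
    segment ℝ a b ≠ segment ℝ U V := by
  intro h
  have le_U : ∀ z ∈ segment ℝ U V, z 0 ≤ U 0 := by
    rintro _ ⟨r, s, hr, hs, hrs, rfl⟩
    simp only [PiLp.add_apply, PiLp.smul_apply, smul_eq_mul]
    have : r * U 0 + s * V 0 ≤ r * U 0 + s * U 0 := by gcongr
    rw [← add_mul, hrs, one_mul] at this
    exact this
  have h1 := le_U a (h ▸ left_mem_segment ℝ a b)
  have h2 := le_U b (h ▸ right_mem_segment ℝ a b)
  obtain ⟨r, s, hr, hs, hrs, hz⟩ := h.symm ▸ left_mem_segment ℝ U V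
  have h3 := congrArg (fun z : Plane => z 0) hz
  simp only [PiLp.add_apply, PiLp.smul_apply, smul_eq_mul] at h3
  obtain ⟨u, hu⟩ := ha 0
  obtain ⟨v, hv⟩ := hb 0
  have h4 : a 0 < U 0 := lt_of_le_of_ne h1 fun he => hU ⟨u, by rw [← hu, he]⟩
  have h5 : b 0 < U 0 := lt_of_le_of_ne h2 fun he => hU ⟨v, by rw [← hv, he]⟩
  rcases hr.eq_or_lt with rfl | hr
  · obtain rfl : s = 1 := by linarith
    linarith
  · have h6 : r * (U 0 - a 0) + s * (U 0 - b 0) = 0 := by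
      linear_combination U 0 * hrs - h3
    linarith [mul_pos hr (sub_pos.2 h4), mul_nonneg hs (sub_pos.2 h5).le]

lemma axis_I₂_not_rational :
    arcChord (triangleI₂ 1) (triangleI₂ 0) (triangleI₂ 2) arcEnd ∉
      rationalQuadrisections triangleI₂ := by
  rintro ⟨-, X, P, Y, Q, -, hX, hP, hY, hQ, h⟩
  rw [arcChord_end] at h
  have hU : sidePoint (√2 / 2) (triangleI₂ 2) (triangleI₂ 0) 0 = 1 / 2 + √2 / 4 := by
    rw [sidePoint_apply]
    simp [triangleI₂_apply]
    ring
  have hV : sidePoint (√2 / 2) (triangleI₂ 1) (triangleI₂ 0) 0 = 1 / 2 - √2 / 4 := by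
    rw [sidePoint_apply]
    simp [triangleI₂_apply]
    ring
  have hirr : Irrational (sidePoint (√2 / 2) (triangleI₂ 2) (triangleI₂ 0) 0) := by
    rw [hU]
    rintro ⟨r, hr⟩
    exact irrational_sqrt_two ⟨4 * r - 2, by push_cast; rw [hr]; ring⟩
  have hle : sidePoint (√2 / 2) (triangleI₂ 1) (triangleI₂ 0) 0 ≤
      sidePoint (√2 / 2) (triangleI₂ 2) (triangleI₂ 0) 0 := by
    rw [hU, hV]
    linarith [sqrt_two_bounds.1]
  rcases Sym2.eq_iff.1 h with ⟨-, h2⟩ | ⟨-, h2⟩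
  · exact segment_ne_of_irrational hY hQ hle hirr h2.symm
  · exact segment_ne_of_irrational hX hP hle hirr h2.symm

lemma base_I₂_rational :
    arcChord (triangleI₂ 0) (triangleI₂ 1) (triangleI₂ 2) 0 ∈
      rationalQuadrisections triangleI₂ := by
  have harc : IsArc (5 / 6) (5 / 6) := by constructor <;> norm_num
  have hperp : PerpCond (triangleI₂ 0) (triangleI₂ 1) (triangleI₂ 2) (5 / 6) (5 / 6) := by
    rw [PerpCond, isosceles_conway isosceles_I₂, conway_I₂_apex, conway_I₂_base]
    norm_num
  have hq := isQuadrisection_of_isArc isosceles_I₂.1 (i := 0) (j := 1) (k := 2) (by decide)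
    (by decide) (by decide) harc hperp
  have h56 : (5 / 6 : ℝ) = ((5 / 6 : ℚ) : ℝ) := by norm_num
  have h35 : (1 / (2 * (5 / 6)) : ℝ) = ((3 / 5 : ℚ) : ℝ) := by norm_num
  have hr := isRationalPoint_I₂
  refine ⟨hr, _, _, _, _, hq, (hr 1).sidePoint (hr 2) h56, (hr 0).sidePoint (hr 2) h35,
    (hr 2).sidePoint (hr 1) h56, (hr 0).sidePoint (hr 1) h35, ?_⟩
  rw [arcChord, neg_zero, arcX_zero, chordPair]

theorem mainTheorem3 :
    -- `I₂` is isosceles; its vertex angle, exactly and in degrees to two decimals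
    (IsIsoscelesTriangle triangleI₂ ∧
      vertexAngle triangleI₂ = 2 * Real.arctan (9 / 16) ∧
      |vertexAngle triangleI₂ * (180 / Real.pi) - 58.72| < 0.005) ∧
    -- up to similarity, `I₂` is the only isosceles triangle with exactly two quadrisections
    (quadrisections triangleI₂).encard = 2 ∧
    (∀ T : Fin 3 → Plane, IsIsoscelesTriangle T →
      ((quadrisections T).encard = 2 ↔ Similar T triangleI₂)) ∧
    -- one of the two quadrisections of `I₂` is rational
    (∃! q : Sym2 (Set Plane), q ∈ quadrisections triangleI₂ ∧
      q ∈ rationalQuadrisections triangleI₂) ∧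
    -- `I₁` is isosceles; its vertex angle; it has only one quadrisection
    (IsIsoscelesTriangle triangleI₁ ∧
      vertexAngle triangleI₁ = Real.arcsin (√(2 * √2 - 2)) ∧
      |vertexAngle triangleI₁ * (180 / Real.pi) - 65.53| < 0.005 ∧
      Real.pi / 3 < vertexAngle triangleI₁ ∧
      (quadrisections triangleI₁).encard = 1) ∧
    -- every other isosceles triangle with these two properties has a larger vertex angle
    (∀ T : Fin 3 → Plane, IsIsoscelesTriangle T → Real.pi / 3 < vertexAngle T →
      (quadrisections T).encard = 1 → ¬ Similar T triangleI₁ →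
      vertexAngle triangleI₁ < vertexAngle T) ∧
    -- a triangle with some angle at least the vertex angle of `I₁` has only one quadrisection
    (∀ T : Fin 3 → Plane, AffineIndependent ℝ T →
      (∃ σ : Equiv.Perm (Fin 3), vertexAngle triangleI₁ ≤ vertexAngle (T ∘ σ)) →
      (quadrisections T).encard = 1) := by
  refine ⟨⟨isosceles_I₂, vertexAngle_I₂, vertexAngle_I₂_degrees⟩, ?_,
    fun T hT => encard_eq_two_iff_similar hT, ?_,
    ⟨isosceles_I₁, vertexAngle_I₁, vertexAngle_I₁_degrees, pi_div_three_lt_I₁, ?_⟩,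
    fun T hT h60 h1 hns => vertexAngle_I₁_lt hT h60 h1 hns,
    fun T hT h => encard_eq_one_of_angle hT h⟩
  · rw [encard_eq_two_iff_similar isosceles_I₂, isosceles_similar_iff isosceles_I₂ isosceles_I₂]
  · refine ⟨arcChord (triangleI₂ 0) (triangleI₂ 1) (triangleI₂ 2) 0, ⟨?_, base_I₂_rational⟩, ?_⟩
    · rw [quadrisections_I₂]
      exact mem_insert _ _
    · rintro q ⟨hq, hr⟩
      rw [quadrisections_I₂] at hq
      rcases hq with rfl | rfl
      · rfl
      · exact absurd hr axis_I₂_not_rational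
  · exact encard_eq_one_of_angle isosceles_I₁.1 ⟨1, le_rfl⟩
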